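/- **The disk.** Let $M=L_3$ be the closed unit disk whose boundary circle is divided, counterclockwise, into six closed intervals meeting only at end points: $\partial_1M$, a black interval, $\partial_2^{(1)}M$, a black interval, $\partial_2^{(2)}M$, a black interval; put $\partial_2M=\partial_2^{(1)}M\sqcup\partial_2^{(2)}M$. All intervals carry the counterclockwise orientation. Let $\alpha=(\alpha^{ij})$ be a constant Poisson structure on $\mathbb R^d$, and let $\hbar\in\mathbb R\setminus\{0\}$. **Fields.** The boundary fields are $\mathbb X_i\in\Omega^\bullet(\partial_1M)$ of total degree $0$, $1\le i\le d$, and $\mathbb E_i\in\Omega^\bullet(\partial_2M)$ of total degree $1$ whose restriction to the end points of the intervals vanishes; components of odd internal degree are Grassmann-odd. Forms are multiplied with signs according to total degree (form degree plus internal degree), and $\int_\gamma$ over a curve acts from the left as an operation of degree $-1$; in particular $\int_{\gamma\times\gamma'}=\int_\gamma\int_{\gamma'}$ and $\int_{\gamma}\int_{\gamma'}ds\wedge dt\,f=-\iint f\,ds\,dt$. Functional derivatives are left derivatives: $\delta F=\int_{\partial_1M}\delta\mathbb X_i\wedge\frac{\delta F}{\delta\mathbb X_i}$ and $\delta F=\int_{\partial_2M}\delta\mathbb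 E_i\wedge\frac{\delta F}{\delta\mathbb E_i}$. The one-forms $dx^i$ on the space $\mathbb R^d\ni x$ of backgrounds are odd, and $\mathrm d=dx^i\partial/\partial x^i$. Repeated indices are summed. **Propagator.** Let $\zeta$ be any propagator: a real closed one-form $\zeta(u,v)$, smooth on $\{(u,v)\in M\times M: u\neq v\}$, with $|\zeta(u,v)|\le C/|u-v|$, with period $1$ when $u$ runs once counterclockwise around an interior point $v$, and whose pull-back vanishes for $u\in\overline{\partial M\setminus\partial_1M}$ and for $v\in\partial_1M$. Write $\zeta_{ab}=\zeta(u_a,u_b)$, and for $u_2\ne u_3$ in $\partial_2M$ let $\widehat\zeta^\partial_{23}=\int_{M\ni u_1}\zeta_{12}\wedge\zeta_{13}$ with the standard orientation of $M$. **State.** Let $\widehat\psi_{L_3}=e^{\frac{i}{\hbar}\mathcal S^{\rm eff}_{\partial M}}$, where $$\mathcal S^{\rm eff}_{\partial M}=-\sum_{k=1}^2\int_{\partial_2^{(k)}M\times\partial_1M}\pi_1^*\mathbb E_i\wedge\zeta_{0\nu}\wedge\pi_2^*\mathbb X_i+\frac12\alpha^{ij}\sum_{k=1}^2\int_{C_2(\partial_2^{(k)}M)}\pi_1^*\mathbb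 E_i\wedge\widehat\zeta^\partial_{23}\wedge\pi_2^*\mathbb E_j+\alpha^{ij}\int_{\partial_2^{(1)}M\times\partial_2^{(2)}M}\pi_1^*\mathbb E_i\wedge\widehat\zeta^\partial_{23}\wedge\pi_2^*\mathbb E_j .$$ Here $u_0\in\partial_1M$, $u_\nu,u_2,u_3\in\partial_2M$, and $C_2(I)$ is the space of pairs of distinct points of $I$, oriented as $I\times I$. **Boundary operator.** Let $\Omega^{(3)}=\Omega^{(3)}_{\rm pert}+\Omega^{(3)}_0$ with $$\Omega^{(3)}_{\rm pert}=-\frac12\alpha^{ij}\Big(\hbar^2\int_{\partial_1M}\frac{\delta}{\delta\mathbb X_i}\frac{\delta}{\delta\mathbb X_j}-\int_{\partial_2M}\mathbb E_i\wedge\mathbb E_j\Big),$$ $$\Omega^{(3)}_0=i\hbar\Big(\int_{\partial_1M}\mathrm d\mathbb X_i\frac{\delta}{\delta\mathbb X_i}+\int_{\partial_2M}\mathrm d\mathbb E_i\frac{\delta}{\delta\mathbb E_i}+\int_{\partial_1M}dx^i\frac{\delta}{\delta\mathbb X_i}+\frac{i}{\hbar}\int_{\partial_2M}\mathbb E_i\wedge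 dx^i\Big).$$ In the second-order term the two derivatives are restricted to the diagonal of $\partial_1M\times\partial_1M$. **Claim.** The relative cohomologies $H^\bullet(M,\partial_1M)$ and $H^\bullet(M,\overline{\partial M\setminus\partial_1M})$ vanish, so there are no residual fields. All functional derivatives needed in $\Omega^{(3)}\widehat\psi_{L_3}$ exist. The state satisfies the modified differential quantum master equation $$\Big(\mathrm d+i\hbar\Delta+\frac i\hbar\Omega^{(3)}\Big)\widehat\psi_{L_3}=0,$$ where $\Delta$ is the BV Laplacian on the (trivial) space of residual fields, and, in its reduced form, $\Omega^{(3)}\widehat\psi_{L_3}=0$. This holds for every propagator, every background $x\in\mathbb R^d$ and all boundary fields. -/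

import Mathlib

open Set MeasureTheory
open scoped ContDiff

noncomputable section

namespace PSM

/-! ## Coefficients

Graded functionals are treated through their values on fields with coefficients in an infinitely
generated Grassmann algebra over `ℂ` (the functor of points).  Among the odd generators are
`dx¹, …, dxᵈ`, so an element is at the same time a differential form on the space `ℝᵈ` of
backgrounds, taken at a point; the further odd generators, indexed by `ℕ`, are auxiliary. -/

/-- The Grassmann algebra of coefficients. -/
abbrev Coef (d : ℕ) : Type := ExteriorAlgebra ℂ ((Fin d ⊕ ℕ) →₀ ℂ)

/-- The one-form `dxⁱ` on the space of backgrounds. -/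
def dx {d : ℕ} (i : Fin d) : Coef d := ExteriorAlgebra.ι ℂ (Finsupp.single (Sum.inl i) 1)

/-- `a` is homogeneous of parity `p`. -/
def HasParity {d : ℕ} (p : ZMod 2) (a : Coef d) : Prop :=
  a ∈ CliffordAlgebra.evenOdd (0 : QuadraticForm ℂ ((Fin d ⊕ ℕ) →₀ ℂ)) p

/-- The parity involution: `a` on even elements, `-a` on odd ones. -/
def inv {d : ℕ} (a : Coef d) : Coef d :=
  CliffordAlgebra.involute (Q := (0 : QuadraticForm ℂ ((Fin d ⊕ ℕ) →₀ ℂ))) a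

/-- The body (component of degree zero) of a Grassmann number. -/
def body {d : ℕ} (a : Coef d) : ℂ := ExteriorAlgebra.algebraMapInv a

/-- The exponential of a Grassmann number: the exponential of its body times the (finite)
exponential series of its nilpotent part. -/
def gexp {d : ℕ} (a : Coef d) : Coef d :=
  Complex.exp (body a) •
    ∑ᶠ n : ℕ, ((n.factorial : ℂ)⁻¹) • (a - algebraMap ℂ (Coef d) (body a)) ^ n

/-! ### Calculus of Grassmann valued functions, through linear functionals -/

/-- `c` is the derivative at `t` within `s` of the Grassmann valued function `f`. -/
def HasWDeriv {d : ℕ} (f : ℝ → Coef d) (c : Coef d) (s : Set ℝ) (t : ℝ) : Prop :=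
  ∀ l : Module.Dual ℂ (Coef d), HasDerivWithinAt (fun τ => l (f τ)) (l c) s t

open Classical in
/-- The derivative of `f` at `t` within `s` (zero where it does not exist). -/
def wderiv {d : ℕ} (f : ℝ → Coef d) (s : Set ℝ) (t : ℝ) : Coef d :=
  if h : ∃ c, HasWDeriv f c s t then h.choose else 0

/-- `f` is integrable on `[a, b]` with integral `c`. -/
def HasWInt {d : ℕ} (f : ℝ → Coef d) (a b : ℝ) (c : Coef d) : Prop :=
  ∀ l : Module.Dual ℂ (Coef d),
    IntervalIntegrable (fun t => l (f t)) volume a b ∧ ∫ t in a..b, l (f t) = l c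

open Classical in
/-- The integral of `f` over `[a, b]` (zero where it does not exist). -/
def wint {d : ℕ} (a b : ℝ) (f : ℝ → Coef d) : Coef d :=
  if h : ∃ c, HasWInt f a b c then h.choose else 0

/-- Membership in `C^∞(s) ⊗ Coef d`. -/
def SmoothCoef {d : ℕ} (f : ℝ → Coef d) (s : Set ℝ) : Prop :=
  ∃ (n : ℕ) (φ : Fin n → ℝ → ℂ) (c : Fin n → Coef d),
    (∀ k, ContDiffOn ℝ ∞ (φ k) s) ∧ ∀ t ∈ s, f t = ∑ k, φ k t • c k

/-! ## Superforms

All signs follow the total degree (form degree plus internal degree): form symbols anticommute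
with each other and with odd coefficients, and integration over a curve acts from the left as an
operator of degree `-1`, normalised by `∫ dt f(t) = ∫ f`. -/

/-- The inhomogeneous form `zero(t) + dt one(t)` on an interval, with Grassmann coefficients. -/
@[ext]
structure SForm (d : ℕ) where
  zero : ℝ → Coef d
  one : ℝ → Coef d

namespace SForm

variable {d : ℕ}

/-- A constant coefficient as a form. -/
def const (a : Coef d) : SForm d := ⟨fun _ => a, fun _ => 0⟩

/-- `ϖ + t δ` for a real number `t`. -/
def shift (ϖ δ : SForm d) (t : ℝ) : SForm d :=
  ⟨fun s => ϖ.zero s + (t : ℂ) • δ.zero s, fun s => ϖ.one s + (t : ℂ) • δ.one s⟩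

/-- Product of forms: `(ϖ₀ + dt ϖ₁)(τ₀ + dt τ₁) = ϖ₀ τ₀ + dt (ϖ₁ τ₀ + inv(ϖ₀) τ₁)`. -/
def wedge (ϖ τ : SForm d) : SForm d :=
  ⟨fun t => ϖ.zero t * τ.zero t, fun t => ϖ.one t * τ.zero t + inv (ϖ.zero t) * τ.one t⟩

/-- The de Rham differential on the interval `[a, b]`. -/
def diff (a b : ℝ) (ϖ : SForm d) : SForm d := ⟨fun _ => 0, wderiv ϖ.zero (Icc a b)⟩

/-- The integral of a form over `[a, b]`. -/
def integral (a b : ℝ) (ϖ : SForm d) : Coef d := wint a b ϖ.one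

/-- Smoothness on `[a, b]`. -/
def IsSmooth (a b : ℝ) (ϖ : SForm d) : Prop :=
  SmoothCoef ϖ.zero (Icc a b) ∧ SmoothCoef ϖ.one (Icc a b)

/-- Homogeneity of total degree of parity `p`. -/
def HasTotalParity (p : ZMod 2) (a b : ℝ) (ϖ : SForm d) : Prop :=
  ∀ t ∈ Icc a b, HasParity p (ϖ.zero t) ∧ HasParity (p + 1) (ϖ.one t)

end SForm

/-- The form `c00 + dv c10 + du c01 + dv du c11` in two variables `(v, u)`. -/
@[ext]
structure BiForm (d : ℕ) where
  c00 : ℝ → ℝ → Coef d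
  c10 : ℝ → ℝ → Coef d
  c01 : ℝ → ℝ → Coef d
  c11 : ℝ → ℝ → Coef d

namespace BiForm

variable {d : ℕ}

/-- Pull-back of a form in the first variable. -/
def fst (ϖ : SForm d) : BiForm d :=
  ⟨fun v _ => ϖ.zero v, fun v _ => ϖ.one v, fun _ _ => 0, fun _ _ => 0⟩

/-- Pull-back of a form in the second variable. -/
def snd (ϖ : SForm d) : BiForm d :=
  ⟨fun _ u => ϖ.zero u, fun _ _ => 0, fun _ u => ϖ.one u, fun _ _ => 0⟩

/-- A real function of two variables. -/
def ofFun (g : ℝ → ℝ → ℝ) : BiForm d :=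
  ⟨fun v u => algebraMap ℂ _ (g v u : ℂ), fun _ _ => 0, fun _ _ => 0, fun _ _ => 0⟩

/-- The real one-form `b dv + a du`. -/
def ofOneForm (b a : ℝ → ℝ → ℝ) : BiForm d :=
  ⟨fun _ _ => 0, fun v u => algebraMap ℂ _ (b v u : ℂ), fun v u => algebraMap ℂ _ (a v u : ℂ),
    fun _ _ => 0⟩

/-- The product of forms in two variables. -/
def wedge (ϖ τ : BiForm d) : BiForm d where
  c00 v u := ϖ.c00 v u * τ.c00 v u
  c10 v u := ϖ.c10 v u * τ.c00 v u + inv (ϖ.c00 v u) * τ.c10 v u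
  c01 v u := ϖ.c01 v u * τ.c00 v u + inv (ϖ.c00 v u) * τ.c01 v u
  c11 v u := ϖ.c11 v u * τ.c00 v u + inv (ϖ.c10 v u) * τ.c01 v u
    - inv (ϖ.c01 v u) * τ.c10 v u + ϖ.c00 v u * τ.c11 v u

/-- Integration over the second variable, `∫ du f = ∫ f` and `∫ dv du f = - dv ∫ f`. -/
def integralSnd (a b : ℝ) (ϖ : BiForm d) : SForm d :=
  ⟨fun v => wint a b (ϖ.c01 v), fun v => - wint a b (ϖ.c11 v)⟩

end BiForm

/-! ## The disk `L₃` and its propagators -/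

/-- The closed unit disk. -/
def disk : Set ℂ := Metric.closedBall 0 1

/-- The boundary point at angle `t`. -/
def bpt (t : ℝ) : ℂ := Complex.exp (t * Complex.I)

/-- The unit tangent vector of the boundary circle at angle `t` (counterclockwise). -/
def btan (t : ℝ) : ℂ := Complex.I * bpt t

/-- The disk whose boundary circle is divided into six intervals by points at the angles
`θ 0 < ⋯ < θ 5 < θ 0 + 2π`.  The interval from `θ 0` to `θ 1` is `∂₁`, those from `θ 2` to `θ 3`
and from `θ 4` to `θ 5` are `∂₂⁽¹⁾` and `∂₂⁽²⁾`, and on the three remaining intervals the boundary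
condition is `η = 0`. -/
structure L3 where
  θ : Fin 6 → ℝ
  strictMono : StrictMono θ
  lt_period : θ 5 < θ 0 + 2 * Real.pi

namespace L3

variable (L : L3)

/-- First end point of the `k`-th interval in `∂₂`. -/
def lo (k : Fin 2) : ℝ := ![L.θ 2, L.θ 4] k

/-- Last end point of the `k`-th interval in `∂₂`. -/
def hi (k : Fin 2) : ℝ := ![L.θ 3, L.θ 5] k

/-- The angles of `∂₁`. -/
def arcX : Set ℝ := Icc (L.θ 0) (L.θ 1)

/-- The angles of the closure of the rest of the boundary. -/
def arcB : Set ℝ := Icc (L.θ 1) (L.θ 0 + 2 * Real.pi)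

end L3

/-- The configuration space of two distinct points of the disk. -/
def conf : Set (ℂ × ℂ) := {p | p.1 ∈ disk ∧ p.2 ∈ disk ∧ p.1 ≠ p.2}

/-- A propagator `ζ(u, v)` for the pairing of `η` at `u` with `X` at `v`: a smooth closed one-form
on the configuration space of two points of the disk, with a singularity on the diagonal of the
order of an angle form, of period one around the diagonal, and whose pull-back vanishes when `u` is
in the part of the boundary where `η` is prescribed (everything except `∂₁`) and when `v` is in
the part where `X` is prescribed (`∂₁`). -/
structure IsPropagator (L : L3) (ζ : ℂ × ℂ → (ℂ × ℂ →L[ℝ] ℝ)) : Prop where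
  smooth : ContDiffOn ℝ ∞ ζ conf
  closed : ∀ p ∈ conf, ∀ w w', fderivWithin ℝ ζ conf p w w' = fderivWithin ℝ ζ conf p w' w
  bound : ∃ C : ℝ, ∀ p ∈ conf, ‖ζ p‖ ≤ C / ‖p.1 - p.2‖
  period : ∀ (v : ℂ) (r : ℝ), 0 < r → Metric.closedBall v r ⊆ Metric.ball 0 1 →
    ∫ t in (0 : ℝ)..(2 * Real.pi), ζ (v + r * bpt t, v) (r * btan t, 0) = 1
  boundary_eta : ∀ t ∈ L.arcB, ∀ v ∈ disk, bpt t ≠ v → ∀ (c : ℝ) (w : ℂ),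
    ζ (bpt t, v) (c * btan t, w) = 0
  boundary_X : ∀ t ∈ L.arcX, ∀ u ∈ disk, u ≠ bpt t → ∀ (c : ℝ) (w : ℂ),
    ζ (u, bpt t) (w, c * btan t) = 0

/-- The pull-back of `ζ` to boundary points `(v, u) ↦ (u₀, u_ν)` with `u₀` at the angle `u` and
`u_ν` at the angle `v`. -/
def boundaryPropagator {d : ℕ} (ζ : ℂ × ℂ → (ℂ × ℂ →L[ℝ] ℝ)) : BiForm d :=
  BiForm.ofOneForm (fun v u => ζ (bpt u, bpt v) (0, btan v))
    (fun v u => ζ (bpt u, bpt v) (btan u, 0))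

/-- The function `ζ̂^∂(u₂, u₃) = ∫_M ζ₁₂ ∧ ζ₁₃` of the angles of two boundary points. -/
def zetaHat (ζ : ℂ × ℂ → (ℂ × ℂ →L[ℝ] ℝ)) (s t : ℝ) : ℝ :=
  ∫ z in disk, (ζ (z, bpt s) (1, 0) * ζ (z, bpt t) (Complex.I, 0)
    - ζ (z, bpt s) (Complex.I, 0) * ζ (z, bpt t) (1, 0))

/-! ## Residual fields: relative de Rham cohomology of the disk -/

/-- Functions on the disk that vanish on the boundary arc with angles in `γ`. -/
def relForm0 (γ : Set ℝ) : Submodule ℝ (ℂ → ℝ) where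
  carrier := {f | ContDiffOn ℝ ∞ f disk ∧ ∀ t ∈ γ, f (bpt t) = 0}
  add_mem' := by
    rintro f g ⟨hf, hf'⟩ ⟨hg, hg'⟩
    exact ⟨hf.add hg, fun t ht => by simp [hf' t ht, hg' t ht]⟩
  zero_mem' := ⟨contDiffOn_const, fun _ _ => rfl⟩
  smul_mem' := by
    rintro c f ⟨hf, hf'⟩
    exact ⟨hf.const_smul c, fun t ht => by simp [hf' t ht]⟩

/-- One-forms on the disk whose pull-back to the boundary arc vanishes. -/
def relForm1 (γ : Set ℝ) : Submodule ℝ (ℂ → (ℂ →L[ℝ] ℝ)) where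
  carrier := {ϖ | ContDiffOn ℝ ∞ ϖ disk ∧ ∀ t ∈ γ, ϖ (bpt t) (btan t) = 0}
  add_mem' := by
    rintro f g ⟨hf, hf'⟩ ⟨hg, hg'⟩
    exact ⟨hf.add hg, fun t ht => by simp [hf' t ht, hg' t ht]⟩
  zero_mem' := ⟨contDiffOn_const, fun _ _ => rfl⟩
  smul_mem' := by
    rintro c f ⟨hf, hf'⟩
    exact ⟨hf.const_smul c, fun t ht => by simp [hf' t ht]⟩

/-- Two-forms `ρ dx ∧ dy` on the disk. -/
def form2 : Submodule ℝ (ℂ → ℝ) where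
  carrier := {ρ | ContDiffOn ℝ ∞ ρ disk}
  add_mem' hf hg := hf.add hg
  zero_mem' := contDiffOn_const
  smul_mem' c _ hf := hf.const_smul c

/-- The coefficient of `dϖ` for a one-form `ϖ` on the disk. -/
def curl (ϖ : ℂ → (ℂ →L[ℝ] ℝ)) (z : ℂ) : ℝ :=
  fderivWithin ℝ ϖ disk z 1 Complex.I - fderivWithin ℝ ϖ disk z Complex.I 1

theorem uniqueDiff_disk : UniqueDiffOn ℝ disk :=
  uniqueDiffOn_convex (convex_closedBall 0 1)
    ⟨0, by rw [disk, interior_closedBall (0 : ℂ) one_ne_zero]; simp⟩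

theorem curl_add {ϖ τ : ℂ → (ℂ →L[ℝ] ℝ)} (hϖ : ContDiffOn ℝ ∞ ϖ disk)
    (hτ : ContDiffOn ℝ ∞ τ disk) {z : ℂ} (hz : z ∈ disk) :
    curl (ϖ + τ) z = curl ϖ z + curl τ z := by
  simp only [curl]
  rw [fderivWithin_add (uniqueDiff_disk z hz) (hϖ.differentiableOn (by simp) z hz)
    (hτ.differentiableOn (by simp) z hz)]
  simp only [add_apply]
  ring

theorem curl_smul {ϖ : ℂ → (ℂ →L[ℝ] ℝ)} (c : ℝ) (hϖ : ContDiffOn ℝ ∞ ϖ disk) {z : ℂ}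
    (hz : z ∈ disk) : curl (c • ϖ) z = c * curl ϖ z := by
  simp only [curl]
  rw [fderivWithin_const_smul (uniqueDiff_disk z hz) (hϖ.differentiableOn (by simp) z hz)]
  simp only [smul_apply, smul_eq_mul]
  ring

/-- Relative cocycles of degree zero. -/
def cocycle0 (γ : Set ℝ) : Submodule ℝ (ℂ → ℝ) where
  carrier := {f | f ∈ relForm0 γ ∧ ∀ z ∈ disk, fderivWithin ℝ f disk z = 0}
  add_mem' := by
    rintro f g ⟨hf, hf'⟩ ⟨hg, hg'⟩
    refine ⟨add_mem hf hg, fun z hz => ?_⟩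
    rw [fderivWithin_add (uniqueDiff_disk z hz) (hf.1.differentiableOn (by simp) z hz)
      (hg.1.differentiableOn (by simp) z hz), hf' z hz, hg' z hz, add_zero]
  zero_mem' := ⟨zero_mem _, fun z _ => by simp⟩
  smul_mem' := by
    rintro c f ⟨hf, hf'⟩
    refine ⟨Submodule.smul_mem _ c hf, fun z hz => ?_⟩
    rw [fderivWithin_const_smul (uniqueDiff_disk z hz) (hf.1.differentiableOn (by simp) z hz),
      hf' z hz, smul_zero]

/-- The functions that are zero on the disk. -/
def null0 : Submodule ℝ (ℂ → ℝ) where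
  carrier := {f | ∀ z ∈ disk, f z = 0}
  add_mem' hf hg z hz := by simp [hf z hz, hg z hz]
  zero_mem' _ _ := rfl
  smul_mem' c f hf z hz := by simp [hf z hz]

/-- Relative cocycles of degree one. -/
def cocycle1 (γ : Set ℝ) : Submodule ℝ (ℂ → (ℂ →L[ℝ] ℝ)) where
  carrier := {ϖ | ϖ ∈ relForm1 γ ∧ ∀ z ∈ disk, curl ϖ z = 0}
  add_mem' := by
    rintro f g ⟨hf, hf'⟩ ⟨hg, hg'⟩
    exact ⟨add_mem hf hg, fun z hz => by rw [curl_add hf.1 hg.1 hz, hf' z hz, hg' z hz, add_zero]⟩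
  zero_mem' := ⟨zero_mem _, fun z _ => by simp [curl]⟩
  smul_mem' := by
    rintro c f ⟨hf, hf'⟩
    exact ⟨Submodule.smul_mem _ c hf, fun z hz => by
      rw [curl_smul c hf.1 hz, hf' z hz, mul_zero]⟩

/-- One-forms that are on the disk the differential of a relative function. -/
def exact1 (γ : Set ℝ) : Submodule ℝ (ℂ → (ℂ →L[ℝ] ℝ)) where
  carrier := {ϖ | ∃ f ∈ relForm0 γ, ∀ z ∈ disk, ϖ z = fderivWithin ℝ f disk z}
  add_mem' := by
    rintro ϖ τ ⟨f, hf, hf'⟩ ⟨g, hg, hg'⟩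
    refine ⟨f + g, add_mem hf hg, fun z hz => ?_⟩
    rw [fderivWithin_add (uniqueDiff_disk z hz) (hf.1.differentiableOn (by simp) z hz)
      (hg.1.differentiableOn (by simp) z hz), Pi.add_apply, hf' z hz, hg' z hz]
  zero_mem' := ⟨0, zero_mem _, fun z _ => by simp⟩
  smul_mem' := by
    rintro c ϖ ⟨f, hf, hf'⟩
    refine ⟨c • f, Submodule.smul_mem _ c hf, fun z hz => ?_⟩
    rw [fderivWithin_const_smul (uniqueDiff_disk z hz) (hf.1.differentiableOn (by simp) z hz),
      Pi.smul_apply, hf' z hz]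

/-- Two-forms that are on the disk the differential of a relative one-form. -/
def exact2 (γ : Set ℝ) : Submodule ℝ (ℂ → ℝ) where
  carrier := {ρ | ∃ ϖ ∈ relForm1 γ, ∀ z ∈ disk, ρ z = curl ϖ z}
  add_mem' := by
    rintro ρ σ ⟨f, hf, hf'⟩ ⟨g, hg, hg'⟩
    refine ⟨f + g, add_mem hf hg, fun z hz => ?_⟩
    rw [curl_add hf.1 hg.1 hz, Pi.add_apply, hf' z hz, hg' z hz]
  zero_mem' := ⟨0, zero_mem _, fun z _ => by simp [curl]⟩
  smul_mem' := by
    rintro c ρ ⟨f, hf, hf'⟩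
    refine ⟨c • f, Submodule.smul_mem _ c hf, fun z hz => ?_⟩
    rw [curl_smul c hf.1 hz, Pi.smul_apply, hf' z hz, smul_eq_mul]

/-- Relative de Rham cohomology of the disk modulo a boundary arc, in degree zero. -/
abbrev H0 (γ : Set ℝ) : Type := cocycle0 γ ⧸ null0.submoduleOf (cocycle0 γ)

instance instQuotient1 (γ : Set ℝ) : HasQuotient (cocycle1 γ) (Submodule ℝ (cocycle1 γ)) :=
  @Submodule.hasQuotient ℝ (cocycle1 γ) _ _ _

/-- Relative de Rham cohomology of the disk modulo a boundary arc, in degree one. -/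
abbrev H1 (γ : Set ℝ) : Type := cocycle1 γ ⧸ (exact1 γ).submoduleOf (cocycle1 γ)

instance instAddCommGroupH1 (γ : Set ℝ) : AddCommGroup (H1 γ) :=
  @Submodule.Quotient.addCommGroup ℝ (cocycle1 γ) _ _ _ _

instance instModuleH1 (γ : Set ℝ) : Module ℝ (H1 γ) :=
  @Submodule.Quotient.module ℝ (cocycle1 γ) _ _ _ _

/-- Relative de Rham cohomology of the disk modulo a boundary arc, in degree two. -/
abbrev H2 (γ : Set ℝ) : Type := form2 ⧸ (exact2 γ).submoduleOf form2

/-- The dimensions of the relative cohomology groups. -/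
def betti (γ : Set ℝ) (k : Fin 3) : ℕ :=
  ![Module.finrank ℝ (H0 γ), Module.finrank ℝ (H1 γ), Module.finrank ℝ (H2 γ)] k

/-- Index set of the coordinates `z` of the residual part of `X`: a basis of
`H^•(M, ∂₁) ⊗ ℝᵈ`. -/
abbrev ResIdx (L : L3) (d : ℕ) : Type := (Σ k : Fin 3, Fin (betti L.arcX k)) × Fin d

/-- Residual fields: coordinates `z` and dual coordinates `z†`. -/
structure Residual (L : L3) (d : ℕ) where
  z : ResIdx L d → Coef d
  zdag : ResIdx L d → Coef d

/-! ## Boundary fields, effective action, state -/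

/-- Boundary fields: `X` on `∂₁` and `E` on the two intervals of `∂₂`. -/
structure Fields (d : ℕ) where
  X : Fin d → SForm d
  E : Fin 2 → Fin d → SForm d

/-- The component fields of `X`: a smooth superform on `∂₁` of total degree zero. -/
def IsXField {d : ℕ} (L : L3) (X : Fin d → SForm d) : Prop :=
  ∀ i, (X i).IsSmooth (L.θ 0) (L.θ 1) ∧ (X i).HasTotalParity 0 (L.θ 0) (L.θ 1)

/-- The component fields of `E`: smooth superforms on the intervals of `∂₂`, of total degree one,
whose restriction to the end points is zero. -/
def IsEField {d : ℕ} (L : L3) (E : Fin 2 → Fin d → SForm d) : Prop :=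
  ∀ k i, (E k i).IsSmooth (L.lo k) (L.hi k) ∧ (E k i).HasTotalParity 1 (L.lo k) (L.hi k) ∧
    (E k i).zero (L.lo k) = 0 ∧ (E k i).zero (L.hi k) = 0

/-- The boundary fields of `L₃`. -/
def IsField {d : ℕ} (L : L3) (Φ : Fields d) : Prop := IsXField L Φ.X ∧ IsEField L Φ.E

/-- `S^eff_{∂^(k) M} = - ∫_{∂₂⁽ᵏ⁾ × ∂₁} E_i ∧ ζ ∧ X_i`. -/
def freeAction {d : ℕ} (L : L3) (ζ : ℂ × ℂ → (ℂ × ℂ →L[ℝ] ℝ)) (k : Fin 2) (Φ : Fields d) :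
    Coef d :=
  - ∑ i, ((((BiForm.fst (Φ.E k i)).wedge (boundaryPropagator ζ)).wedge
      (BiForm.snd (Φ.X i))).integralSnd (L.θ 0) (L.θ 1)).integral (L.lo k) (L.hi k)

/-- `α^{ij} ∫ E_i ∧ ζ̂^∂ ∧ E_j` over pairs of points, the first in the `k`-th and the second in the
`l`-th interval of `∂₂`. -/
def pertIntegral {d : ℕ} (L : L3) (ζ : ℂ × ℂ → (ℂ × ℂ →L[ℝ] ℝ)) (A : Matrix (Fin d) (Fin d) ℝ)
    (k l : Fin 2) (Φ : Fields d) : Coef d :=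
  ∑ i, ∑ j, (A i j : ℂ) • ((((BiForm.fst (Φ.E k i)).wedge (BiForm.ofFun (zetaHat ζ))).wedge
      (BiForm.snd (Φ.E l j))).integralSnd (L.lo l) (L.hi l)).integral (L.lo k) (L.hi k)

/-- The effective action: the two free terms, the interaction terms of the single intervals
(symmetry factor `1/2`) and the mixed interaction term. -/
def effAction {d : ℕ} (L : L3) (ζ : ℂ × ℂ → (ℂ × ℂ →L[ℝ] ℝ)) (A : Matrix (Fin d) (Fin d) ℝ)
    (Φ : Fields d) : Coef d :=
  freeAction L ζ 0 Φ + freeAction L ζ 1 Φ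
    + (1 / 2 : ℂ) • pertIntegral L ζ A 0 0 Φ + (1 / 2 : ℂ) • pertIntegral L ζ A 1 1 Φ
    + pertIntegral L ζ A 0 1 Φ

/-- The state `exp((i/ħ) S^eff)`, as a function of the background `x`, the residual fields and the
boundary fields.  The effective action of `L₃` has no term with residual fields. -/
def state {d : ℕ} (L : L3) (ζ : ℂ × ℂ → (ℂ × ℂ →L[ℝ] ℝ))
    (α : (Fin d → ℝ) → Matrix (Fin d) (Fin d) ℝ) (ħ : ℝ) :
    (Fin d → ℝ) → Residual L d → Fields d → Coef d :=
  fun x _ Φ => gexp ((Complex.I / ħ) • effAction L ζ (α x) Φ)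

/-! ## Functional derivatives and the boundary operator -/

/-- `K i = δF/δX_i` at `Φ`: the variation of `F` is `∑ ∫_{∂₁} δX_i ∧ K_i`. -/
def HasXDeriv {d : ℕ} (L : L3) (F : Fields d → Coef d) (Φ : Fields d) (K : Fin d → SForm d) :
    Prop :=
  (∀ i, (K i).IsSmooth (L.θ 0) (L.θ 1)) ∧
  ∀ δ : Fin d → SForm d, IsXField L δ →
    HasWDeriv (fun t => F ⟨fun i => (Φ.X i).shift (δ i) t, Φ.E⟩)
      (∑ i, ((δ i).wedge (K i)).integral (L.θ 0) (L.θ 1)) univ 0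

/-- `K k i = δF/δE_i` at `Φ` on the `k`-th interval of `∂₂`: the variation of `F` is
`∑ ∫_{∂₂} δE_i ∧ K_i`. -/
def HasEDeriv {d : ℕ} (L : L3) (F : Fields d → Coef d) (Φ : Fields d)
    (K : Fin 2 → Fin d → SForm d) : Prop :=
  (∀ k i, (K k i).IsSmooth (L.lo k) (L.hi k)) ∧
  ∀ δ : Fin 2 → Fin d → SForm d, IsEField L δ →
    HasWDeriv (fun t => F ⟨Φ.X, fun k i => (Φ.E k i).shift (δ k i) t⟩)
      (∑ k, ∑ i, ((δ k i).wedge (K k i)).integral (L.lo k) (L.hi k)) univ 0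

open Classical in
/-- The functional derivatives `δF/δX_i` (zero where they do not exist). -/
def xGrad {d : ℕ} (L : L3) (F : Fields d → Coef d) (Φ : Fields d) : Fin d → SForm d :=
  if h : ∃ K, HasXDeriv L F Φ K then h.choose else fun _ => SForm.const 0

open Classical in
/-- The functional derivatives `δF/δE_i` (zero where they do not exist). -/
def eGrad {d : ℕ} (L : L3) (F : Fields d → Coef d) (Φ : Fields d) : Fin 2 → Fin d → SForm d :=
  if h : ∃ K, HasEDeriv L F Φ K then h.choose else fun _ _ => SForm.const 0

/-- The one-form part, on the diagonal of `∂₁ × ∂₁`, of `δ/δX_i δ/δX_j F`.  Writing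
`δF/δX_j = K₀ + du K₁`, the operator `δ/δX_i`, which is of degree one, gives
`δK₀/δX_i - du δK₁/δX_i`. -/
def xxDiag {d : ℕ} (L : L3) (F : Fields d → Coef d) (Φ : Fields d) (i j : Fin d) (u : ℝ) :
    Coef d :=
  (xGrad L (fun Ψ => (xGrad L F Ψ j).zero u) Φ i).one u
    - (xGrad L (fun Ψ => (xGrad L F Ψ j).one u) Φ i).zero u

/-- `F` has the functional derivatives that the boundary operator needs. -/
def IsRegular {d : ℕ} (L : L3) (F : Fields d → Coef d) : Prop :=
  (∀ Φ, IsField L Φ → (∃ K, HasXDeriv L F Φ K) ∧ ∃ K, HasEDeriv L F Φ K) ∧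
  (∀ Φ, IsField L Φ → ∀ j, ∀ u ∈ Icc (L.θ 0) (L.θ 1),
    (∃ K, HasXDeriv L (fun Ψ => (xGrad L F Ψ j).zero u) Φ K) ∧
    ∃ K, HasXDeriv L (fun Ψ => (xGrad L F Ψ j).one u) Φ K) ∧
  (∀ Φ, IsField L Φ → ∀ i j, SmoothCoef (xxDiag L F Φ i j) (Icc (L.θ 0) (L.θ 1)))

/-- `Ω_pert = -½ α^{ij} (ħ² ∫_{∂₁} δ/δX_i δ/δX_j - ∫_{∂₂} E_i ∧ E_j)`. -/
def omegaPert {d : ℕ} (L : L3) (A : Matrix (Fin d) (Fin d) ℝ) (ħ : ℝ) (F : Fields d → Coef d)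
    (Φ : Fields d) : Coef d :=
  -(1 / 2 : ℂ) • ∑ i, ∑ j, (A i j : ℂ) •
    ((ħ : ℂ) ^ 2 • wint (L.θ 0) (L.θ 1) (xxDiag L F Φ i j)
      - (∑ k, ((Φ.E k i).wedge (Φ.E k j)).integral (L.lo k) (L.hi k)) * F Φ)

/-- `Ω₀ = iħ (∫_{∂₁} dX_i δ/δX_i + ∫_{∂₂} dE_i δ/δE_i + ∫_{∂₁} dxⁱ δ/δX_i
+ (i/ħ) ∫_{∂₂} E_i ∧ dxⁱ)`. -/
def omegaFree {d : ℕ} (L : L3) (ħ : ℝ) (F : Fields d → Coef d) (Φ : Fields d) : Coef d :=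
  (Complex.I * ħ) •
    ((∑ i, (((Φ.X i).diff (L.θ 0) (L.θ 1)).wedge (xGrad L F Φ i)).integral (L.θ 0) (L.θ 1))
      + (∑ k, ∑ i, (((Φ.E k i).diff (L.lo k) (L.hi k)).wedge (eGrad L F Φ k i)).integral
          (L.lo k) (L.hi k))
      + (∑ i, ((SForm.const (dx i)).wedge (xGrad L F Φ i)).integral (L.θ 0) (L.θ 1))
      + (Complex.I / ħ) • ((∑ k, ∑ i, ((Φ.E k i).wedge (SForm.const (dx i))).integral
          (L.lo k) (L.hi k)) * F Φ))

/-- The boundary operator `Ω⁽³⁾ = Ω₀ + Ω_pert`. -/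
def omega {d : ℕ} (L : L3) (A : Matrix (Fin d) (Fin d) ℝ) (ħ : ℝ) (F : Fields d → Coef d)
    (Φ : Fields d) : Coef d :=
  omegaFree L ħ F Φ + omegaPert L A ħ F Φ

/-- The de Rham differential `d = dxⁱ ∂/∂xⁱ` on the space of backgrounds. -/
def extD {d : ℕ} (F : (Fin d → ℝ) → Coef d) (x : Fin d → ℝ) : Coef d :=
  ∑ i, dx i * wderiv (fun t => F (x + t • Pi.single i 1)) univ 0

/-- `c` is the left derivative at zero of `f` along elements of parity `p`. -/
def HasLeftDeriv {d : ℕ} (p : ZMod 2) (f : Coef d → Coef d) (c : Coef d) : Prop :=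
  ∀ δ : Coef d, HasParity p δ → HasWDeriv (fun t : ℝ => f ((t : ℂ) • δ)) (δ * c) univ 0

open Classical in
/-- The left derivative at zero along elements of parity `p` (zero where it does not exist). -/
def leftDeriv {d : ℕ} (p : ZMod 2) (f : Coef d → Coef d) : Coef d :=
  if h : ∃ c, HasLeftDeriv p f c then h.choose else 0

open Classical in
/-- The derivative along the coordinate `z_a`; it has the parity of the form degree `k` of the
cohomology class, as `X` has total degree zero. -/
def dz {d : ℕ} {L : L3} (a : ResIdx L d) (F : Residual L d → Coef d) (r : Residual L d) : Coef d :=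
  leftDeriv ((a.1.1 : ℕ) : ZMod 2) fun δ => F ⟨Function.update r.z a (r.z a + δ), r.zdag⟩

open Classical in
/-- The derivative along the dual coordinate `z†_a`, of parity opposite to `z_a`. -/
def dzdag {d : ℕ} {L : L3} (a : ResIdx L d) (F : Residual L d → Coef d) (r : Residual L d) :
    Coef d :=
  leftDeriv (((a.1.1 : ℕ) : ZMod 2) + 1) fun δ =>
    F ⟨r.z, Function.update r.zdag a (r.zdag a + δ)⟩

/-- The BV Laplacian `Δ = ∑_a (-1)^{1 + deg z_a} ∂/∂z_a ∂/∂z†_a` on functions of the residual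
fields. -/
def bvLaplacian {d : ℕ} {L : L3} (F : Residual L d → Coef d) (r : Residual L d) : Coef d :=
  ∑ a : ResIdx L d, (-1 : ℂ) ^ (1 + (a.1.1 : ℕ)) • dz a (dzdag a F) r

/-- The operator `d + iħ Δ + (i/ħ) Ω⁽³⁾`. -/
def quantumGrothendieck {d : ℕ} (L : L3) (α : (Fin d → ℝ) → Matrix (Fin d) (Fin d) ℝ) (ħ : ℝ)
    (F : (Fin d → ℝ) → Residual L d → Fields d → Coef d) :
    (Fin d → ℝ) → Residual L d → Fields d → Coef d :=
  fun x r Φ => extD (fun y => F y r Φ) x + (Complex.I * ħ) • bvLaplacian (fun s => F x s Φ) r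
    + (Complex.I / ħ) • omega L (α x) ħ (F x r) Φ

end PSM

end

open Set MeasureTheory
open scoped ContDiff

noncomputable section

namespace PSM

section

/-! ## Weak calculus of Grassmann valued functions -/

/-! After the signs are collected, the effective action is `freeSum E X - ½ pertSum E E`: affine in
`X` and quadratic in `E`. Hence the state is an exponential whose first functional derivatives are
`gradX` and `gradE` times the state, and whose second derivative along `X` is just a product of two
first ones. The equation `Ω ψ = 0` becomes an identity between integrals of boundary kernels, which
is Stokes' theorem for the propagator.

In the first-order part, `dX` and `dE` are integrated by parts. No end point terms survive: the
component of the propagator along `∂₂` vanishes at the ends of `∂₁` (`kerV_eq_zero`), and `E`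
vanishes at the ends of its intervals. The terms mixing `X` and `E` cancel because the propagator is
closed: both derivatives give the same kernel `kerD`. What remains is the derivative of `ζ̂(v, w)`
in `v`. It consists of the smooth kernel `kerC`, an integral over `∂₁` of a product of two
propagators, which cancels the operator `δ/δX δ/δX`, and of a jump on the diagonal, which cancels `E
∧ E`. The two terms containing `dxⁱ` cancel because the propagator has integral one over `∂₁`
(`integral_boundary`). The operator `d` contributes nothing since the state is the same for all
backgrounds, and neither does the BV Laplacian since there are no residual fields.

The analytic core is the formula `zetaHat_eq_bdryPair`: `ζ̂(s, t)` is the integral over `∂₁` of a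
primitive of the propagator at `s` against the propagator at `t`, plus one if `s < t`. A slice of
the propagator at a boundary point `bpt s` is closed on the disk without that point, which is
convex, so it has a primitive `f`. Then `ζ₁₂ ∧ ζ₁₃` is the differential of `f ζ₁₃`. Green's formula
on the disk of radius `R < 1` (`green_polar`) and the limit `R → 1` (`tendsto_boundary_integral`,
`zetaHat_eq_of_lt`) express `ζ̂` through boundary values. These are explicit: the slices vanish
tangentially off `∂₁`, so `f` is locally constant there and jumps by the period at the singularity.
The bound `C / |u - v|` enters through the majorants `(1 - r)^(-1/2) |sin|^(-1/2)`, which separate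
radius and angle and are integrable in each.

Grassmann valued functions are handled through linear functionals and finite expansions with scalar
coefficient functions. Integral operators are treated uniformly by `IsKernel`, which covers smooth
kernels as well as the step kernel. Functional derivatives are unique (`HasXDeriv.unique`,
`HasEDeriv.unique`), so the chosen ones in the operators agree with the computed ones. The
cohomology groups vanish by the Poincaré lemma, corrected along the boundary arc. -/

theorem Coef.ext_dual {d : ℕ} {a b : Coef d} (h : ∀ l : Module.Dual ℂ (Coef d), l a = l b) :
    a = b := by
  rw [← sub_eq_zero, ← Module.forall_dual_apply_eq_zero_iff ℂ]
  intro l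
  rw [map_sub, h l, sub_self]

/-- A vector outside a subspace is detected by a functional that kills the subspace. In this way
weak integrals inherit membership in a subspace, in particular parity, without a topology on the
Grassmann algebra. -/
theorem Coef.mem_of_dual {d : ℕ} {W : Submodule ℂ (Coef d)} {a : Coef d}
    (h : ∀ l : Module.Dual ℂ (Coef d), (∀ w ∈ W, l w = 0) → l a = 0) : a ∈ W := by
  by_contra ha
  obtain ⟨f, hf, hW⟩ := Submodule.exists_dual_map_eq_bot_of_notMem ha inferInstance
  refine hf (h f fun w hw => ?_)
  have : f w ∈ W.map f := Submodule.mem_map_of_mem hw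
  rwa [hW, Submodule.mem_bot] at this

section Deriv

variable {d : ℕ} {f g : ℝ → Coef d} {c c' : Coef d} {s : Set ℝ} {t : ℝ}

theorem HasWDeriv.unique (h : HasWDeriv f c s t) (h' : HasWDeriv f c' s t)
    (hs : UniqueDiffWithinAt ℝ s t) : c = c' :=
  Coef.ext_dual fun l => hs.eq_deriv _ (h l) (h' l)

theorem HasWDeriv.wderiv_eq (h : HasWDeriv f c s t) (hs : UniqueDiffWithinAt ℝ s t) :
    wderiv f s t = c := by
  have hex : ∃ c, HasWDeriv f c s t := ⟨c, h⟩
  rw [wderiv, dif_pos hex]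
  exact hex.choose_spec.unique h hs

theorem HasWDeriv.congr (h : HasWDeriv f c s t) (hfg : ∀ x ∈ s, g x = f x) (ht : t ∈ s) :
    HasWDeriv g c s t := fun l =>
  (h l).congr (fun x hx => by rw [hfg x hx]) (by rw [hfg t ht])

theorem hasWDeriv_const (a : Coef d) : HasWDeriv (fun _ => a) 0 s t := fun l => by
  simpa using hasDerivWithinAt_const t s (l a)

theorem HasWDeriv.add (hf : HasWDeriv f c s t) (hg : HasWDeriv g c' s t) :
    HasWDeriv (fun x => f x + g x) (c + c') s t := fun l => by
  simp only [map_add]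
  exact (hf l).fun_add (hg l)

theorem HasWDeriv.linear (hf : HasWDeriv f c s t) (T : Coef d →ₗ[ℂ] Coef d) :
    HasWDeriv (fun x => T (f x)) (T c) s t := fun l => hf (l.comp T)

theorem HasWDeriv.finsetSum {ι : Type*} (S : Finset ι) {f : ι → ℝ → Coef d} {c : ι → Coef d}
    (h : ∀ i ∈ S, HasWDeriv (f i) (c i) s t) :
    HasWDeriv (fun x => ∑ i ∈ S, f i x) (∑ i ∈ S, c i) s t := fun l => by
  simpa using HasDerivWithinAt.fun_sum fun i hi => h i hi l

theorem hasWDeriv_smul {φ : ℝ → ℂ} {φ' : ℂ} (h : HasDerivWithinAt φ φ' s t) (a : Coef d) :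
    HasWDeriv (fun x => φ x • a) (φ' • a) s t := fun l => by
  simpa using h.mul_const (l a)

theorem HasWDeriv.mul_left (hf : HasWDeriv f c s t) (a : Coef d) :
    HasWDeriv (fun x => a * f x) (a * c) s t := hf.linear (LinearMap.mulLeft ℂ a)

theorem HasWDeriv.const_smul (hf : HasWDeriv f c s t) (z : ℂ) :
    HasWDeriv (fun x => z • f x) (z • c) s t := hf.linear (z • LinearMap.id)

theorem HasWDeriv.neg (hf : HasWDeriv f c s t) :
    HasWDeriv (fun x => - f x) (-c) s t := hf.linear (-LinearMap.id)

end Deriv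

section Int

variable {d : ℕ} {f g : ℝ → Coef d} {c c' : Coef d} {a b : ℝ}

theorem HasWInt.unique (h : HasWInt f a b c) (h' : HasWInt f a b c') : c = c' :=
  Coef.ext_dual fun l => by rw [← (h l).2, (h' l).2]

theorem HasWInt.wint_eq (h : HasWInt f a b c) : wint a b f = c := by
  have hex : ∃ c, HasWInt f a b c := ⟨c, h⟩
  rw [wint, dif_pos hex]
  exact hex.choose_spec.unique h

theorem HasWInt.hasWInt_wint (h : HasWInt f a b c) : HasWInt f a b (wint a b f) := by
  rwa [h.wint_eq]

theorem HasWInt.congr_ae (h : HasWInt f a b c)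
    (hfg : ∀ᵐ x ∂volume, x ∈ Set.uIoc a b → f x = g x) : HasWInt g a b c := fun l => by
  have h1 : ∀ᵐ x ∂volume, x ∈ Set.uIoc a b → l (f x) = l (g x) := by
    filter_upwards [hfg] with x hx hx'
    rw [hx hx']
  refine ⟨(h l).1.congr_ae ?_, ?_⟩
  · exact (ae_restrict_iff' measurableSet_uIoc).2 h1
  · rw [← intervalIntegral.integral_congr_ae h1]
    exact (h l).2

theorem HasWInt.congr (h : HasWInt f a b c) (hab : a ≤ b) (hfg : ∀ x ∈ Icc a b, g x = f x) :
    HasWInt g a b c :=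
  h.congr_ae (Filter.Eventually.of_forall fun x hx => by
    rw [uIoc_of_le hab] at hx
    exact (hfg x ⟨hx.1.le, hx.2⟩).symm)

theorem wint_congr (hab : a ≤ b) (hfg : ∀ x ∈ Icc a b, g x = f x) : wint a b g = wint a b f := by
  have : ∀ c, HasWInt g a b c ↔ HasWInt f a b c := fun c =>
    ⟨fun h => h.congr hab fun x hx => (hfg x hx).symm, fun h => h.congr hab hfg⟩
  by_cases h : ∃ c, HasWInt f a b c
  · obtain ⟨c, hc⟩ := h
    rw [hc.wint_eq, ((this c).2 hc).wint_eq]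
  · have h' : ¬ ∃ c, HasWInt g a b c := fun ⟨c, hc⟩ => h ⟨c, (this c).1 hc⟩
    rw [wint, wint, dif_neg h, dif_neg h']

theorem hasWInt_zero : HasWInt (fun _ => (0 : Coef d)) a b 0 := fun l => by simp

@[simp]
theorem wint_zero : wint a b (fun _ => (0 : Coef d)) = 0 := hasWInt_zero.wint_eq

theorem HasWInt.add (hf : HasWInt f a b c) (hg : HasWInt g a b c') :
    HasWInt (fun x => f x + g x) a b (c + c') := fun l => by
  simp only [map_add]
  exact ⟨(hf l).1.add (hg l).1, by
    rw [intervalIntegral.integral_add (hf l).1 (hg l).1, (hf l).2, (hg l).2]⟩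

theorem HasWInt.linear (hf : HasWInt f a b c) (T : Coef d →ₗ[ℂ] Coef d) :
    HasWInt (fun x => T (f x)) a b (T c) := fun l => hf (l.comp T)

theorem HasWInt.mul_left (hf : HasWInt f a b c) (e : Coef d) :
    HasWInt (fun x => e * f x) a b (e * c) := hf.linear (LinearMap.mulLeft ℂ e)

theorem HasWInt.mul_right (hf : HasWInt f a b c) (e : Coef d) :
    HasWInt (fun x => f x * e) a b (c * e) := hf.linear (LinearMap.mulRight ℂ e)

theorem HasWInt.const_smul (hf : HasWInt f a b c) (z : ℂ) :
    HasWInt (fun x => z • f x) a b (z • c) := hf.linear (z • LinearMap.id)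

theorem HasWInt.neg (hf : HasWInt f a b c) :
    HasWInt (fun x => - f x) a b (-c) := hf.linear (-LinearMap.id)

theorem HasWInt.sub (hf : HasWInt f a b c) (hg : HasWInt g a b c') :
    HasWInt (fun x => f x - g x) a b (c - c') := by
  simpa only [sub_eq_add_neg] using hf.add hg.neg

theorem HasWInt.finsetSum {ι : Type*} (S : Finset ι) {f : ι → ℝ → Coef d} {c : ι → Coef d}
    (h : ∀ i ∈ S, HasWInt (f i) a b (c i)) :
    HasWInt (fun x => ∑ i ∈ S, f i x) a b (∑ i ∈ S, c i) := by
  classical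
  induction S using Finset.induction_on with
  | empty => simpa using hasWInt_zero
  | insert i S hi ih =>
    simp only [Finset.sum_insert hi]
    exact (h i (by simp)).add (ih fun j hj => h j (by simp [hj]))

theorem hasWInt_smul {φ : ℝ → ℂ} (h : IntervalIntegrable φ volume a b) (e : Coef d) :
    HasWInt (fun x => φ x • e) a b ((∫ x in a..b, φ x) • e) := fun l => by
  simp only [map_smul, smul_eq_mul]
  exact ⟨h.mul_const _, intervalIntegral.integral_mul_const _ _⟩

theorem HasWInt.mem {W : Submodule ℂ (Coef d)} (h : HasWInt f a b c) (hab : a ≤ b)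
    (hW : ∀ x ∈ Icc a b, f x ∈ W) : c ∈ W :=
  Coef.mem_of_dual fun l hl => by
    rw [← (h l).2]
    rw [intervalIntegral.integral_congr (g := fun _ => 0)]
    · simp
    · intro x hx
      rw [uIcc_of_le hab] at hx
      exact hl _ (hW x hx)

theorem wint_mem {W : Submodule ℂ (Coef d)} (hab : a ≤ b)
    (hW : ∀ x ∈ Icc a b, f x ∈ W) : wint a b f ∈ W := by
  by_cases h : ∃ c, HasWInt f a b c
  · obtain ⟨c, hc⟩ := h
    rw [hc.wint_eq]
    exact hc.mem hab hW
  · rw [wint, dif_neg h]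
    exact W.zero_mem

theorem HasWInt.of_hasWDeriv {f' : ℝ → Coef d} (hab : a ≤ b)
    (h : ∀ t ∈ Icc a b, HasWDeriv f (f' t) (Icc a b) t)
    (hi : HasWInt f' a b c) : c = f b - f a :=
  Coef.ext_dual fun l => by
    rw [← (hi l).2, map_sub]
    refine intervalIntegral.integral_eq_sub_of_hasDeriv_right_of_le hab
      (fun t ht => (h t ht l).continuousWithinAt) (fun t ht => ?_) (hi l).1
    exact ((h t ⟨ht.1.le, ht.2.le⟩ l).hasDerivAt (Icc_mem_nhds ht.1 ht.2)).hasDerivWithinAt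

end Int

/-! ### Smooth functions -/

namespace SmoothCoef

variable {d : ℕ} {f g : ℝ → Coef d} {s : Set ℝ}

theorem of_fintype {ι : Type*} [Fintype ι] {φ : ι → ℝ → ℂ} {c : ι → Coef d}
    (hφ : ∀ k, ContDiffOn ℝ ∞ (φ k) s) (hf : ∀ t ∈ s, f t = ∑ k, φ k t • c k) :
    SmoothCoef f s := by
  refine ⟨Fintype.card ι, fun k => φ ((Fintype.equivFin ι).symm k),
    fun k => c ((Fintype.equivFin ι).symm k), fun k => hφ _, fun t ht => ?_⟩
  rw [hf t ht]
  exact ((Fintype.equivFin ι).symm.sum_comp fun k => φ k t • c k).symm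

theorem congr (hf : SmoothCoef f s) (h : ∀ t ∈ s, g t = f t) : SmoothCoef g s := by
  obtain ⟨n, φ, c, hφ, hfc⟩ := hf
  exact ⟨n, φ, c, hφ, fun t ht => (h t ht).trans (hfc t ht)⟩

theorem smul_const {φ : ℝ → ℂ} (hφ : ContDiffOn ℝ ∞ φ s) (c : Coef d) :
    SmoothCoef (fun t => φ t • c) s :=
  ⟨1, fun _ => φ, fun _ => c, fun _ => hφ, fun t _ => by simp⟩

theorem const (c : Coef d) : SmoothCoef (fun _ => c) s :=
  (smul_const (φ := fun _ => 1) contDiffOn_const c).congr fun t _ => by simp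

theorem add (hf : SmoothCoef f s) (hg : SmoothCoef g s) : SmoothCoef (fun t => f t + g t) s := by
  obtain ⟨n, φ, c, hφ, hfc⟩ := hf
  obtain ⟨m, ψ, e, hψ, hge⟩ := hg
  refine of_fintype (ι := Fin n ⊕ Fin m) (φ := Sum.elim φ ψ) (c := Sum.elim c e) ?_ ?_
  · rintro (k | k)
    exacts [hφ k, hψ k]
  · intro t ht
    simp [hfc t ht, hge t ht]

theorem mul (hf : SmoothCoef f s) (hg : SmoothCoef g s) : SmoothCoef (fun t => f t * g t) s := by
  obtain ⟨n, φ, c, hφ, hfc⟩ := hf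
  obtain ⟨m, ψ, e, hψ, hge⟩ := hg
  refine of_fintype (ι := Fin n × Fin m) (φ := fun p t => φ p.1 t * ψ p.2 t)
    (c := fun p => c p.1 * e p.2) (fun p => (hφ _).mul (hψ _)) fun t ht => ?_
  rw [hfc t ht, hge t ht]
  simp only [Finset.sum_mul_sum, Fintype.sum_prod_type, smul_mul_smul_comm]

theorem linear (hf : SmoothCoef f s) (T : Coef d →ₗ[ℂ] Coef d) :
    SmoothCoef (fun t => T (f t)) s := by
  obtain ⟨n, φ, c, hφ, hfc⟩ := hf
  exact ⟨n, φ, fun k => T (c k), hφ, fun t ht => by simp [hfc t ht]⟩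

theorem smul {φ : ℝ → ℂ} (hφ : ContDiffOn ℝ ∞ φ s) (hf : SmoothCoef f s) :
    SmoothCoef (fun t => φ t • f t) s :=
  ((smul_const hφ 1).mul hf).congr fun t _ => by simp

theorem const_smul (hf : SmoothCoef f s) (z : ℂ) : SmoothCoef (fun t => z • f t) s :=
  hf.linear (z • LinearMap.id)

theorem neg (hf : SmoothCoef f s) : SmoothCoef (fun t => - f t) s := hf.linear (-LinearMap.id)

theorem sub (hf : SmoothCoef f s) (hg : SmoothCoef g s) : SmoothCoef (fun t => f t - g t) s := by
  simpa only [sub_eq_add_neg] using hf.add hg.neg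

theorem sum {ι : Type*} (S : Finset ι) {f : ι → ℝ → Coef d} (h : ∀ i ∈ S, SmoothCoef (f i) s) :
    SmoothCoef (fun t => ∑ i ∈ S, f i t) s := by
  classical
  induction S using Finset.induction_on with
  | empty => simpa using const (s := s) (0 : Coef d)
  | insert i S hi ih =>
    simp only [Finset.sum_insert hi]
    exact (h i (by simp)).add (ih fun j hj => h j (by simp [hj]))

theorem pow (hf : SmoothCoef f s) (n : ℕ) : SmoothCoef (fun t => f t ^ n) s := by
  induction n with
  | zero => simpa using const 1
  | succ n ih => simpa only [pow_succ] using ih.mul hf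

theorem contDiffOn_dual (hf : SmoothCoef f s) (l : Module.Dual ℂ (Coef d)) :
    ContDiffOn ℝ ∞ (fun t => l (f t)) s := by
  obtain ⟨n, φ, c, hφ, hfc⟩ := hf
  have h : ContDiffOn ℝ ∞ (fun t => ∑ k, φ k t * l (c k)) s :=
    ContDiffOn.sum fun k _ => (hφ k).mul contDiffOn_const
  exact h.congr fun t ht => by simp [hfc t ht]

/-- A smooth function has a smooth derivative. -/
theorem exists_deriv (hf : SmoothCoef f s) (hs : UniqueDiffOn ℝ s) :
    ∃ f' : ℝ → Coef d, SmoothCoef f' s ∧ ∀ t ∈ s, HasWDeriv f (f' t) s t := by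
  obtain ⟨n, φ, c, hφ, hfc⟩ := hf
  refine ⟨fun t => ∑ k, derivWithin (φ k) s t • c k,
    ⟨n, fun k => derivWithin (φ k) s, c,
      fun k => (hφ k).derivWithin hs (by simp), fun t _ => rfl⟩, fun t ht => ?_⟩
  refine HasWDeriv.congr (f := fun t => ∑ k, φ k t • c k) ?_ hfc ht
  exact HasWDeriv.finsetSum _ fun k _ =>
    hasWDeriv_smul ((hφ k).differentiableOn (by simp) t ht).hasDerivWithinAt _

theorem hasWDeriv_wderiv (hf : SmoothCoef f s) (hs : UniqueDiffOn ℝ s) {t : ℝ} (ht : t ∈ s) :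
    HasWDeriv f (wderiv f s t) s t := by
  obtain ⟨f', -, h⟩ := hf.exists_deriv hs
  rw [(h t ht).wderiv_eq (hs t ht)]
  exact h t ht

theorem wderiv (hf : SmoothCoef f s) (hs : UniqueDiffOn ℝ s) : SmoothCoef (wderiv f s) s := by
  obtain ⟨f', hf', h⟩ := hf.exists_deriv hs
  exact hf'.congr fun t ht => (h t ht).wderiv_eq (hs t ht)

end SmoothCoef

/-- Linear functionals are not multiplicative, so the product rule cannot be tested on functionals
directly. Finite expansions of both factors reduce it to the scalar product rule; uniqueness of
derivatives identifies `a` and `b` with the expanded ones. -/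
theorem HasWDeriv.mul {d : ℕ} {f g : ℝ → Coef d} {a b : Coef d} {s : Set ℝ} {t : ℝ}
    (hf : HasWDeriv f a s t) (hg : HasWDeriv g b s t) (hfs : SmoothCoef f s)
    (hgs : SmoothCoef g s) (hs : UniqueDiffWithinAt ℝ s t) (ht : t ∈ s) :
    HasWDeriv (fun x => f x * g x) (a * g t + f t * b) s t := by
  obtain ⟨n, φ, c, hφ, hfc⟩ := hfs
  obtain ⟨m, ψ, e, hψ, hge⟩ := hgs
  have h1 : a = ∑ k, derivWithin (φ k) s t • c k :=
    hf.unique (HasWDeriv.congr (HasWDeriv.finsetSum _ fun k _ => hasWDeriv_smul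
      ((hφ k).differentiableOn (by simp) t ht).hasDerivWithinAt (c k)) hfc ht) hs
  have h2 : b = ∑ k, derivWithin (ψ k) s t • e k :=
    hg.unique (HasWDeriv.congr (HasWDeriv.finsetSum _ fun k _ => hasWDeriv_smul
      ((hψ k).differentiableOn (by simp) t ht).hasDerivWithinAt (e k)) hge ht) hs
  have h3 : HasWDeriv (fun x => ∑ p : Fin n × Fin m, (φ p.1 x * ψ p.2 x) • (c p.1 * e p.2))
      (∑ p : Fin n × Fin m, (derivWithin (φ p.1) s t * ψ p.2 t + φ p.1 t * derivWithin (ψ p.2) s t) •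
        (c p.1 * e p.2)) s t :=
    HasWDeriv.finsetSum _ fun p _ => hasWDeriv_smul
      (((hφ p.1).differentiableOn (by simp) t ht).hasDerivWithinAt.mul
      ((hψ p.2).differentiableOn (by simp) t ht).hasDerivWithinAt) _
  have h4 : a * g t + f t * b = ∑ p : Fin n × Fin m,
      (derivWithin (φ p.1) s t * ψ p.2 t + φ p.1 t * derivWithin (ψ p.2) s t) •
        (c p.1 * e p.2) := by
    simp only [add_smul, Finset.sum_add_distrib, Fintype.sum_prod_type, h1, h2, hfc t ht, hge t ht,
      Finset.sum_mul_sum, smul_mul_smul_comm]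
  rw [h4]
  refine h3.congr (fun x hx => ?_) ht
  simp only [hfc x hx, hge x hx, Finset.sum_mul_sum, Fintype.sum_prod_type, smul_mul_smul_comm]


end

section

/-! ## Parity and the exponential -/

section Parity

variable {d : ℕ} {a b : Coef d} {p q : ZMod 2}

theorem HasParity.add (ha : HasParity p a) (hb : HasParity p b) : HasParity p (a + b) :=
  Submodule.add_mem _ ha hb

theorem HasParity.sub (ha : HasParity p a) (hb : HasParity p b) : HasParity p (a - b) :=
  Submodule.sub_mem _ ha hb

theorem HasParity.smul (z : ℂ) (ha : HasParity p a) : HasParity p (z • a) :=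
  Submodule.smul_mem _ z ha

theorem HasParity.zero : HasParity p (0 : Coef d) := Submodule.zero_mem _

theorem HasParity.sum {ι : Type*} (S : Finset ι) {f : ι → Coef d}
    (h : ∀ i ∈ S, HasParity p (f i)) : HasParity p (∑ i ∈ S, f i) := Submodule.sum_mem _ h

theorem HasParity.mul (ha : HasParity p a) (hb : HasParity q b) : HasParity (p + q) (a * b) :=
  CliffordAlgebra.evenOdd_mul_le _ p q (Submodule.mul_mem_mul ha hb)

theorem HasParity.one : HasParity 0 (1 : Coef d) :=
  Submodule.one_le.1 (CliffordAlgebra.one_le_evenOdd_zero _)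

theorem HasParity.algebraMap (z : ℂ) : HasParity 0 (algebraMap ℂ (Coef d) z) := by
  rw [Algebra.algebraMap_eq_smul_one]
  exact HasParity.one.smul z

theorem HasParity.ι (v : (Fin d ⊕ ℕ) →₀ ℂ) : HasParity 1 (ExteriorAlgebra.ι ℂ v : Coef d) :=
  CliffordAlgebra.ι_mem_evenOdd_one _ v

theorem HasParity.dx (i : Fin d) : HasParity 1 (dx i) := HasParity.ι _

theorem HasParity.inv_even (ha : HasParity 0 a) : inv a = a :=
  CliffordAlgebra.involute_eq_of_mem_even ha

theorem HasParity.inv_odd (ha : HasParity 1 a) : inv a = -a :=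
  CliffordAlgebra.involute_eq_of_mem_odd ha

theorem HasParity.wint {f : ℝ → Coef d} {x y : ℝ} (hxy : x ≤ y)
    (h : ∀ t ∈ Icc x y, HasParity p (f t)) : HasParity p (wint x y f) := wint_mem hxy h

theorem inv_zero : inv (0 : Coef d) = 0 := map_zero _

theorem inv_neg (a : Coef d) : inv (-a) = - inv a := map_neg _ a

theorem inv_algebraMap (z : ℂ) : inv (algebraMap ℂ (Coef d) z) = algebraMap ℂ (Coef d) z :=
  AlgHom.commutes _ z

theorem inv_mul (a b : Coef d) : inv (a * b) = inv a * inv b := map_mul _ a b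

theorem inv_smul (z : ℂ) (a : Coef d) : inv (z • a) = z • inv a := map_smul _ z a

/-- The parity involution as a linear map. -/
def invₗ : Coef d →ₗ[ℂ] Coef d :=
  (CliffordAlgebra.involute (Q := (0 : QuadraticForm ℂ ((Fin d ⊕ ℕ) →₀ ℂ)))).toLinearMap

theorem ι_mul_ι_swap (v w : (Fin d ⊕ ℕ) →₀ ℂ) :
    (ExteriorAlgebra.ι ℂ v * ExteriorAlgebra.ι ℂ w : Coef d) =
      -(ExteriorAlgebra.ι ℂ w * ExteriorAlgebra.ι ℂ v) :=
  eq_neg_of_add_eq_zero_left (ExteriorAlgebra.ι_add_mul_swap v w)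

/-- Moving a generator past a pair of generators changes the sign twice. -/
theorem commute_ι_mul_ι (v w : (Fin d ⊕ ℕ) →₀ ℂ) (b : Coef d) :
    Commute (ExteriorAlgebra.ι ℂ v * ExteriorAlgebra.ι ℂ w : Coef d) b := by
  induction b using ExteriorAlgebra.induction with
  | algebraMap r => exact (Algebra.commutes r _).symm
  | ι x =>
    change _ * _ = _ * _
    rw [mul_assoc, ι_mul_ι_swap w x, mul_neg, ← mul_assoc, ι_mul_ι_swap v x, neg_mul, neg_neg,
      mul_assoc]
  | mul a b ha hb => exact ha.mul_right hb
  | add a b ha hb => exact ha.add_right hb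

/-- Even elements are central. -/
theorem HasParity.commute (ha : HasParity 0 a) (b : Coef d) : Commute a b := by
  unfold HasParity at ha
  induction a, ha using CliffordAlgebra.even_induction with
  | algebraMap r => exact Algebra.commutes r b
  | add x y _ _ hx hy => exact hx.add_left hy
  | ι_mul_ι_mul v w x _ hx => exact (commute_ι_mul_ι v w b).mul_left hx

theorem HasParity.ι_mul (ha : HasParity 1 a) (v : (Fin d ⊕ ℕ) →₀ ℂ) :
    ExteriorAlgebra.ι ℂ v * a = -(a * ExteriorAlgebra.ι ℂ v) := by
  unfold HasParity at ha
  induction a, ha using CliffordAlgebra.odd_induction with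
  | ι w => exact ι_mul_ι_swap v w
  | add x y _ _ hx hy => rw [mul_add, add_mul, hx, hy, neg_add]
  | ι_mul_ι_mul w w' x _ hx =>
    have h := commute_ι_mul_ι w w' (ExteriorAlgebra.ι ℂ v : Coef d)
    change _ * _ = _ * _ at h
    change ExteriorAlgebra.ι ℂ v * (ExteriorAlgebra.ι ℂ w * ExteriorAlgebra.ι ℂ w' * x) =
      -(ExteriorAlgebra.ι ℂ w * ExteriorAlgebra.ι ℂ w' * x * ExteriorAlgebra.ι ℂ v)
    rw [← mul_assoc, ← h, mul_assoc, hx, mul_neg, mul_assoc (_ * _) x]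

/-- Odd elements anticommute. -/
theorem HasParity.anticommute (ha : HasParity 1 a) (hb : HasParity 1 b) : a * b = -(b * a) := by
  unfold HasParity at ha
  induction a, ha using CliffordAlgebra.odd_induction with
  | ι w => exact hb.ι_mul w
  | add x y _ _ hx hy => rw [mul_add, add_mul, hx, hy, neg_add]
  | ι_mul_ι_mul w w' x _ hx =>
    have h := commute_ι_mul_ι w w' b
    change _ * _ = _ * _ at h
    change ExteriorAlgebra.ι ℂ w * ExteriorAlgebra.ι ℂ w' * x * b =
      -(b * (ExteriorAlgebra.ι ℂ w * ExteriorAlgebra.ι ℂ w' * x))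
    rw [← mul_assoc b, ← h, mul_assoc, hx, mul_neg, mul_assoc (_ * _) b]

/-! ### Cancellation of odd generators -/

open CliffordAlgebra in
-- Only finitely many generators occur in a given element, so the infinite supply of auxiliary ones
-- always leaves fresh ones.
theorem exists_contract_eq_zero (c : Coef d) : ∃ N : ℕ, ∀ n ≥ N,
    contractLeft (Q := (0 : QuadraticForm ℂ ((Fin d ⊕ ℕ) →₀ ℂ)))
      (Finsupp.lapply (Sum.inr n)) c = 0 := by
  induction c using CliffordAlgebra.left_induction with
  | algebraMap r => exact ⟨0, fun n _ => contractLeft_algebraMap _ _ _⟩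
  | add x y hx hy =>
    obtain ⟨N, hN⟩ := hx
    obtain ⟨M, hM⟩ := hy
    exact ⟨max N M, fun n hn => by
      rw [map_add, hN n (le_of_max_le_left hn), hM n (le_of_max_le_right hn), add_zero]⟩
  | ι_mul x m hx =>
    obtain ⟨N, hN⟩ := hx
    obtain ⟨M, hM⟩ : ∃ M : ℕ, ∀ n ≥ M, m (Sum.inr n) = 0 := by
      refine ⟨(m.support.sup fun k => Sum.elim (fun _ => 0) id k) + 1, fun n hn => ?_⟩
      by_contra h
      have := Finset.le_sup (f := fun k : Fin d ⊕ ℕ => Sum.elim (fun _ => 0) id k)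
        (Finsupp.mem_support_iff.2 h)
      simp only [Sum.elim_inr, id] at this
      omega
    refine ⟨max N M, fun n hn => ?_⟩
    rw [contractLeft_ι_mul, hN n (le_of_max_le_left hn), mul_zero, sub_zero,
      Finsupp.lapply_apply, hM n (le_of_max_le_right hn), zero_smul]

open CliffordAlgebra in
/-- There are enough odd elements to separate Grassmann numbers. -/
theorem eq_zero_of_odd_mul (h : ∀ ξ : Coef d, HasParity 1 ξ → ξ * a = 0) : a = 0 := by
  obtain ⟨N, hN⟩ := exists_contract_eq_zero a
  -- Take for `ξ` a generator that does not occur in `a`: contracting `ξ * a` with the dual of `ξ`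
  -- gives back `a`.
  have h1 := h (ExteriorAlgebra.ι ℂ (Finsupp.single (Sum.inr N) 1)) (HasParity.ι _)
  have h2 := contractLeft_ι_mul (Q := (0 : QuadraticForm ℂ ((Fin d ⊕ ℕ) →₀ ℂ)))
    (d := Finsupp.lapply (Sum.inr N)) (Finsupp.single (Sum.inr N) 1) a
  rw [hN N le_rfl, mul_zero, sub_zero] at h2
  have h3 : contractLeft (Q := (0 : QuadraticForm ℂ ((Fin d ⊕ ℕ) →₀ ℂ)))
      (Finsupp.lapply (Sum.inr N)) (ι 0 (Finsupp.single (Sum.inr N) 1) * a) = 0 := by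
    have : (ι 0 (Finsupp.single (Sum.inr N) 1) * a : Coef d) = 0 := h1
    rw [this, map_zero]
  rw [h3] at h2
  simpa using h2.symm

/-! ### The exponential -/

/-- The nilpotent part of a Grassmann number. -/
def soul (a : Coef d) : Coef d := a - algebraMap ℂ (Coef d) (body a)

theorem body_add (a b : Coef d) : body (a + b) = body a + body b := map_add _ a b

theorem body_smul (z : ℂ) (a : Coef d) : body (z • a) = z * body a := map_smul _ z a

theorem body_algebraMap (z : ℂ) : body (algebraMap ℂ (Coef d) z) = z :=
  AlgHom.commutes _ z

theorem body_ι_mul (v : (Fin d ⊕ ℕ) →₀ ℂ) (a : Coef d) :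
    body (ExteriorAlgebra.ι ℂ v * a) = 0 := by
  have : ExteriorAlgebra.algebraMapInv (ExteriorAlgebra.ι ℂ v : Coef d) = (0 : ℂ) := by
    simp [ExteriorAlgebra.algebraMapInv]
  rw [body, map_mul, this, zero_mul]

theorem soul_add (a b : Coef d) : soul (a + b) = soul a + soul b := by
  simp only [soul, body_add, map_add]
  abel

theorem soul_smul (z : ℂ) (a : Coef d) : soul (z • a) = z • soul a := by
  rw [soul, soul, body_smul, map_mul, smul_sub, Algebra.smul_def z (algebraMap _ _ _)]

theorem soul_algebraMap (z : ℂ) : soul (algebraMap ℂ (Coef d) z) = 0 := by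
  rw [soul, body_algebraMap, sub_self]

theorem HasParity.soul (ha : HasParity 0 a) : HasParity 0 (soul a) := ha.sub (.algebraMap _)

/-- Even elements are sums of scalars, which have no soul, and of products that begin with two
generators. Such a product has no body, and its square vanishes because a pair of generators is
central with square zero. Commuting nilpotent elements have a nilpotent sum. -/
theorem HasParity.isNilpotent_soul (ha : HasParity 0 a) : IsNilpotent (PSM.soul a) := by
  unfold HasParity at ha
  induction a, ha using CliffordAlgebra.even_induction with
  | algebraMap r =>
    exact (soul_algebraMap r).symm ▸ IsNilpotent.zero
  | add x y hx hy ihx ihy =>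
    rw [soul_add]
    exact Commute.isNilpotent_add (HasParity.commute (HasParity.soul hx) _) ihx ihy
  | ι_mul_ι_mul v w x hx ih =>
    change IsNilpotent (PSM.soul (ExteriorAlgebra.ι ℂ v * ExteriorAlgebra.ι ℂ w * x))
    have h0 : PSM.soul (ExteriorAlgebra.ι ℂ v * ExteriorAlgebra.ι ℂ w * x : Coef d) =
        ExteriorAlgebra.ι ℂ v * ExteriorAlgebra.ι ℂ w * x := by
      rw [PSM.soul, mul_assoc, body_ι_mul, map_zero, sub_zero]
    refine ⟨2, ?_⟩
    rw [h0, (commute_ι_mul_ι v w x).mul_pow, pow_two (_ * _)]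
    have : (ExteriorAlgebra.ι ℂ v * ExteriorAlgebra.ι ℂ w *
        (ExteriorAlgebra.ι ℂ v * ExteriorAlgebra.ι ℂ w) : Coef d) = 0 := by
      rw [mul_assoc, ← mul_assoc (ExteriorAlgebra.ι ℂ w), ι_mul_ι_swap w v, neg_mul, mul_neg,
        mul_assoc, ExteriorAlgebra.ι_sq_zero, mul_zero, mul_zero, neg_zero]
    rw [this, zero_mul]

/-- Replaces the `finsum` by a sum of prescribed length, so that one length can be used along a
whole curve. -/
theorem gexp_eq_sum {N : ℕ} (h : soul a ^ N = 0) :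
    gexp a = Complex.exp (body a) • ∑ n ∈ Finset.range N, ((n.factorial : ℂ)⁻¹) • soul a ^ n := by
  rw [gexp]
  congr 1
  refine finsum_eq_sum_of_support_subset _ fun n hn => ?_
  rw [Finset.coe_range, mem_Iio]
  by_contra hN
  refine hn ?_
  change _ • soul a ^ n = 0
  rw [pow_eq_zero_of_le (not_lt.1 hN) h, smul_zero]

theorem HasWDeriv.pow {f : ℝ → Coef d} {s : Set ℝ} {t : ℝ} {c : Coef d} (hf : HasWDeriv f c s t)
    (hfs : SmoothCoef f s) (hs : UniqueDiffWithinAt ℝ s t) (ht : t ∈ s)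
    (hc : Commute c (f t)) (n : ℕ) :
    HasWDeriv (fun x => f x ^ (n + 1)) ((n + 1 : ℂ) • (c * f t ^ n)) s t := by
  induction n with
  | zero => simpa using hf
  | succ n ih =>
    have h := ih.mul hf (hfs.pow (n + 1)) hfs hs ht
    have h2 : ((n + 1 : ℂ) • (c * f t ^ n)) * f t + f t ^ (n + 1) * c =
        (((n + 1 : ℕ) : ℂ) + 1) • (c * f t ^ (n + 1)) := by
      rw [smul_mul_assoc, mul_assoc, ← pow_succ, ← (hc.pow_right (n + 1)).eq]
      push_cast
      module
    rw [h2] at h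
    simpa only [pow_succ] using h

/-- The derivative of the exponential along an even curve that is quadratic in time. -/
theorem hasWDeriv_gexp {S₀ S₁ S₂ : Coef d} (h₀ : HasParity 0 S₀) (h₁ : HasParity 0 S₁)
    (h₂ : HasParity 0 S₂) :
    HasWDeriv (fun t : ℝ => gexp (S₀ + (t : ℂ) • S₁ + ((t : ℂ) ^ 2) • S₂)) (S₁ * gexp S₀)
      univ 0 := by
  set f : ℝ → Coef d := fun t => S₀ + (t : ℂ) • S₁ + ((t : ℂ) ^ 2) • S₂ with hf
  have hpar : ∀ t, HasParity 0 (f t) := fun t => (h₀.add (h₁.smul _)).add (h₂.smul _)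
  have hf0 : f 0 = S₀ := by simp [hf]
  have hsoul : ∀ t, soul (f t) = soul S₀ + (t : ℂ) • soul S₁ + ((t : ℂ) ^ 2) • soul S₂ := fun t => by
    simp only [hf, soul_add, soul_smul]
  have hbody : ∀ t, body (f t) = body S₀ + (t : ℂ) * body S₁ + ((t : ℂ) ^ 2) * body S₂ := fun t => by
    simp only [hf, body_add, body_smul]
  -- A single exponent has to serve all times; it is combined from the nilpotency orders of the
  -- three even, hence commuting, coefficients.
  obtain ⟨N, hN⟩ : ∃ N, ∀ t, soul (f t) ^ N = 0 := by
    obtain ⟨n₀, hn₀⟩ := h₀.isNilpotent_soul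
    obtain ⟨n₁, hn₁⟩ := h₁.isNilpotent_soul
    obtain ⟨n₂, hn₂⟩ := h₂.isNilpotent_soul
    refine ⟨(n₀ + n₁ - 1) + n₂ - 1, fun t => ?_⟩
    rw [hsoul]
    refine Commute.add_pow_add_eq_zero_of_pow_eq_zero ?_ ?_ ?_
    · exact (((h₀.soul).add (h₁.soul.smul _))).commute _
    · refine Commute.add_pow_add_eq_zero_of_pow_eq_zero (h₀.soul.commute _) hn₀ ?_
      rw [smul_pow, hn₁, smul_zero]
    · rw [smul_pow, hn₂, smul_zero]
  -- Differentiation shortens the exponential series by one term, so one more term than necessary is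
  -- kept.
  have hN' : ∀ t, soul (f t) ^ (N + 1) = 0 := fun t => by rw [pow_succ, hN, zero_mul]
  have hofReal : ContDiff ℝ ∞ (fun t : ℝ => (t : ℂ)) := Complex.ofRealCLM.contDiff
  have hsm : SmoothCoef (fun t => soul (f t)) univ := by
    refine SmoothCoef.congr (f := fun t : ℝ =>
      soul S₀ + (t : ℂ) • soul S₁ + ((t : ℂ) ^ 2) • soul S₂) ?_ fun t _ => hsoul t
    exact ((SmoothCoef.const _).add (.smul_const hofReal.contDiffOn _)).add
      (.smul_const (hofReal.pow 2).contDiffOn _)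
  have hd1 : HasDerivWithinAt (fun t : ℝ => (t : ℂ)) 1 univ 0 :=
    (Complex.ofRealCLM.hasDerivAt (x := (0 : ℝ))).hasDerivWithinAt
  have hd2 : HasDerivWithinAt (fun t : ℝ => (t : ℂ) ^ 2) 0 univ 0 := by
    simpa using hd1.fun_pow 2
  have hds : HasWDeriv (fun t => soul (f t)) (soul S₁) univ 0 := by
    have := ((hasWDeriv_const (s := univ) (t := 0) (soul S₀)).add
      (hasWDeriv_smul hd1 (soul S₁))).add (hasWDeriv_smul hd2 (soul S₂))
    simp only [zero_add, one_smul, zero_smul, add_zero] at this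
    exact this.congr (fun t _ => hsoul t) (mem_univ _)
  have hdb : HasDerivWithinAt (fun t => Complex.exp (body (f t)))
      (Complex.exp (body S₀) * body S₁) univ 0 := by
    have h := (((hasDerivWithinAt_const (0 : ℝ) univ (body S₀)).fun_add
      (hd1.mul_const (body S₁))).fun_add (hd2.mul_const (body S₂))).cexp
    simpa [hbody] using h
  have hbsm : ContDiffOn ℝ ∞ (fun t => Complex.exp (body (f t))) univ := by
    simp only [hbody]
    exact (((contDiff_const.add (hofReal.mul contDiff_const)).add
      ((hofReal.pow 2).mul contDiff_const)).cexp).contDiffOn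
  have hpow : ∀ n ∈ Finset.range (N + 1), HasWDeriv (fun t => ((n.factorial : ℂ)⁻¹) • soul (f t) ^ n)
      (((n.factorial : ℂ)⁻¹) • ((n : ℂ) • (soul S₁ * soul S₀ ^ (n - 1)))) univ 0 := fun n _ => by
    refine HasWDeriv.const_smul ?_ _
    cases n with
    | zero => simpa using hasWDeriv_const (1 : Coef d)
    | succ n =>
      have := hds.pow hsm uniqueDiffWithinAt_univ (mem_univ _) (h₁.soul.commute _) n
      rw [hf0] at this
      simpa using this
  have hsum := HasWDeriv.finsetSum _ hpow
  have key := (hasWDeriv_smul hdb (1 : Coef d)).mul hsum (SmoothCoef.smul_const hbsm 1)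
    (SmoothCoef.sum _ fun n _ => (hsm.pow n).const_smul _) uniqueDiffWithinAt_univ (mem_univ _)
  have hE : ∑ n ∈ Finset.range (N + 1),
      (((n.factorial : ℂ)⁻¹) • ((n : ℂ) • (soul S₁ * soul S₀ ^ (n - 1)))) =
      soul S₁ * ∑ n ∈ Finset.range N, ((n.factorial : ℂ)⁻¹) • soul S₀ ^ n := by
    rw [Finset.sum_range_succ', Finset.mul_sum]
    simp only [Nat.cast_zero, zero_smul, smul_zero, add_zero]
    refine Finset.sum_congr rfl fun n _ => ?_
    rw [smul_smul, mul_smul_comm, Nat.add_sub_cancel]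
    congr 1
    rw [Nat.factorial_succ]
    have : (n.factorial : ℂ) ≠ 0 := by exact_mod_cast n.factorial_ne_zero
    have : (n + 1 : ℂ) ≠ 0 := by exact_mod_cast n.succ_ne_zero
    push_cast
    field_simp
  have hS₀ : soul S₀ ^ N = 0 := by rw [← hf0]; exact hN 0
  have hS₀' : soul S₀ ^ (N + 1) = 0 := by rw [← hf0]; exact hN' 0
  -- The derivative of the exponential of the body supplies the body of `S₁`, the derivative of the
  -- series supplies its soul.
  have hval : (Complex.exp (body S₀) * body S₁) • (1 : Coef d) *
        (∑ n ∈ Finset.range (N + 1), ((n.factorial : ℂ)⁻¹) • soul (f 0) ^ n) +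
      Complex.exp (body (f 0)) • (1 : Coef d) * ∑ n ∈ Finset.range (N + 1),
      (((n.factorial : ℂ)⁻¹) • ((n : ℂ) • (soul S₁ * soul S₀ ^ (n - 1)))) = S₁ * gexp S₀ := by
    rw [hE, hf0, gexp_eq_sum hS₀, Finset.sum_range_succ, hS₀, smul_zero, add_zero]
    have : S₁ = body S₁ • (1 : Coef d) + soul S₁ := by
      rw [soul, Algebra.algebraMap_eq_smul_one]; abel
    conv_rhs => rw [this]
    simp only [smul_mul_assoc, one_mul, add_mul, mul_smul_comm, smul_add, smul_smul]
  rw [hval] at key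
  refine key.congr (fun t _ => ?_) (mem_univ _)
  rw [gexp_eq_sum (hN' t), smul_mul_assoc, one_mul]

end Parity


end

section

/-! ## Integrals depending on a parameter -/

section Parametric

open Topology Function

/-- Derivatives are taken within a convex set because the disk is closed and its boundary points
matter. The remainder of the integrand is estimated by the mean value inequality, uniformly over the
compact interval of integration. -/
theorem hasFDerivWithinAt_intervalIntegral {E F : Type*} [NormedAddCommGroup E] [NormedSpace ℝ E]
    [NormedAddCommGroup F] [NormedSpace ℝ F] {S : Set E} (hS : Convex ℝ S)
    {a b : ℝ} (hab : a ≤ b) {k : E → ℝ → F} {k' : E → ℝ → E →L[ℝ] F}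
    (hk : ∀ x ∈ S, ContinuousOn (k x) (Icc a b))
    (hk' : ContinuousOn (uncurry k') (S ×ˢ Icc a b))
    (hd : ∀ x ∈ S, ∀ u ∈ Icc a b, HasFDerivWithinAt (fun y => k y u) (k' x u) S x)
    {x : E} (hx : x ∈ S) [CompleteSpace F] :
    HasFDerivWithinAt (fun y => ∫ u in a..b, k y u) (∫ u in a..b, k' x u) S x := by
  have hkx' : ContinuousOn (k' x) (Icc a b) :=
    hk'.comp (f := fun u => (x, u)) (by fun_prop) fun u hu => ⟨hx, hu⟩
  have hint : ∀ y ∈ S, IntervalIntegrable (k y) volume a b := fun y hy =>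
    (hk y hy).intervalIntegrable_of_Icc hab
  have hint' : IntervalIntegrable (k' x) volume a b := hkx'.intervalIntegrable_of_Icc hab
  rw [hasFDerivWithinAt_iff_isLittleO, Asymptotics.isLittleO_iff]
  intro ε hε
  -- The added one keeps the denominator positive when the interval is a single point.
  set ε' := ε / (b - a + 1) with hε'
  have hba : 0 < b - a + 1 := by linarith
  have hε'0 : 0 < ε' := div_pos hε hba
  -- Compactness gives one neighbourhood of `x` on which `k'` is close to its value at `x` for all
  -- `u` simultaneously.
  obtain ⟨v, hv, hvk⟩ := isCompact_Icc.mem_uniformity_of_prod hk' hx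
    (Metric.dist_mem_uniformity hε'0)
  obtain ⟨δ, hδ, hδv⟩ := Metric.mem_nhdsWithin_iff.1 hv
  have key : ∀ y ∈ S ∩ Metric.ball x δ,
      ‖(∫ u in a..b, k y u) - (∫ u in a..b, k x u) - (∫ u in a..b, k' x u) (y - x)‖ ≤
        ε * ‖y - x‖ := by
    rintro y ⟨hyS, hyδ⟩
    have h1 : (∫ u in a..b, k y u) - (∫ u in a..b, k x u) - (∫ u in a..b, k' x u) (y - x) =
        ∫ u in a..b, (k y u - k x u - k' x u (y - x)) := by
      rw [intervalIntegral.integral_sub ((hint y hyS).sub (hint x hx)),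
        intervalIntegral.integral_sub (hint y hyS) (hint x hx),
        ContinuousLinearMap.intervalIntegral_apply hint']
      exact (hkx'.clm_apply continuousOn_const).intervalIntegrable_of_Icc hab
    rw [h1]
    have h2 : ∀ u ∈ uIoc a b, ‖k y u - k x u - k' x u (y - x)‖ ≤ ε' * ‖y - x‖ := by
      intro u hu
      rw [uIoc_of_le hab] at hu
      have hu' : u ∈ Icc a b := ⟨hu.1.le, hu.2⟩
      refine (hS.inter (convex_ball x δ)).norm_image_sub_le_of_norm_hasFDerivWithin_le'
        (f := fun y => k y u) (f' := fun y => k' y u)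
        (fun z hz => (hd z hz.1 u hu').mono inter_subset_left) (fun z hz => ?_)
        ⟨hx, Metric.mem_ball_self hδ⟩ ⟨hyS, hyδ⟩
      have := hvk z (hδv ⟨hz.2, hz.1⟩) u hu'
      rw [← dist_eq_norm]
      exact le_of_lt this
    refine (intervalIntegral.norm_integral_le_of_norm_le_const h2).trans ?_
    rw [abs_of_nonneg (by linarith : 0 ≤ b - a), hε']
    have h3 : ε / (b - a + 1) * ‖y - x‖ * (b - a) = ε * ‖y - x‖ * ((b - a) / (b - a + 1)) := by
      ring
    rw [h3]
    exact mul_le_of_le_one_right (by positivity) ((div_le_one hba).2 (by linarith))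
  have hmem : S ∩ Metric.ball x δ ∈ 𝓝[S] x :=
    Filter.inter_mem self_mem_nhdsWithin (mem_nhdsWithin_of_mem_nhds (Metric.ball_mem_nhds x hδ))
  exact Filter.mem_of_superset hmem key

/-- Differentiating under the integral turns the kernel into one with values in a space of linear
maps. The induction on the order therefore runs over all target spaces at once. -/
theorem contDiffOn_kernel_integral_nat {E : Type} [NormedAddCommGroup E] [NormedSpace ℝ E]
    {S : Set E} (hS : Convex ℝ S) (hSo : IsOpen S) {T : Set ℝ} (hT : IsOpen T) {a b : ℝ}
    (hab : a ≤ b) (habT : Icc a b ⊆ T) {φ : ℝ → ℂ} (hφ : ContinuousOn φ (Icc a b)) (n : ℕ) :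
    ∀ {F : Type} [NormedAddCommGroup F] [NormedSpace ℝ F] [NormedSpace ℂ F] [SMulCommClass ℝ ℂ F]
      [CompleteSpace F] {k : E × ℝ → F} (_ : ContDiffOn ℝ ∞ k (S ×ˢ T)),
      ContDiffOn ℝ n (fun x => ∫ u in a..b, φ u • k (x, u)) S ∧
      ∀ x ∈ S, HasFDerivAt (fun x => ∫ u in a..b, φ u • k (x, u))
        (∫ u in a..b, φ u • (fderiv ℝ k (x, u)).comp (ContinuousLinearMap.inl ℝ E ℝ)) x := by
  have hder : ∀ {F : Type} [NormedAddCommGroup F] [NormedSpace ℝ F] [NormedSpace ℂ F]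
      [SMulCommClass ℝ ℂ F] [CompleteSpace F] {k : E × ℝ → F} (_ : ContDiffOn ℝ ∞ k (S ×ˢ T)),
      ContDiffOn ℝ ∞ (fun p => (fderiv ℝ k p).comp (ContinuousLinearMap.inl ℝ E ℝ)) (S ×ˢ T) ∧
      ∀ x ∈ S, HasFDerivAt (fun x => ∫ u in a..b, φ u • k (x, u))
        (∫ u in a..b, φ u • (fderiv ℝ k (x, u)).comp (ContinuousLinearMap.inl ℝ E ℝ)) x := by
    intro F _ _ _ _ _ k hk
    have h1 : ContDiffOn ℝ ∞ (fun p => (fderiv ℝ k p).comp (ContinuousLinearMap.inl ℝ E ℝ))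
        (S ×ˢ T) :=
      (hk.fderiv_of_isOpen (hSo.prod hT) (by simp)).clm_comp contDiffOn_const
    refine ⟨h1, fun x hx => ?_⟩
    refine (hasFDerivWithinAt_intervalIntegral (k := fun x u => φ u • k (x, u))
      (k' := fun x u => φ u • (fderiv ℝ k (x, u)).comp (ContinuousLinearMap.inl ℝ E ℝ)) hS hab
      (fun y hy => ?_) ?_ (fun y hy u hu => ?_) hx).hasFDerivAt (hSo.mem_nhds hx)
    · exact hφ.smul (hk.continuousOn.comp (f := fun u => (y, u)) (by fun_prop)
        fun u hu => ⟨hy, habT hu⟩)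
    · refine ContinuousOn.smul (f := fun p : E × ℝ => φ p.2)
        (g := fun p : E × ℝ => (fderiv ℝ k p).comp (ContinuousLinearMap.inl ℝ E ℝ)) ?_ ?_
      · exact hφ.comp continuousOn_snd fun p hp => hp.2
      · exact h1.continuousOn.mono (prod_mono le_rfl habT)
    · have h2 : HasFDerivAt k (fderiv ℝ k (y, u)) (y, u) :=
        ((hk.contDiffAt ((hSo.prod hT).mem_nhds ⟨hy, habT hu⟩)).differentiableAt
          (by simp)).hasFDerivAt
      exact ((h2.comp y (hasFDerivAt_prodMk_left y u)).const_smul (φ u)).hasFDerivWithinAt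
  induction n with
  | zero =>
    intro F _ _ _ _ _ k hk
    refine ⟨?_, (hder hk).2⟩
    rw [Nat.cast_zero, contDiffOn_zero]
    exact fun x hx => ((hder hk).2 x hx).continuousAt.continuousWithinAt
  | succ n ih =>
    intro F _ _ _ _ _ k hk
    refine ⟨?_, (hder hk).2⟩
    rw [Nat.cast_succ, contDiffOn_succ_iff_hasFDerivWithinAt_of_uniqueDiffOn hSo.uniqueDiffOn]
    refine ⟨fun h => by simp at h, _, (ih (hder hk).1).1, fun x hx =>
      ((hder hk).2 x hx).hasFDerivWithinAt⟩

/-- The integral of a smooth kernel against a continuous function is smooth. -/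
theorem contDiffOn_kernel_integral {E : Type} [NormedAddCommGroup E] [NormedSpace ℝ E]
    {S : Set E} (hS : Convex ℝ S) (hSo : IsOpen S) {T : Set ℝ} (hT : IsOpen T) {a b : ℝ}
    (hab : a ≤ b) (habT : Icc a b ⊆ T) {φ : ℝ → ℂ} (hφ : ContinuousOn φ (Icc a b))
    {k : E × ℝ → ℂ} (hk : ContDiffOn ℝ ∞ k (S ×ˢ T)) :
    ContDiffOn ℝ ∞ (fun x => ∫ u in a..b, φ u * k (x, u)) S :=
  contDiffOn_infty.2 fun n => (contDiffOn_kernel_integral_nat hS hSo hT hab habT hφ n hk).1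

theorem hasDerivAt_kernel_integral {S T : Set ℝ} (hS : Convex ℝ S) (hSo : IsOpen S)
    {a b : ℝ} (hab : a ≤ b) (habT : Icc a b ⊆ T)
    {φ : ℝ → ℂ} (hφ : ContinuousOn φ (Icc a b)) {k k' : ℝ × ℝ → ℂ}
    (hk : ContinuousOn k (S ×ˢ T)) (hk' : ContinuousOn k' (S ×ˢ T))
    (h : ∀ x ∈ S, ∀ u ∈ T, HasDerivAt (fun y => k (y, u)) (k' (x, u)) x) {x : ℝ} (hx : x ∈ S) :
    HasDerivAt (fun x => ∫ u in a..b, φ u * k (x, u)) (∫ u in a..b, φ u * k' (x, u)) x := by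
  have hc : ∀ {g : ℝ × ℝ → ℂ}, ContinuousOn g (S ×ˢ T) → ∀ y ∈ S,
      ContinuousOn (fun u => φ u * g (y, u)) (Icc a b) := fun hg y hy =>
    hφ.mul (hg.comp (f := fun u => (y, u)) (by fun_prop) fun u hu => ⟨hy, habT hu⟩)
  have key := (hasFDerivWithinAt_intervalIntegral (k := fun x u => φ u * k (x, u))
    (k' := fun x u => ContinuousLinearMap.toSpanSingleton ℝ (φ u * k' (x, u))) hS hab
    (hc hk) ?_ (fun y hy u hu => ?_) hx).hasFDerivAt (hSo.mem_nhds hx)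
  · have h2 := key.hasDerivAt
    rw [ContinuousLinearMap.intervalIntegral_apply] at h2
    · simpa using h2
    · refine ContinuousOn.intervalIntegrable_of_Icc hab ?_
      exact (ContinuousLinearMap.toSpanSingletonCLE (𝕜 := ℝ) (E := ℂ)).continuous.comp_continuousOn
        (hc hk' x hx)
  · refine (ContinuousLinearMap.toSpanSingletonCLE (𝕜 := ℝ) (E := ℂ)).continuous.comp_continuousOn
      (f := fun p : ℝ × ℝ => φ p.2 * k' p) ?_
    exact (hφ.comp continuousOn_snd fun p hp => hp.2).mul (hk'.mono (prod_mono le_rfl habT))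
  · exact ((h y hy u (habT hu)).const_mul (φ u)).hasFDerivAt.hasFDerivWithinAt

end Parametric


end

section

/-! ## Relative cohomology of the disk -/

section Cohomology

open Topology

theorem bpt_eq (t : ℝ) : bpt t = ⟨Real.cos t, Real.sin t⟩ := by
  apply Complex.ext <;> simp [bpt, Complex.exp_ofReal_mul_I_re, Complex.exp_ofReal_mul_I_im]

@[simp]
theorem norm_bpt (t : ℝ) : ‖bpt t‖ = 1 := Complex.norm_exp_ofReal_mul_I t

theorem bpt_mem_disk (t : ℝ) : bpt t ∈ disk := by simp [disk]

theorem bpt_add (s t : ℝ) : bpt (s + t) = bpt s * bpt t := by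
  simp [bpt, add_mul, Complex.exp_add]

theorem hasDerivAt_bpt (t : ℝ) : HasDerivAt bpt (btan t) t := by
  have h : HasDerivAt (fun t : ℝ => (t : ℂ) * Complex.I) Complex.I t := by
    simpa using (Complex.ofRealCLM.hasDerivAt (x := t)).mul_const Complex.I
  exact h.cexp.congr_deriv (mul_comm _ _)

theorem contDiff_bpt : ContDiff ℝ ∞ bpt :=
  Complex.contDiff_exp.comp (Complex.ofRealCLM.contDiff.mul contDiff_const)

theorem contDiff_btan : ContDiff ℝ ∞ btan := contDiff_const.mul contDiff_bpt

theorem convex_disk : Convex ℝ disk := convex_closedBall 0 1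

theorem contDiffOn_infty_of_hasFDerivWithinAt {E F : Type*} [NormedAddCommGroup E]
    [NormedSpace ℝ E] [NormedAddCommGroup F] [NormedSpace ℝ F] {s : Set E} {f : E → F}
    {f' : E → E →L[ℝ] F} (hs : UniqueDiffOn ℝ s) (hf' : ContDiffOn ℝ ∞ f' s)
    (h : ∀ x ∈ s, HasFDerivWithinAt f (f' x) s x) : ContDiffOn ℝ ∞ f s :=
  (contDiffOn_infty_iff_fderivWithin hs).2 ⟨fun x hx => (h x hx).differentiableWithinAt,
    hf'.congr fun x hx => (h x hx).fderivWithin (hs x hx)⟩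

/-- The Poincaré lemma on a convex subset of a real normed space. -/
theorem exists_primitive {E : Type*} [NormedAddCommGroup E] [NormedSpace ℝ E] {s : Set E}
    (hs : Convex ℝ s) (hu : UniqueDiffOn ℝ s) {ϖ : E → E →L[ℝ] ℝ} (hϖ : ContDiffOn ℝ ∞ ϖ s)
    (hc : ∀ z ∈ s, ∀ x y, fderivWithin ℝ ϖ s z x y = fderivWithin ℝ ϖ s z y x) :
    ∃ f : E → ℝ, ContDiffOn ℝ ∞ f s ∧ ∀ z ∈ s, HasFDerivWithinAt f (ϖ z) s z := by
  obtain ⟨f, hf⟩ := hs.exists_forall_hasFDerivWithinAt_of_fderivWithin_symmetric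
    (hϖ.differentiableOn (by simp)) fun a ha x _ y _ => hc a ha x y
  exact ⟨f, contDiffOn_infty_of_hasFDerivWithinAt hu hϖ hf, hf⟩

theorem symmetric_of_curl_eq_zero {A : ℂ →L[ℝ] ℂ →L[ℝ] ℝ} (h : A 1 Complex.I = A Complex.I 1)
    (x y : ℂ) : A x y = A y x := by
  have key : ∀ z : ℂ, z = z.re • (1 : ℂ) + z.im • Complex.I := fun z => by
    simp [Complex.re_add_im]
  rw [key x, key y]
  simp only [map_add, map_smul, add_apply, smul_apply, smul_eq_mul]
  rw [h]
  ring

theorem hasDerivAt_comp_bpt {f : ℂ → ℝ} {L : ℂ →L[ℝ] ℝ} {t : ℝ}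
    (h : HasFDerivWithinAt f L disk (bpt t)) : HasDerivAt (fun t => f (bpt t)) (L (btan t)) t :=
  h.comp_hasDerivAt t (hasDerivAt_bpt t) (Filter.Eventually.of_forall bpt_mem_disk)

variable {x y : ℝ}

/-- A cocycle is constant on the convex disk and takes the value zero on the arc. -/
theorem subsingleton_H0 (hxy : x < y) : Subsingleton (H0 (Icc x y)) := by
  rw [Submodule.Quotient.subsingleton_iff, Submodule.submoduleOf, Submodule.eq_top_iff']
  rintro ⟨f, hf, hf'⟩
  intro z hz
  have := convex_disk.is_const_of_fderivWithin_eq_zero (hf.1.differentiableOn (by simp)) hf' hz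
    (bpt_mem_disk x)
  exact this.trans (hf.2 x (left_mem_Icc.2 hxy.le))

/-- The primitive given by the Poincaré lemma is constant along the arc because the tangential part
of the form vanishes there; subtracting this constant makes it a relative function. -/
theorem subsingleton_H1 (hxy : x < y) : Subsingleton (H1 (Icc x y)) := by
  refine (Submodule.Quotient.subsingleton_iff (R := ℝ) (M := cocycle1 (Icc x y))).2 ?_
  rw [Submodule.submoduleOf, Submodule.eq_top_iff']
  rintro ⟨ϖ, ⟨hϖ, hϖγ⟩, hc⟩
  obtain ⟨f, hf, hfd⟩ := exists_primitive convex_disk uniqueDiff_disk hϖ fun z hz =>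
    symmetric_of_curl_eq_zero (sub_eq_zero.1 (hc z hz))
  have hconst : ∀ t ∈ Icc x y, f (bpt t) = f (bpt x) := by
    refine constant_of_derivWithin_zero (fun t ht => ?_) fun t ht => ?_
    · exact (hasDerivAt_comp_bpt (hfd _ (bpt_mem_disk t))).differentiableAt.differentiableWithinAt
    · rw [((hasDerivAt_comp_bpt (hfd _ (bpt_mem_disk t))).hasDerivWithinAt).derivWithin
        (uniqueDiffOn_Icc hxy t ⟨ht.1, ht.2.le⟩)]
      exact hϖγ t ⟨ht.1, ht.2.le⟩
  refine ⟨fun z => f z - f (bpt x), ⟨hf.sub contDiffOn_const, fun t ht => ?_⟩, fun z hz => ?_⟩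
  · exact sub_eq_zero.2 (hconst t ht)
  · exact (((hfd z hz).sub_const _).fderivWithin (uniqueDiff_disk z hz)).symm

/-- Radial averages of smooth functions on the disk are smooth. -/
theorem contDiffOn_radial_nat (n : ℕ) :
    ∀ {F : Type} [NormedAddCommGroup F] [NormedSpace ℝ F] [CompleteSpace F] (m : ℕ) {ρ : ℂ → F}
      (_ : ContDiffOn ℝ ∞ ρ disk),
      ContDiffOn ℝ n (fun z => ∫ s in (0 : ℝ)..1, s ^ m • ρ (s • z)) disk ∧
      ∀ z ∈ disk, HasFDerivWithinAt (fun z => ∫ s in (0 : ℝ)..1, s ^ m • ρ (s • z))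
        (∫ s in (0 : ℝ)..1, s ^ (m + 1) • fderivWithin ℝ ρ disk (s • z)) disk z := by
  have hmaps : ∀ s ∈ Icc (0 : ℝ) 1, ∀ z ∈ disk, s • z ∈ disk := fun s hs z hz => by
    simp only [disk, Metric.mem_closedBall, dist_zero_right] at hz ⊢
    rw [norm_smul, Real.norm_of_nonneg hs.1]
    exact mul_le_one₀ hs.2 (norm_nonneg _) hz
  have hcont : ∀ {G : Type} [NormedAddCommGroup G] [NormedSpace ℝ G] (m : ℕ) {ρ : ℂ → G},
      ContinuousOn ρ disk →
      ContinuousOn (Function.uncurry fun (z : ℂ) (s : ℝ) => s ^ m • ρ (s • z))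
        (disk ×ˢ Icc (0 : ℝ) 1) := fun m ρ hρ => by
    refine ContinuousOn.smul (f := fun p : ℂ × ℝ => p.2 ^ m)
      (g := fun p : ℂ × ℝ => ρ (p.2 • p.1)) (by fun_prop) ?_
    exact hρ.comp (by fun_prop) fun p hp => hmaps _ hp.2 _ hp.1
  have hder : ∀ {F : Type} [NormedAddCommGroup F] [NormedSpace ℝ F] [CompleteSpace F] (m : ℕ)
      {ρ : ℂ → F} (_ : ContDiffOn ℝ ∞ ρ disk),
      ∀ z ∈ disk, HasFDerivWithinAt (fun z => ∫ s in (0 : ℝ)..1, s ^ m • ρ (s • z))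
        (∫ s in (0 : ℝ)..1, s ^ (m + 1) • fderivWithin ℝ ρ disk (s • z)) disk z := by
    intro F _ _ _ m ρ hρ z hz
    have hρ' := ((contDiffOn_infty_iff_fderivWithin uniqueDiff_disk).1 hρ).2
    refine hasFDerivWithinAt_intervalIntegral (k := fun (z : ℂ) (s : ℝ) => s ^ m • ρ (s • z))
      (k' := fun (z : ℂ) (s : ℝ) => s ^ (m + 1) • fderivWithin ℝ ρ disk (s • z)) convex_disk
      zero_le_one (fun w hw => ?_) ?_ (fun w hw s hs => ?_) hz
    · have h1 := hcont m hρ.continuousOn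
      exact h1.comp (f := fun s => (w, s)) (by fun_prop) fun s hs => ⟨hw, hs⟩
    · have h1 := hcont (m + 1) hρ'.continuousOn
      exact h1
    · have h1 := (hρ.differentiableOn (by simp) _ (hmaps s hs w hw)).hasFDerivWithinAt
      have h2 := (h1.comp w ((hasFDerivWithinAt_id w disk).const_smul s)
        (fun v hv => hmaps s hs v hv)).const_smul (s ^ m)
      refine h2.congr_fderiv (ContinuousLinearMap.ext fun v => ?_)
      simp [pow_succ, mul_smul]
  -- A derivative raises the exponent of `s` by one and changes the target space, so both stay
  -- general in the induction.
  induction n with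
  | zero =>
    intro F _ _ _ m ρ hρ
    refine ⟨?_, hder m hρ⟩
    rw [Nat.cast_zero, contDiffOn_zero]
    exact fun z hz => (hder m hρ z hz).continuousWithinAt
  | succ n ih =>
    intro F _ _ _ m ρ hρ
    refine ⟨?_, hder m hρ⟩
    rw [Nat.cast_succ, contDiffOn_succ_iff_hasFDerivWithinAt_of_uniqueDiffOn uniqueDiff_disk]
    exact ⟨fun h => by simp at h, _,
      (ih (m + 1) ((contDiffOn_infty_iff_fderivWithin uniqueDiff_disk).1 hρ).2).1, hder m hρ⟩

/-- The one-form `x dy - y dx`. -/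
def rotForm : ℂ →L[ℝ] ℂ →L[ℝ] ℝ :=
  LinearMap.mkContinuous₂ (LinearMap.mk₂ ℝ (fun z w : ℂ => z.re * w.im - z.im * w.re)
      (fun _ _ _ => by simp; ring) (fun _ _ _ => by simp; ring) (fun _ _ _ => by simp; ring)
      (fun _ _ _ => by simp; ring)) 2 fun z w => by
        simp only [LinearMap.mk₂_apply]
        have h1 := Complex.abs_re_le_norm z
        have h2 := Complex.abs_im_le_norm z
        have h3 := Complex.abs_re_le_norm w
        have h4 := Complex.abs_im_le_norm w
        calc ‖z.re * w.im - z.im * w.re‖ ≤ ‖z.re * w.im‖ + ‖z.im * w.re‖ := norm_sub_le _ _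
          _ = |z.re| * |w.im| + |z.im| * |w.re| := by simp
          _ ≤ ‖z‖ * ‖w‖ + ‖z‖ * ‖w‖ := by gcongr
          _ = 2 * ‖z‖ * ‖w‖ := by ring

theorem rotForm_apply (z w : ℂ) : rotForm z w = z.re * w.im - z.im * w.re := rfl

/-- Every two-form on the disk is exact. -/
theorem exists_curl_eq {ρ : ℂ → ℝ} (hρ : ContDiffOn ℝ ∞ ρ disk) :
    ∃ ϖ : ℂ → ℂ →L[ℝ] ℝ, ContDiffOn ℝ ∞ ϖ disk ∧ ∀ z ∈ disk, curl ϖ z = ρ z := by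
  -- This is the homotopy operator of the radial contraction: `ρ dx ∧ dy` is contracted with the
  -- radial vector field and averaged over dilations.
  set G : ℂ → ℝ := fun z => ∫ s in (0 : ℝ)..1, s ^ 1 • ρ (s • z) with hG
  have hGs : ContDiffOn ℝ ∞ G disk := contDiffOn_infty.2 fun n => (contDiffOn_radial_nat n 1 hρ).1
  have hGd := (contDiffOn_radial_nat 0 1 hρ).2
  refine ⟨fun z => G z • rotForm z, hGs.smul rotForm.contDiff.contDiffOn, fun z hz => ?_⟩
  have hd := (hGd z hz).smul (rotForm.hasFDerivWithinAt (s := disk) (x := z))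
  have hmaps : ∀ s ∈ Icc (0 : ℝ) 1, s • z ∈ disk := fun s hs => by
    simp only [disk, Metric.mem_closedBall, dist_zero_right] at hz ⊢
    rw [norm_smul, Real.norm_of_nonneg hs.1]
    exact mul_le_one₀ hs.2 (norm_nonneg _) hz
  have hρ' := ((contDiffOn_infty_iff_fderivWithin uniqueDiff_disk).1 hρ).2
  have hc1 : ContinuousOn (fun s : ℝ => s ^ 2 • fderivWithin ℝ ρ disk (s • z)) (Icc 0 1) :=
    ContinuousOn.smul (f := fun s : ℝ => s ^ 2) (by fun_prop) (hρ'.continuousOn.comp (f := fun s : ℝ => s • z) (by fun_prop)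
      hmaps)
  have hc0 : ContinuousOn (fun s : ℝ => s ^ 1 • ρ (s • z)) (Icc 0 1) :=
    ContinuousOn.smul (f := fun s : ℝ => s ^ 1) (by fun_prop) (hρ.continuousOn.comp (f := fun s : ℝ => s • z) (by fun_prop)
      hmaps)
  have hcurl : curl (fun z => G z • rotForm z) z =
      2 * G z + (∫ s in (0 : ℝ)..1, s ^ 2 • fderivWithin ℝ ρ disk (s • z)) z := by
    have hz' : z = z.re • (1 : ℂ) + z.im • Complex.I := by simp [Complex.re_add_im]
    rw [curl]
    have h0 : fderivWithin ℝ (fun z => G z • rotForm z) disk z = _ :=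
      hd.fderivWithin (uniqueDiff_disk z hz)
    rw [h0]
    conv_rhs => rw [hz', map_add, map_smul, map_smul, ← hz']
    simp [rotForm_apply, hG]
    ring
  -- The integrand of the curl is the derivative of `s ^ 2 * ρ (s • z)`, so the integral is the
  -- value at `s = 1`.
  have hFTC : ∫ s in (0 : ℝ)..1, (2 * (s ^ 1 • ρ (s • z)) +
      (s ^ 2 • fderivWithin ℝ ρ disk (s • z)) z) = 1 ^ 2 * ρ ((1 : ℝ) • z) - 0 ^ 2 * ρ ((0 : ℝ) • z) := by
    have hfd : ∀ s ∈ Icc (0 : ℝ) 1, HasDerivWithinAt (fun s : ℝ => s ^ 2 * ρ (s • z))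
        (2 * (s ^ 1 • ρ (s • z)) + (s ^ 2 • fderivWithin ℝ ρ disk (s • z)) z) (Icc 0 1) s := by
      intro s hs
      have h1 := (hρ.differentiableOn (by simp) _ (hmaps s hs)).hasFDerivWithinAt
      have h2 : HasDerivWithinAt (fun s : ℝ => s • z) z (Icc 0 1) s := by
        simpa using (hasDerivWithinAt_id s (Icc (0 : ℝ) 1)).smul_const z
      have h3 := h1.comp_hasDerivWithinAt s h2 hmaps
      have h4 := ((hasDerivWithinAt_id s (Icc (0 : ℝ) 1)).pow 2).mul h3
      refine h4.congr_deriv ?_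
      simp
      ring
    refine intervalIntegral.integral_eq_sub_of_hasDeriv_right_of_le zero_le_one
      (fun s hs => (hfd s hs).continuousWithinAt) (fun s hs => ?_) ?_
    · exact ((hfd s ⟨hs.1.le, hs.2.le⟩).hasDerivAt (Icc_mem_nhds hs.1 hs.2)).hasDerivWithinAt
    · exact ((continuousOn_const.mul hc0).add
        (hc1.clm_apply continuousOn_const)).intervalIntegrable_of_Icc zero_le_one
  have hi : IntervalIntegrable (fun s : ℝ => 2 * (s ^ 1 • ρ (s • z))) volume 0 1 :=
    (continuousOn_const.mul hc0).intervalIntegrable_of_Icc zero_le_one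
  rw [hcurl]
  rw [intervalIntegral.integral_add hi
    ((hc1.clm_apply continuousOn_const).intervalIntegrable_of_Icc zero_le_one),
    intervalIntegral.integral_const_mul, ← ContinuousLinearMap.intervalIntegral_apply
    (hc1.intervalIntegrable_of_Icc zero_le_one)] at hFTC
  simpa [hG] using hFTC

open scoped Manifold in
/-- A smooth function of the angle on a proper arc extends to the plane. -/
theorem exists_boundary_extension (hyx : y < x + 2 * Real.pi) {H : ℝ → ℝ} (hH : ContDiff ℝ ∞ H) :
    ∃ f : ℂ → ℝ, ContDiff ℝ ∞ f ∧ ∀ t ∈ Icc x y, f (bpt t) = H t := by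
  -- The arc is shorter than a full turn. Rotated so that its midpoint is `1`, it avoids the
  -- negative real axis, and the principal logarithm recovers the angle.
  set μ := (x + y) / 2 with hμ
  set K : Set ℂ := bpt '' Icc (x - μ) (y - μ) with hK
  have hKc : IsCompact K := isCompact_Icc.image contDiff_bpt.continuous
  have harg : ∀ τ ∈ Icc (x - μ) (y - μ), Complex.arg (bpt τ) = τ := fun τ hτ => by
    rw [bpt, Complex.arg_exp_mul_I, toIocMod_eq_self]
    constructor <;> linarith [hτ.1, hτ.2]
  have hKs : K ⊆ Complex.slitPlane := by
    rintro _ ⟨τ, hτ, rfl⟩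
    rw [Complex.mem_slitPlane_iff_arg, harg τ hτ]
    refine ⟨?_, ?_⟩
    · have := hτ.2
      linarith
    · exact norm_ne_zero_iff.1 (by simp)
  -- The cutoff is one near the rotated arc and vanishes near the branch cut, which makes the
  -- product smooth on the whole plane.
  obtain ⟨χ, hχ0, hχ1, -⟩ := exists_contMDiffMap_zero_one_nhds_of_isClosed (n := ⊤) 𝓘(ℝ, ℂ)
    Complex.isOpen_slitPlane.isClosed_compl hKc.isClosed
    (disjoint_compl_left_iff_subset.2 hKs)
  have hχ : ContDiff ℝ ∞ χ := χ.contMDiff.contDiff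
  have hf : ContDiff ℝ ∞ fun w : ℂ => χ w * H (μ + (Complex.log w).im) := by
    rw [contDiff_iff_contDiffAt]
    intro w
    by_cases hw : w ∈ Complex.slitPlane
    · have hl : ContDiffAt ℝ ∞ Complex.log w := (Complex.contDiffAt_log hw).restrict_scalars ℝ
      exact hχ.contDiffAt.mul (hH.contDiffAt.comp w (contDiffAt_const.add
        (Complex.imCLM.contDiff.contDiffAt.comp w hl)))
    · have h0 : ∀ᶠ v in 𝓝 w, χ v = 0 := Filter.Eventually.self_of_nhdsSet hχ0.eventually_nhdsSet w hw
      refine contDiffAt_const (c := (0 : ℝ)) |>.congr_of_eventuallyEq ?_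
      filter_upwards [h0] with v hv
      rw [hv, zero_mul]
  refine ⟨fun z => χ (z * bpt (-μ)) * H (μ + (Complex.log (z * bpt (-μ))).im),
    hf.comp (contDiff_id.mul contDiff_const), fun t ht => ?_⟩
  have hτ : t + -μ ∈ Icc (x - μ) (y - μ) := ⟨by linarith [ht.1], by linarith [ht.2]⟩
  simp only [← bpt_add, Complex.log_im, harg _ hτ]
  rw [hχ1.self_of_nhdsSet _ (mem_image_of_mem _ hτ)]
  simp [show μ + (t + -μ) = t by ring]

/-- A one-form with the right curl may have a tangential part on the arc. Subtracting the
differential of a function whose values on the arc are a primitive of that part removes it and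
leaves the curl unchanged. Such a function on the plane exists because the arc is not the whole
circle. -/
theorem subsingleton_H2 (hxy : x < y) (hyx : y < x + 2 * Real.pi) :
    Subsingleton (H2 (Icc x y)) := by
  rw [Submodule.Quotient.subsingleton_iff, Submodule.submoduleOf, Submodule.eq_top_iff']
  rintro ⟨ρ, hρ⟩
  obtain ⟨ϖ, hϖ, hcurl⟩ := exists_curl_eq hρ
  have hg : ContDiff ℝ ∞ fun t => ϖ (bpt t) (btan t) :=
    ((hϖ.comp_contDiff contDiff_bpt bpt_mem_disk)).clm_apply contDiff_btan
  have hHd : ∀ t, HasDerivAt (fun t => ∫ s in x..t, ϖ (bpt s) (btan s)) (ϖ (bpt t) (btan t)) t :=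
    fun t => hg.continuous.integral_hasStrictDerivAt x t |>.hasDerivAt
  have hH : ContDiff ℝ ∞ fun t => ∫ s in x..t, ϖ (bpt s) (btan s) := by
    rw [contDiff_infty_iff_deriv]
    refine ⟨fun t => (hHd t).differentiableAt, ?_⟩
    rwa [show deriv _ = _ from funext fun t => (hHd t).deriv]
  obtain ⟨f, hf, hft⟩ := exists_boundary_extension hyx hH
  have hf' : ContDiff ℝ ∞ (fderiv ℝ f) := hf.fderiv_right (by simp)
  refine ⟨fun z => ϖ z - fderiv ℝ f z, ⟨hϖ.sub hf'.contDiffOn, fun t ht => ?_⟩, fun z hz => ?_⟩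
  · have h1 : HasDerivWithinAt (fun t => f (bpt t)) (fderiv ℝ f (bpt t) (btan t)) (Icc x y) t :=
      ((hf.differentiable (by simp) _).hasFDerivAt.comp_hasDerivAt t
        (hasDerivAt_bpt t)).hasDerivWithinAt
    have h2 := ((hHd t).hasDerivWithinAt (s := Icc x y)).congr hft (hft t ht)
    rw [sub_apply, (uniqueDiffOn_Icc hxy t ht).eq_deriv _ h1 h2, sub_self]
  · have hz' := uniqueDiff_disk z hz
    have h1 : fderivWithin ℝ (fun z => ϖ z - fderiv ℝ f z) disk z =
        fderivWithin ℝ ϖ disk z - fderiv ℝ (fderiv ℝ f) z := by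
      rw [fderivWithin_fun_sub hz' (hϖ.differentiableOn (by simp) z hz)
        (hf'.differentiable (by simp) z).differentiableWithinAt,
        (hf'.differentiable (by simp) z).fderivWithin hz']
    have h2 : fderiv ℝ (fderiv ℝ f) z 1 Complex.I = fderiv ℝ (fderiv ℝ f) z Complex.I 1 :=
      ((contDiff_infty.1 hf 2).contDiffAt (x := z)).isSymmSndFDerivAt (by simp) 1 Complex.I
    rw [curl, h1]
    simp only [sub_apply]
    change ρ z = _
    rw [h2, ← hcurl z hz, curl]
    ring

theorem L3.θ_lt (L : L3) {i j : Fin 6} (h : i < j) : L.θ i < L.θ j := L.strictMono h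

theorem L3.arcB_nonempty (L : L3) : L.θ 1 < L.θ 0 + 2 * Real.pi :=
  (L.θ_lt (by decide : (1 : Fin 6) < 5)).trans L.lt_period

/-- There are no residual fields on `L₃`. -/
theorem L3.subsingleton_cohomology (L : L3) :
    Subsingleton (H0 L.arcX) ∧ Subsingleton (H1 L.arcX) ∧ Subsingleton (H2 L.arcX) ∧
      Subsingleton (H0 L.arcB) ∧ Subsingleton (H1 L.arcB) ∧ Subsingleton (H2 L.arcB) := by
  have h01 : L.θ 0 < L.θ 1 := L.θ_lt (by decide)
  have h1 := L.arcB_nonempty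
  exact ⟨subsingleton_H0 h01, subsingleton_H1 h01, subsingleton_H2 h01 (by linarith),
    subsingleton_H0 h1, subsingleton_H1 h1, subsingleton_H2 h1 (by linarith)⟩

end Cohomology


end

section

/-! ### Slices of a propagator, their primitives, and the period carried by `∂₁` -/

section Propagator

open Topology Function

theorem continuousOn_intervalIntegral {X F : Type*} [TopologicalSpace X]
    [NormedAddCommGroup F] [NormedSpace ℝ F] {S : Set X} {a b : ℝ} (hab : a ≤ b) {k : X → ℝ → F}
    (hk : ContinuousOn (uncurry k) (S ×ˢ Icc a b)) :
    ContinuousOn (fun x => ∫ u in a..b, k x u) S := by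
  intro x hx
  have hint : ∀ y ∈ S, IntervalIntegrable (k y) volume a b := fun y hy =>
    (hk.comp (f := fun u => (y, u)) (by fun_prop)
      fun u hu => ⟨hy, hu⟩).intervalIntegrable_of_Icc hab
  refine Metric.tendsto_nhds.2 fun ε hε => ?_
  have hba : 0 < b - a + 1 := by linarith
  obtain ⟨v, hv, hvk⟩ := isCompact_Icc.mem_uniformity_of_prod hk hx
    (Metric.dist_mem_uniformity (div_pos hε hba))
  filter_upwards [hv, self_mem_nhdsWithin] with y hyv hyS
  rw [dist_eq_norm, ← intervalIntegral.integral_sub (hint y hyS) (hint x hx)]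
  refine (intervalIntegral.norm_integral_le_of_norm_le_const (C := ε / (b - a + 1))
    fun u hu => ?_).trans_lt ?_
  · rw [uIoc_of_le hab] at hu
    rw [← dist_eq_norm]
    exact le_of_lt (hvk y hyv u ⟨hu.1.le, hu.2⟩)
  · rw [abs_of_nonneg (by linarith : 0 ≤ b - a), div_mul_eq_mul_div, div_lt_iff₀ hba]
    exact mul_lt_mul_of_pos_left (by linarith) hε

theorem hasDerivWithinAt_intervalIntegral {F : Type*} [NormedAddCommGroup F] [NormedSpace ℝ F]
    [CompleteSpace F] {S : Set ℝ} (hS : Convex ℝ S) {a b : ℝ} (hab : a ≤ b) {k k' : ℝ → ℝ → F}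
    (hk : ∀ x ∈ S, ContinuousOn (k x) (Icc a b))
    (hk' : ContinuousOn (uncurry k') (S ×ˢ Icc a b))
    (hd : ∀ x ∈ S, ∀ u ∈ Icc a b, HasDerivWithinAt (fun y => k y u) (k' x u) S x)
    {x : ℝ} (hx : x ∈ S) :
    HasDerivWithinAt (fun y => ∫ u in a..b, k y u) (∫ u in a..b, k' x u) S x := by
  have hc : Continuous fun w : F => ContinuousLinearMap.toSpanSingleton ℝ w :=
    (ContinuousLinearMap.toSpanSingletonCLE (𝕜 := ℝ) (E := F)).continuous
  have h := hasFDerivWithinAt_intervalIntegral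
    (k' := fun x u => ContinuousLinearMap.toSpanSingleton ℝ (k' x u)) hS hab hk
    (hc.comp_continuousOn hk') (fun y hy u hu => (hd y hy u hu).hasFDerivWithinAt) hx
  have hkx : ContinuousOn (k' x) (Icc a b) :=
    hk'.comp (f := fun u => (x, u)) (by fun_prop) fun u hu => ⟨hx, hu⟩
  have h2 := h.hasDerivWithinAt
  rw [ContinuousLinearMap.intervalIntegral_apply] at h2
  · simpa using h2
  · exact (hc.comp_continuousOn hkx).intervalIntegrable_of_Icc hab

/-! ## Propagators -/

theorem uniqueDiff_conf : UniqueDiffOn ℝ conf := by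
  have h : conf = disk ×ˢ disk ∩ {p : ℂ × ℂ | p.1 ≠ p.2} := by
    ext p
    simp [conf, and_assoc]
  rw [h]
  exact (uniqueDiff_disk.prod uniqueDiff_disk).inter (isOpen_ne_fun continuous_fst continuous_snd)

/-- The disk without a point. -/
def punctured (v : ℂ) : Set ℂ := disk \ {v}

theorem uniqueDiff_punctured (v : ℂ) : UniqueDiffOn ℝ (punctured v) :=
  uniqueDiff_disk.inter isOpen_compl_singleton

/-- Points of the circle are extreme points of the disk, and removing an extreme point from a convex
set leaves it convex. Hence the Poincaré lemma applies to a propagator whose second point is on the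
boundary, despite the singularity. -/
theorem convex_punctured (s : ℝ) : Convex ℝ (punctured (bpt s)) := by
  refine (convex_disk.mem_extremePoints_iff_convex_sdiff.1 ?_).2
  rw [disk, StrictConvexSpace.extremePoints_closedBall_eq_sphere]
  simp

theorem mk_mem_conf {v z : ℂ} (hv : v ∈ disk) (hz : z ∈ punctured v) : (z, v) ∈ conf :=
  ⟨hz.1, hv, hz.2⟩

theorem bpt_ne_bpt {s t : ℝ} (h : s ≠ t) (hst : |s - t| < 2 * Real.pi) : bpt s ≠ bpt t := by
  intro h'
  rw [bpt, bpt, Complex.exp_eq_exp_iff_exists_int] at h'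
  obtain ⟨n, hn⟩ := h'
  have h1 : s - t = n * (2 * Real.pi) := by
    have := congrArg Complex.im hn
    simp at this
    linarith
  have hpi := Real.pi_pos
  rw [h1, abs_mul, abs_of_pos (by positivity : (0 : ℝ) < 2 * Real.pi)] at hst
  have h2 : |(n : ℝ)| < 1 := by
    by_contra h3
    nlinarith [not_lt.1 h3]
  have h3 : n = 0 := by
    have h4 : |n| < 1 := by exact_mod_cast h2
    exact Int.abs_lt_one_iff.1 h4
  rw [h3] at h1
  simp at h1
  exact h (by linarith)

theorem bpt_periodic : Function.Periodic bpt (2 * Real.pi) := fun t => by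
  rw [bpt_add, show bpt (2 * Real.pi) = 1 by simp [bpt, Complex.exp_two_pi_mul_I], mul_one]

theorem btan_periodic : Function.Periodic btan (2 * Real.pi) := fun t => by
  rw [btan, bpt_periodic, btan]

variable {L : L3} {ζ : ℂ × ℂ → (ℂ × ℂ →L[ℝ] ℝ)}

/-- The restriction of a propagator to a fixed second point. -/
def slice (ζ : ℂ × ℂ → (ℂ × ℂ →L[ℝ] ℝ)) (v z : ℂ) : ℂ →L[ℝ] ℝ :=
  (ζ (z, v)).comp (ContinuousLinearMap.inl ℝ ℂ ℂ)

theorem slice_apply (v z w : ℂ) : slice ζ v z w = ζ (z, v) (w, 0) := by simp [slice]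

namespace IsPropagator

theorem hasFDerivWithinAt (hζ : IsPropagator L ζ) {p : ℂ × ℂ} (hp : p ∈ conf) :
    HasFDerivWithinAt ζ (fderivWithin ℝ ζ conf p) conf p :=
  (hζ.smooth.differentiableOn (by simp) p hp).hasFDerivWithinAt

theorem contDiffOn_slice (hζ : IsPropagator L ζ) {v : ℂ} (hv : v ∈ disk) :
    ContDiffOn ℝ ∞ (slice ζ v) (punctured v) :=
  (hζ.smooth.comp (f := fun z => (z, v)) (by fun_prop) fun z hz => mk_mem_conf hv hz).clm_comp
    contDiffOn_const

theorem symm_fderivWithin_slice (hζ : IsPropagator L ζ) {v z : ℂ} (hv : v ∈ disk)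
    (hz : z ∈ punctured v) (x y : ℂ) :
    fderivWithin ℝ (slice ζ v) (punctured v) z x y =
      fderivWithin ℝ (slice ζ v) (punctured v) z y x := by
  have h1 : HasFDerivWithinAt (fun z => ζ (z, v))
      ((fderivWithin ℝ ζ conf (z, v)).comp (ContinuousLinearMap.inl ℝ ℂ ℂ)) (punctured v) z :=
    (hζ.hasFDerivWithinAt (mk_mem_conf hv hz)).comp z (hasFDerivAt_prodMk_left z v).hasFDerivWithinAt
      fun w hw => mk_mem_conf hv hw
  have h2 : HasFDerivWithinAt (slice ζ v) (((ContinuousLinearMap.compL ℝ ℂ (ℂ × ℂ) ℝ).flip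
      (ContinuousLinearMap.inl ℝ ℂ ℂ)).comp ((fderivWithin ℝ ζ conf (z, v)).comp
      (ContinuousLinearMap.inl ℝ ℂ ℂ))) (punctured v) z :=
    ((ContinuousLinearMap.compL ℝ ℂ (ℂ × ℂ) ℝ).flip
      (ContinuousLinearMap.inl ℝ ℂ ℂ)).hasFDerivAt.comp_hasFDerivWithinAt z h1
  rw [h2.fderivWithin (uniqueDiff_punctured v z hz)]
  simpa using hζ.closed (z, v) (mk_mem_conf hv hz) (x, 0) (y, 0)

/-- A propagator with the second point on the boundary has a primitive. -/
theorem exists_primitive_slice (hζ : IsPropagator L ζ) (s : ℝ) :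
    ∃ f : ℂ → ℝ, ContDiffOn ℝ ∞ f (punctured (bpt s)) ∧
      ∀ z ∈ punctured (bpt s), HasFDerivWithinAt f (slice ζ (bpt s) z) (punctured (bpt s)) z :=
  exists_primitive (convex_punctured s) (uniqueDiff_punctured _)
    (hζ.contDiffOn_slice (bpt_mem_disk s)) fun _ hz => hζ.symm_fderivWithin_slice (bpt_mem_disk s) hz

theorem norm_slice_le (hζ : IsPropagator L ζ) : ∃ C : ℝ, 0 ≤ C ∧ ∀ v ∈ disk, ∀ z ∈ punctured v,
    ∀ w : ℂ, |slice ζ v z w| ≤ C / ‖z - v‖ * ‖w‖ := by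
  obtain ⟨C, hC⟩ := hζ.bound
  refine ⟨|C|, abs_nonneg C, fun v hv z hz w => ?_⟩
  rw [slice_apply, ← Real.norm_eq_abs]
  refine ((ζ (z, v)).le_opNorm _).trans ?_
  have h1 : ‖((w, 0) : ℂ × ℂ)‖ = ‖w‖ := by simp [Prod.norm_def]
  rw [h1]
  refine mul_le_mul_of_nonneg_right ((hC _ (mk_mem_conf hv hz)).trans ?_) (norm_nonneg _)
  exact div_le_div_of_nonneg_right (le_abs_self C) (norm_nonneg _)

end IsPropagator

/-! ### The period -/

theorem rpt_mem_disk {r : ℝ} (h0 : 0 ≤ r) (h1 : r ≤ 1) (t : ℝ) : (r : ℂ) * bpt t ∈ disk := by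
  simp [disk, abs_of_nonneg h0, h1]

theorem rpt_ne_bpt {r : ℝ} (h0 : 0 ≤ r) (h1 : r < 1) (s t : ℝ) : (r : ℂ) * bpt t ≠ bpt s := by
  intro h
  have := congrArg (‖·‖) h
  simp [abs_of_nonneg h0] at this
  linarith

theorem continuous_bpt : Continuous bpt := contDiff_bpt.continuous

theorem continuous_btan : Continuous btan := contDiff_btan.continuous

namespace IsPropagator

/-- The case `c = 0` of the boundary condition concerns vectors moving only the second point. It
applies in particular at the two ends of `∂₁` and there removes all end point terms. -/
theorem zeta_boundary_eta (hζ : IsPropagator L ζ) {t : ℝ} (ht : t ∈ L.arcB) {v : ℂ} (hv : v ∈ disk)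
    (hne : bpt t ≠ v) (w : ℂ) : ζ (bpt t, v) (0, w) = 0 := by
  simpa using hζ.boundary_eta t ht v hv hne 0 w

theorem slice_boundary_eta (hζ : IsPropagator L ζ) {t : ℝ} (ht : t ∈ L.arcB) {v : ℂ} (hv : v ∈ disk)
    (hne : bpt t ≠ v) : slice ζ v (bpt t) (btan t) = 0 := by
  simpa [slice_apply] using hζ.boundary_eta t ht v hv hne 1 0

/-- The period is prescribed on circles in the open disk. For circles around the centre the radius
can be moved up to one by continuity, and on the boundary circle only `∂₁` contributes. -/
theorem integral_boundary_zero (hζ : IsPropagator L ζ) :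
    ∫ u in (L.θ 0)..(L.θ 1), ζ (bpt u, 0) (btan u, 0) = 1 := by
  have hpi := Real.pi_pos
  have h01 : L.θ 0 < L.θ 1 := L.θ_lt (by decide)
  set I : ℝ → ℝ := fun r => ∫ t in (0 : ℝ)..(2 * Real.pi), ζ (r * bpt t, 0) (r * btan t, 0) with hI
  have hne : ∀ r : ℝ, 0 < r → ∀ t, (r : ℂ) * bpt t ≠ 0 := fun r hr t =>
    norm_ne_zero_iff.1 (by simp [hr.ne'])
  have hcont : ContinuousOn I (Ioc 0 1) := by
    refine continuousOn_intervalIntegral (by positivity) ?_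
    have h1 : ContinuousOn (fun p : ℝ × ℝ => ζ ((p.1 : ℂ) * bpt p.2, 0))
        (Ioc 0 1 ×ˢ Icc 0 (2 * Real.pi)) := by
      refine hζ.smooth.continuousOn.comp (f := fun p : ℝ × ℝ => ((p.1 : ℂ) * bpt p.2, (0 : ℂ))) ?_
        fun p hp => ⟨rpt_mem_disk hp.1.1.le hp.1.2 _, by simp [disk], hne _ hp.1.1 _⟩
      exact (Continuous.prodMk ((Complex.continuous_ofReal.comp continuous_fst).mul
        (continuous_bpt.comp continuous_snd)) continuous_const).continuousOn
    refine h1.clm_apply (g := fun p : ℝ × ℝ => ((p.1 : ℂ) * btan p.2, (0 : ℂ))) ?_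
    exact (Continuous.prodMk ((Complex.continuous_ofReal.comp continuous_fst).mul
        (continuous_btan.comp continuous_snd)) continuous_const).continuousOn
  have hI1 : I 1 = 1 := by
    have h1 : Filter.Tendsto I (𝓝[Ioo 0 1] 1) (𝓝 (I 1)) :=
      (hcont 1 ⟨one_pos, le_rfl⟩).mono_left (nhdsWithin_mono _ Ioo_subset_Ioc_self)
    have h2 : Filter.Tendsto I (𝓝[Ioo 0 1] 1) (𝓝 1) := by
      refine tendsto_const_nhds.congr' ?_
      filter_upwards [self_mem_nhdsWithin] with r hr
      have := hζ.period 0 r hr.1 (Metric.closedBall_subset_ball hr.2)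
      simpa [hI] using this.symm
    have : (𝓝[Ioo (0 : ℝ) 1] 1).NeBot := by
      rw [← mem_closure_iff_nhdsWithin_neBot, closure_Ioo (by simp)]
      simp
    exact tendsto_nhds_unique h1 h2
  set g : ℝ → ℝ := fun u => ζ (bpt u, 0) (btan u, 0) with hg
  have hgc : Continuous g := by
    have h1 : Continuous fun u => ζ (bpt u, 0) :=
      hζ.smooth.continuousOn.comp_continuous (continuous_bpt.prodMk continuous_const) fun u =>
        ⟨bpt_mem_disk u, by simp [disk], by simpa using hne 1 one_pos u⟩
    exact h1.clm_apply (continuous_btan.prodMk continuous_const)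
  have hper : Function.Periodic g (2 * Real.pi) := fun u => by
    simp only [hg, bpt_periodic u, btan_periodic u]
  have h2 : ∫ u in (L.θ 0)..(L.θ 0 + 2 * Real.pi), g u = 1 := by
    rw [hper.intervalIntegral_add_eq (L.θ 0) 0, zero_add, ← hI1]
    simp [hI, hg]
  rw [← intervalIntegral.integral_add_adjacent_intervals (b := L.θ 1)
    (hgc.intervalIntegrable _ _) (hgc.intervalIntegrable _ _)] at h2
  rw [← h2, left_eq_add]
  rw [intervalIntegral.integral_congr (g := fun _ => 0), intervalIntegral.integral_zero]
  intro u hu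
  rw [uIcc_of_le L.arcB_nonempty.le] at hu
  have := hζ.slice_boundary_eta hu (v := 0) (by simp [disk]) (by simpa using hne 1 one_pos u)
  rwa [slice_apply] at this

theorem hasDerivAt_fst (hζ : IsPropagator L ζ) {v : ℂ} (hv : v ∈ disk) {u : ℝ} (hne : bpt u ≠ v)
    (w : ℂ × ℂ) : HasDerivAt (fun u => ζ (bpt u, v) w)
      (fderivWithin ℝ ζ conf (bpt u, v) (btan u, 0) w) u := by
  have h2 : HasDerivAt (fun u => (bpt u, v)) (btan u, 0) u :=
    (hasDerivAt_bpt u).prodMk (hasDerivAt_const u _)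
  have h3 : ∀ᶠ u' in 𝓝 u, (bpt u', v) ∈ conf := by
    have h4 : IsOpen {u' : ℝ | bpt u' ≠ v} := isOpen_ne_fun continuous_bpt continuous_const
    filter_upwards [h4.mem_nhds hne] with u' hu'
    exact ⟨bpt_mem_disk u', hv, hu'⟩
  have h5 := ((hζ.hasFDerivWithinAt ⟨bpt_mem_disk u, hv, hne⟩).comp_hasDerivAt u h2 h3).clm_apply
    (hasDerivAt_const u w)
  refine h5.congr_deriv ?_
  rw [map_zero, add_zero]

/-- The period of a propagator around a boundary point is carried by `∂₁`. -/
theorem integral_boundary (hζ : IsPropagator L ζ) {s : ℝ}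
    (hs : s ∈ Ioo (L.θ 1) (L.θ 0 + 2 * Real.pi)) :
    ∫ u in (L.θ 0)..(L.θ 1), ζ (bpt u, bpt s) (btan u, 0) = 1 := by
  have h01 : L.θ 0 < L.θ 1 := L.θ_lt (by decide)
  -- The second point moves along a radius from the centre, where the integral is known, to `bpt s`;
  -- it never meets `∂₁`.
  have hmem : ∀ ρ ∈ Icc (0 : ℝ) 1, ∀ u ∈ Icc (L.θ 0) (L.θ 1), (bpt u, (ρ : ℂ) * bpt s) ∈ conf := by
    intro ρ hρ u hu
    refine ⟨bpt_mem_disk u, rpt_mem_disk hρ.1 hρ.2 s, ?_⟩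
    rcases hρ.2.lt_or_eq with h | h
    · exact (rpt_ne_bpt hρ.1 h u s).symm
    · rw [h, Complex.ofReal_one, one_mul]
      refine bpt_ne_bpt (by linarith [hu.2, hs.1]) ?_
      rw [abs_lt]
      constructor <;> linarith [hu.1, hu.2, hs.1, hs.2, Real.pi_pos]
  set D := fun p => fderivWithin ℝ ζ conf p with hD
  have hDc : ContinuousOn D conf :=
    ((contDiffOn_infty_iff_fderivWithin uniqueDiff_conf).1 hζ.smooth).2.continuousOn
  have hpath : Continuous fun p : ℝ × ℝ => (bpt p.2, (p.1 : ℂ) * bpt s) :=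
    (continuous_bpt.comp continuous_snd).prodMk
      ((Complex.continuous_ofReal.comp continuous_fst).mul continuous_const)
  have hζc : ContinuousOn (fun p : ℝ × ℝ => ζ (bpt p.2, (p.1 : ℂ) * bpt s))
      (Icc 0 1 ×ˢ Icc (L.θ 0) (L.θ 1)) :=
    hζ.smooth.continuousOn.comp hpath.continuousOn fun p hp => hmem _ hp.1 _ hp.2
  have hDc' : ContinuousOn (fun p : ℝ × ℝ => D (bpt p.2, (p.1 : ℂ) * bpt s))
      (Icc 0 1 ×ˢ Icc (L.θ 0) (L.θ 1)) :=
    hDc.comp hpath.continuousOn fun p hp => hmem _ hp.1 _ hp.2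
  have hk' : ContinuousOn (uncurry fun (ρ u : ℝ) =>
      D (bpt u, (ρ : ℂ) * bpt s) (0, bpt s) (btan u, 0)) (Icc 0 1 ×ˢ Icc (L.θ 0) (L.θ 1)) :=
    (hDc'.clm_apply continuousOn_const).clm_apply
      ((continuous_btan.comp continuous_snd).prodMk continuous_const).continuousOn
  have hder : ∀ ρ ∈ Icc (0 : ℝ) 1, HasDerivWithinAt
      (fun ρ : ℝ => ∫ u in (L.θ 0)..(L.θ 1), ζ (bpt u, (ρ : ℂ) * bpt s) (btan u, 0))
      (∫ u in (L.θ 0)..(L.θ 1), D (bpt u, (ρ : ℂ) * bpt s) (0, bpt s) (btan u, 0)) (Icc 0 1) ρ := by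
    intro ρ hρ
    refine hasDerivWithinAt_intervalIntegral
      (k := fun (ρ u : ℝ) => ζ (bpt u, (ρ : ℂ) * bpt s) (btan u, 0))
      (k' := fun (ρ u : ℝ) => D (bpt u, (ρ : ℂ) * bpt s) (0, bpt s) (btan u, 0))
      (convex_Icc 0 1) h01.le (fun r hr => ?_) hk' (fun r hr u hu => ?_) hρ
    · have h1 : ContinuousOn (fun u : ℝ => ζ (bpt u, (r : ℂ) * bpt s)) (Icc (L.θ 0) (L.θ 1)) :=
        hζc.comp (f := fun u => (r, u)) (by fun_prop) fun u hu => ⟨hr, hu⟩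
      exact h1.clm_apply (continuous_btan.prodMk continuous_const).continuousOn
    · have h1 : HasDerivWithinAt (fun r : ℝ => (bpt u, (r : ℂ) * bpt s)) (0, bpt s) (Icc 0 1) r := by
        have h2 : HasDerivAt (fun r : ℝ => (r : ℂ) * bpt s) (bpt s) r := by
          simpa using (Complex.ofRealCLM.hasDerivAt (x := r)).mul_const (bpt s)
        exact ((hasDerivAt_const r (bpt u)).prodMk h2).hasDerivWithinAt
      have h3 := (hζ.hasFDerivWithinAt (hmem r hr u hu)).comp_hasDerivWithinAt r h1
        fun r' hr' => hmem r' hr' u hu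
      simpa using h3.clm_apply (hasDerivWithinAt_const r (Icc 0 1) ((btan u, 0) : ℂ × ℂ))
  -- Closedness converts the derivative in the second point into a derivative along the circle, and
  -- the end points of `∂₁` contribute nothing.
  have hzero : ∀ ρ ∈ Icc (0 : ℝ) 1,
      ∫ u in (L.θ 0)..(L.θ 1), D (bpt u, (ρ : ℂ) * bpt s) (0, bpt s) (btan u, 0) = 0 := by
    intro ρ hρ
    have h1 : ∀ u ∈ Icc (L.θ 0) (L.θ 1), HasDerivAt (fun u => ζ (bpt u, (ρ : ℂ) * bpt s) (0, bpt s))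
        (D (bpt u, (ρ : ℂ) * bpt s) (0, bpt s) (btan u, 0)) u := by
      intro u hu
      rw [hD, hζ.closed _ (hmem ρ hρ u hu)]
      exact hζ.hasDerivAt_fst (rpt_mem_disk hρ.1 hρ.2 s) (hmem ρ hρ u hu).2.2 _
    rw [intervalIntegral.integral_eq_sub_of_hasDerivAt (fun u hu => h1 u ?_)]
    · have e1 := hζ.zeta_boundary_eta (t := L.θ 1) ⟨le_rfl, L.arcB_nonempty.le⟩
        (rpt_mem_disk hρ.1 hρ.2 s) (hmem ρ hρ _ ⟨h01.le, le_rfl⟩).2.2 (bpt s)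
      -- The first end of `∂₁` belongs to `arcB` only after a full turn.
      have e0 := hζ.zeta_boundary_eta (t := L.θ 0 + 2 * Real.pi) ⟨L.arcB_nonempty.le, le_rfl⟩
        (rpt_mem_disk hρ.1 hρ.2 s) (by
          rw [bpt_periodic]
          exact (hmem ρ hρ _ ⟨le_rfl, h01.le⟩).2.2) (bpt s)
      rw [bpt_periodic] at e0
      rw [e1, e0, sub_zero]
    · exact (hk'.comp (f := fun u => (ρ, u)) (by fun_prop) fun u hu =>
        ⟨hρ, hu⟩).intervalIntegrable_of_Icc h01.le
    · rwa [uIcc_of_le h01.le] at hu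
  have hconst := constant_of_derivWithin_zero
    (f := fun ρ : ℝ => ∫ u in (L.θ 0)..(L.θ 1), ζ (bpt u, (ρ : ℂ) * bpt s) (btan u, 0))
    (a := 0) (b := 1) (fun ρ hρ => (hder ρ hρ).differentiableWithinAt) (fun ρ hρ => by
      rw [(hder ρ ⟨hρ.1, hρ.2.le⟩).derivWithin (uniqueDiffOn_Icc one_pos ρ ⟨hρ.1, hρ.2.le⟩),
        hzero ρ ⟨hρ.1, hρ.2.le⟩]) 1 ⟨zero_le_one, le_rfl⟩
  simpa [hζ.integral_boundary_zero] using hconst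

end IsPropagator

end Propagator


end

section

/-! ### Green's formula on smaller disks and estimates near the boundary circle -/

section Green

open Topology Function

/-- The coefficient of the wedge product of two one-forms. -/
def wedgeCoeff (ϖ η : ℂ →L[ℝ] ℝ) : ℝ := ϖ 1 * η Complex.I - ϖ Complex.I * η 1

/-- The pair `bpt t`, `btan t` is a positively oriented orthonormal frame, so the wedge product has
the same coefficient in it. -/
theorem wedgeCoeff_bpt (ϖ η : ℂ →L[ℝ] ℝ) (t : ℝ) :
    ϖ (bpt t) * η (btan t) - ϖ (btan t) * η (bpt t) = wedgeCoeff ϖ η := by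
  have h1 : bpt t = Real.cos t • (1 : ℂ) + Real.sin t • Complex.I := by
    rw [bpt_eq]
    apply Complex.ext <;> simp <;> rfl
  have h2 : btan t = (-Real.sin t) • (1 : ℂ) + Real.cos t • Complex.I := by
    rw [btan, bpt_eq]
    apply Complex.ext <;> simp <;> rfl
  rw [h1, h2]
  simp only [map_add, map_smul, smul_eq_mul, wedgeCoeff]
  linear_combination (ϖ 1 * η Complex.I - ϖ Complex.I * η 1) * Real.sin_sq_add_cos_sq t

theorem map_rmul (ϖ : ℂ →L[ℝ] ℝ) (r : ℝ) (z : ℂ) : ϖ ((r : ℂ) * z) = r * ϖ z := by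
  rw [← Complex.real_smul, map_smul, smul_eq_mul]

theorem hasDerivAt_rpt_radius (r t : ℝ) : HasDerivAt (fun r : ℝ => (r : ℂ) * bpt t) (bpt t) r := by
  simpa using (Complex.ofRealCLM.hasDerivAt (x := r)).mul_const (bpt t)

theorem hasDerivAt_rpt_angle (r t : ℝ) :
    HasDerivAt (fun t : ℝ => (r : ℂ) * bpt t) ((r : ℂ) * btan t) t :=
  (hasDerivAt_bpt t).const_mul _

theorem continuous_rpt : Continuous fun p : ℝ × ℝ => (p.1 : ℂ) * bpt p.2 :=
  (Complex.continuous_ofReal.comp continuous_fst).mul (continuous_bpt.comp continuous_snd)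

theorem rpt_mem_ball {r : ℝ} (hr : r ∈ Ico (0 : ℝ) 1) (t : ℝ) :
    (r : ℂ) * bpt t ∈ Metric.ball (0 : ℂ) 1 := by
  simp [abs_of_nonneg hr.1, hr.2]

/-- Green's formula in polar coordinates for `f η`, where `df = ϖ` and `η` is closed. -/
theorem green_polar {f : ℂ → ℝ} {ϖ η : ℂ → ℂ →L[ℝ] ℝ} {η' : ℂ → ℂ →L[ℝ] ℂ →L[ℝ] ℝ}
    (hf : ∀ z ∈ Metric.ball (0 : ℂ) 1, HasFDerivAt f (ϖ z) z)
    (hη : ∀ z ∈ Metric.ball (0 : ℂ) 1, HasFDerivAt η (η' z) z)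
    (hsym : ∀ z ∈ Metric.ball (0 : ℂ) 1, ∀ x y, η' z x y = η' z y x)
    (hϖ : ContinuousOn ϖ (Metric.ball 0 1)) (hη' : ContinuousOn η' (Metric.ball 0 1))
    (x : ℝ) {R : ℝ} (hR : R ∈ Ico (0 : ℝ) 1) :
    ∫ r in (0 : ℝ)..R, ∫ φ in x..(x + 2 * Real.pi),
        r * wedgeCoeff (ϖ (r * bpt φ)) (η (r * bpt φ)) =
      ∫ φ in x..(x + 2 * Real.pi), f (R * bpt φ) * (R * η (R * bpt φ) (btan φ)) := by
  have hx : x ≤ x + 2 * Real.pi := by linarith [Real.pi_pos]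
  have hfc : ContinuousOn f (Metric.ball 0 1) := fun z hz => (hf z hz).continuousAt.continuousWithinAt
  have hηc : ContinuousOn η (Metric.ball 0 1) := fun z hz => (hη z hz).continuousAt.continuousWithinAt
  have hcomp : ∀ {X : Type} [TopologicalSpace X] {g : ℂ → X}, ContinuousOn g (Metric.ball 0 1) →
      ContinuousOn (fun p : ℝ × ℝ => g (p.1 * bpt p.2)) (Ico 0 1 ×ˢ univ) := fun hg =>
    hg.comp continuous_rpt.continuousOn fun p hp => rpt_mem_ball hp.1 _
  have hb : ContinuousOn (fun p : ℝ × ℝ => bpt p.2) (Ico 0 1 ×ˢ univ) :=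
    (continuous_bpt.comp continuous_snd).continuousOn
  have hbt : ContinuousOn (fun p : ℝ × ℝ => btan p.2) (Ico 0 1 ×ˢ univ) :=
    (continuous_btan.comp continuous_snd).continuousOn
  have hr : ContinuousOn (fun p : ℝ × ℝ => p.1) (Ico (0 : ℝ) 1 ×ˢ (univ : Set ℝ)) :=
    continuous_fst.continuousOn
  have hsec : ∀ {g : ℝ × ℝ → ℝ}, ContinuousOn g (Ico 0 1 ×ˢ univ) → ∀ r ∈ Ico (0 : ℝ) 1,
      Continuous fun φ => g (r, φ) := fun hg r hr =>
    hg.comp_continuous (f := fun φ => (r, φ)) (by fun_prop) fun φ => ⟨hr, mem_univ _⟩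
  -- Here `k` and `q` are the angular and the radial coefficient of `f η` in polar coordinates. As
  -- `η` is closed, `k' - q'` is the coefficient of `ϖ ∧ η` including the Jacobian, and `q'`
  -- integrates to zero by periodicity.
  set k : ℝ → ℝ → ℝ := fun r φ => f (r * bpt φ) * (r * η (r * bpt φ) (btan φ)) with hk
  set k' : ℝ → ℝ → ℝ := fun r φ => ϖ (r * bpt φ) (bpt φ) * (r * η (r * bpt φ) (btan φ)) +
    f (r * bpt φ) * (η (r * bpt φ) (btan φ) + r * η' (r * bpt φ) (bpt φ) (btan φ)) with hk'
  set q : ℝ → ℝ → ℝ := fun r φ => f (r * bpt φ) * η (r * bpt φ) (bpt φ) with hq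
  set q' : ℝ → ℝ → ℝ := fun r φ => r * ϖ (r * bpt φ) (btan φ) * η (r * bpt φ) (bpt φ) +
    f (r * bpt φ) * (r * η' (r * bpt φ) (btan φ) (bpt φ) + η (r * bpt φ) (btan φ)) with hq'
  have hkc : ContinuousOn (uncurry k) (Ico 0 1 ×ˢ univ) :=
    (hcomp hfc).mul (hr.mul ((hcomp hηc).clm_apply hbt))
  have hkc' : ContinuousOn (uncurry k') (Ico 0 1 ×ˢ univ) :=
    (((hcomp hϖ).clm_apply hb).mul (hr.mul ((hcomp hηc).clm_apply hbt))).add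
      ((hcomp hfc).mul (((hcomp hηc).clm_apply hbt).add
        (hr.mul (((hcomp hη').clm_apply hb).clm_apply hbt))))
  have hqc' : ContinuousOn (uncurry q') (Ico 0 1 ×ˢ univ) :=
    ((hr.mul ((hcomp hϖ).clm_apply hbt)).mul ((hcomp hηc).clm_apply hb)).add
      ((hcomp hfc).mul ((hr.mul (((hcomp hη').clm_apply hbt).clm_apply hb)).add
        ((hcomp hηc).clm_apply hbt)))
  have hkd : ∀ r ∈ Ico (0 : ℝ) 1, ∀ φ, HasDerivAt (fun r => k r φ) (k' r φ) r := by
    intro r hr φ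
    have hz := rpt_mem_ball hr φ
    have h1 : HasDerivAt (fun r : ℝ => f (r * bpt φ)) (ϖ (r * bpt φ) (bpt φ)) r :=
      (hf _ hz).comp_hasDerivAt r (hasDerivAt_rpt_radius r φ)
    have h2 : HasDerivAt (fun r : ℝ => η (r * bpt φ)) (η' (r * bpt φ) (bpt φ)) r :=
      (hη _ hz).comp_hasDerivAt r (hasDerivAt_rpt_radius r φ)
    have h3 := h2.clm_apply (hasDerivAt_const r (btan φ))
    refine (h1.mul ((hasDerivAt_id r).mul h3)).congr_deriv ?_
    simp [hk']
  have hqd : ∀ r ∈ Ico (0 : ℝ) 1, ∀ φ, HasDerivAt (fun φ => q r φ) (q' r φ) φ := by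
    intro r hr φ
    have hz := rpt_mem_ball hr φ
    have h1 : HasDerivAt (fun φ : ℝ => f (r * bpt φ)) (ϖ (r * bpt φ) (r * btan φ)) φ :=
      (hf _ hz).comp_hasDerivAt φ (hasDerivAt_rpt_angle r φ)
    have h2 : HasDerivAt (fun φ : ℝ => η (r * bpt φ)) (η' (r * bpt φ) (r * btan φ)) φ :=
      (hη _ hz).comp_hasDerivAt φ (hasDerivAt_rpt_angle r φ)
    have h3 := h2.clm_apply (hasDerivAt_bpt φ)
    refine (h1.mul h3).congr_deriv ?_
    have h4 : η' (r * bpt φ) (r * btan φ) = r • η' (r * bpt φ) (btan φ) := by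
      rw [show (r : ℂ) * btan φ = r • btan φ from Complex.real_smul.symm, map_smul]
    simp [hq', map_rmul, h4]
  have hdiff : ∀ r ∈ Ico (0 : ℝ) 1, ∀ φ,
      k' r φ - q' r φ = r * wedgeCoeff (ϖ (r * bpt φ)) (η (r * bpt φ)) := by
    intro r hr φ
    simp only [hk', hq']
    rw [← wedgeCoeff_bpt _ _ φ, hsym _ (rpt_mem_ball hr φ) (bpt φ)]
    ring
  have hqint : ∀ r ∈ Ico (0 : ℝ) 1, ∫ φ in x..(x + 2 * Real.pi), q' r φ = 0 := by
    intro r hr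
    rw [intervalIntegral.integral_eq_sub_of_hasDerivAt (fun φ _ => hqd r hr φ)
      ((hsec hqc' r hr).intervalIntegrable _ _)]
    simp only [hq, bpt_periodic x, sub_self]
  have hint : ∀ r ∈ Ico (0 : ℝ) 1, ∫ φ in x..(x + 2 * Real.pi),
      r * wedgeCoeff (ϖ (r * bpt φ)) (η (r * bpt φ)) = ∫ φ in x..(x + 2 * Real.pi), k' r φ := by
    intro r hr
    simp only [← hdiff r hr]
    have i1 : IntervalIntegrable (k' r) volume x (x + 2 * Real.pi) :=
      (hsec hkc' r hr).intervalIntegrable _ _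
    have i2 : IntervalIntegrable (q' r) volume x (x + 2 * Real.pi) :=
      (hsec hqc' r hr).intervalIntegrable _ _
    rw [intervalIntegral.integral_sub i1 i2, hqint r hr, sub_zero]
  have hsub : Ico (0 : ℝ) 1 ×ˢ Icc x (x + 2 * Real.pi) ⊆ Ico 0 1 ×ˢ univ :=
    prod_mono le_rfl (subset_univ _)
  have hIcc : Icc 0 R ⊆ Ico (0 : ℝ) 1 := fun r hr => ⟨hr.1, hr.2.trans_lt hR.2⟩
  have hmain : ∀ r ∈ Ico (0 : ℝ) 1, HasDerivWithinAt
      (fun r => ∫ φ in x..(x + 2 * Real.pi), k r φ) (∫ φ in x..(x + 2 * Real.pi), k' r φ)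
      (Ico 0 1) r := fun r hr =>
    hasDerivWithinAt_intervalIntegral (convex_Ico 0 1) hx
      (fun y hy => (hsec hkc y hy).continuousOn) (hkc'.mono hsub)
      (fun y hy φ _ => (hkd y hy φ).hasDerivWithinAt) hr
  have hcI : ContinuousOn (fun r => ∫ φ in x..(x + 2 * Real.pi), k' r φ) (Icc 0 R) :=
    continuousOn_intervalIntegral hx (hkc'.mono ((prod_mono hIcc le_rfl).trans hsub))
  have hFTC := intervalIntegral.integral_eq_sub_of_hasDeriv_right_of_le hR.1
    (fun r hr => ((hmain r (hIcc hr)).continuousWithinAt.mono hIcc))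
    (fun r hr => ((hmain r ⟨hr.1.le, hr.2.trans hR.2⟩).hasDerivAt
      (Ico_mem_nhds hr.1 (hr.2.trans hR.2))).hasDerivWithinAt)
    (hcI.intervalIntegrable_of_Icc hR.1)
  rw [intervalIntegral.integral_congr (g := fun r => ∫ φ in x..(x + 2 * Real.pi), k' r φ)]
  · rw [hFTC]
    simp [hk]
  · intro r hr
    rw [uIcc_of_le hR.1] at hr
    exact hint r (hIcc hr)

/-! ### Integrable majorants -/

/-- A periodic majorant with square root singularities. -/
def sinMajorant (s φ : ℝ) : ℝ := |Real.sin ((φ - s) / 2)| ^ (-(1 / 2) : ℝ)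

theorem sinMajorant_nonneg (s φ : ℝ) : 0 ≤ sinMajorant s φ := Real.rpow_nonneg (abs_nonneg _) _

theorem sinMajorant_periodic (s : ℝ) : Function.Periodic (sinMajorant s) (2 * Real.pi) := fun φ => by
  rw [sinMajorant, sinMajorant, show (φ + 2 * Real.pi - s) / 2 = (φ - s) / 2 + Real.pi by ring,
    Real.sin_add_pi, abs_neg]

theorem measurable_sinMajorant (s : ℝ) : Measurable (sinMajorant s) := by
  unfold sinMajorant
  fun_prop

/-- On the period centred at `s`, concavity of the sine gives `|sin ((φ - s) / 2)| ≥ |φ - s| / π`,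
so an inverse square root dominates. Periodicity extends the result to every interval. -/
theorem intervalIntegrable_sinMajorant (s a b : ℝ) :
    IntervalIntegrable (sinMajorant s) volume a b := by
  have hpi := Real.pi_pos
  have h0 : IntervalIntegrable (fun x : ℝ => |x| ^ (-(1 / 2) : ℝ)) volume (-Real.pi) Real.pi := by
    have h1 : IntervalIntegrable (fun x : ℝ => |x| ^ (-(1 / 2) : ℝ)) volume 0 Real.pi := by
      refine (intervalIntegral.intervalIntegrable_rpow' (r := -(1 / 2)) (by norm_num)).congr ?_
      intro x hx
      rw [uIoc_of_le hpi.le] at hx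
      simp only [abs_of_pos hx.1]
    have h2 : IntervalIntegrable (fun x : ℝ => |x| ^ (-(1 / 2) : ℝ)) volume (-Real.pi) 0 := by
      have := (IntervalIntegrable.iff_comp_neg (f := fun x : ℝ => |x| ^ (-(1 / 2) : ℝ))).1 h1
      simp only [abs_neg, neg_zero] at this
      exact this.symm
    exact h2.trans h1
  have h1 : IntervalIntegrable (fun x : ℝ => (Real.pi⁻¹) ^ (-(1 / 2) : ℝ) * |x - s| ^ (-(1 / 2) : ℝ))
      volume (s - Real.pi) (s + Real.pi) := by
    have := (h0.comp_sub_right s).const_mul ((Real.pi⁻¹) ^ (-(1 / 2) : ℝ))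
    rwa [show -Real.pi + s = s - Real.pi by ring, add_comm Real.pi] at this
  have h2 : IntervalIntegrable (sinMajorant s) volume (s - Real.pi) (s - Real.pi + 2 * Real.pi) := by
    rw [show s - Real.pi + 2 * Real.pi = s + Real.pi by ring]
    refine h1.mono_fun (measurable_sinMajorant s).aestronglyMeasurable ?_
    refine (ae_restrict_iff' measurableSet_uIoc).2 ?_
    have hs : ∀ᵐ x : ℝ, x ≠ s := by simp [ae_iff]
    filter_upwards [hs] with x hxs hx
    rw [uIoc_of_le (by linarith)] at hx
    rw [Real.norm_of_nonneg (sinMajorant_nonneg s x), Real.norm_of_nonneg (by positivity),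
      ← Real.mul_rpow (by positivity) (abs_nonneg _), sinMajorant]
    have hpos : 0 < |x - s| := abs_pos.2 (sub_ne_zero.2 hxs)
    refine Real.rpow_le_rpow_of_nonpos (by positivity) ?_ (by norm_num)
    have h3 : |x - s| ≤ Real.pi := abs_le.2 ⟨by linarith [hx.1], by linarith [hx.2]⟩
    have h4 := Real.mul_le_sin (x := |x - s| / 2) (by positivity) (by linarith)
    have h5 : |Real.sin ((x - s) / 2)| = Real.sin (|x - s| / 2) := by
      rcases abs_cases (x - s) with ⟨h, h'⟩ | ⟨h, h'⟩
      · rw [h, abs_of_nonneg]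
        rw [← h]
        exact Real.sin_nonneg_of_nonneg_of_le_pi (by positivity) (by linarith)
      · rw [h, neg_div, Real.sin_neg, abs_of_nonpos]
        have : 0 ≤ Real.sin (|x - s| / 2) :=
          Real.sin_nonneg_of_nonneg_of_le_pi (by positivity) (by linarith)
        rw [h, neg_div, Real.sin_neg] at this
        linarith
    rw [h5]
    refine le_trans (le_of_eq ?_) h4
    field_simp
  exact (sinMajorant_periodic s).intervalIntegrable (by positivity) h2 a b

theorem normSq_rpt_sub_bpt (r φ s : ℝ) :
    ‖(r : ℂ) * bpt φ - bpt s‖ ^ 2 = (1 - r) ^ 2 + 4 * r * Real.sin ((φ - s) / 2) ^ 2 := by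
  rw [← Complex.normSq_eq_norm_sq, bpt_eq, bpt_eq, Complex.normSq_apply]
  have h := Real.cos_sub φ s
  have h2 : Real.cos (φ - s) = 1 - 2 * Real.sin ((φ - s) / 2) ^ 2 := by
    have h3 := Real.cos_two_mul ((φ - s) / 2)
    rw [show 2 * ((φ - s) / 2) = φ - s by ring] at h3
    linarith [Real.sin_sq_add_cos_sq ((φ - s) / 2)]
  simp only [Complex.sub_re, Complex.sub_im, Complex.mul_re, Complex.mul_im, Complex.ofReal_re,
    Complex.ofReal_im, zero_mul, sub_zero, add_zero]
  linear_combination r ^ 2 * Real.sin_sq_add_cos_sq φ + Real.sin_sq_add_cos_sq s + 2 * r * h -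
    2 * r * h2

/-- Near the boundary, the distance to a boundary point is bounded below by the geometric mean of
the radial and the angular distances. -/
theorem div_norm_rpt_sub_le {r : ℝ} (h0 : 0 ≤ r) (h1 : r < 1) {φ s : ℝ}
    (hs : Real.sin ((φ - s) / 2) ≠ 0) :
    r / ‖(r : ℂ) * bpt φ - bpt s‖ ≤ (1 - r) ^ (-(1 / 2) : ℝ) * sinMajorant s φ := by
  have hσ : 0 < |Real.sin ((φ - s) / 2)| := abs_pos.2 hs
  have hr : 0 < 1 - r := by linarith
  have hd : 0 < ‖(r : ℂ) * bpt φ - bpt s‖ := norm_pos_iff.2 (sub_ne_zero.2 (rpt_ne_bpt h0 h1 s φ))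
  rw [sinMajorant, ← Real.mul_rpow hr.le hσ.le, Real.rpow_neg (by positivity),
    ← Real.sqrt_eq_rpow, ← one_div, div_le_div_iff₀ hd (by positivity), one_mul]
  have h2 := normSq_rpt_sub_bpt r φ s
  set σ := |Real.sin ((φ - s) / 2)| with hσdef
  rw [← sq_abs (Real.sin _), ← hσdef] at h2
  -- The square of the distance is `(1 - r) ^ 2 + 4 * r * σ ^ 2`, and the squared inequality follows
  -- from the inequality between arithmetic and geometric means together with `r ^ 2 ≤ r`.
  refine abs_le_of_sq_le_sq' ?_ hd.le |>.2
  rw [mul_pow, Real.sq_sqrt (by positivity), h2]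
  have hr2 : r ^ 2 ≤ r := by nlinarith
  have hAM : r ^ 2 * ((1 - r) * σ) ≤ r * ((1 - r) * σ) :=
    mul_le_mul_of_nonneg_right hr2 (by positivity)
  have h3 : r * σ * (1 - r) ≤ (1 - r) ^ 2 + 4 * r * σ ^ 2 := by
    nlinarith [sq_nonneg ((1 - r) - r * σ), mul_nonneg h0 (sq_nonneg σ), sq_nonneg (1 - r),
      mul_le_mul_of_nonneg_right hr2 (sq_nonneg σ), mul_nonneg (mul_nonneg h0 hσ.le) hr.le]
  linarith

theorem intervalIntegrable_one_sub_rpow (a b : ℝ) :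
    IntervalIntegrable (fun r : ℝ => (1 - r) ^ (-(1 / 2) : ℝ)) volume a b := by
  have := (intervalIntegral.intervalIntegrable_rpow' (a := 1 - a) (b := 1 - b)
    (r := -(1 / 2)) (by norm_num)).comp_sub_left 1
  simpa using this

end Green


end

section

/-! ### The integral defining `zetaHat`: convergence, polar coordinates, radial limits -/

section ZetaHat

open Topology Function

theorem ae_sin_ne_zero (s : ℝ) : ∀ᵐ φ : ℝ, Real.sin ((φ - s) / 2) ≠ 0 := by
  rw [ae_iff]
  refine ((countable_range fun n : ℤ => 2 * (n * Real.pi) + s).mono fun φ hφ => ?_).measure_zero _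
  obtain ⟨n, hn⟩ := Real.sin_eq_zero_iff.1 (not_not.1 hφ)
  exact ⟨n, by simp only [hn]; ring⟩

theorem bpt_ne_of_sin_ne_zero {φ s : ℝ} (h : Real.sin ((φ - s) / 2) ≠ 0) : bpt φ ≠ bpt s := by
  intro h'
  have := normSq_rpt_sub_bpt 1 φ s
  rw [h'] at this
  simp at this
  exact h this

theorem ball_mem_nhds_punctured {s : ℝ} {z : ℂ} (hz : z ∈ Metric.ball (0 : ℂ) 1) :
    punctured (bpt s) ∈ 𝓝 z := by
  refine Filter.mem_of_superset (Metric.isOpen_ball.mem_nhds hz) fun w hw => ?_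
  refine ⟨Metric.ball_subset_closedBall hw, fun h => ?_⟩
  rw [mem_singleton_iff.1 h] at hw
  simp at hw

theorem ball_subset_punctured (s : ℝ) : Metric.ball (0 : ℂ) 1 ⊆ punctured (bpt s) := fun _ hz =>
  mem_of_mem_nhds (ball_mem_nhds_punctured hz)

variable {L : L3} {ζ : ℂ × ℂ → (ℂ × ℂ →L[ℝ] ℝ)}

/-- The integrand of `zetaHat`. -/
def sliceWedge (ζ : ℂ × ℂ → (ℂ × ℂ →L[ℝ] ℝ)) (s t : ℝ) (z : ℂ) : ℝ :=
  wedgeCoeff (slice ζ (bpt s) z) (slice ζ (bpt t) z)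

theorem zetaHat_eq (s t : ℝ) : zetaHat ζ s t = ∫ z in disk, sliceWedge ζ s t z := by
  simp only [zetaHat, sliceWedge, wedgeCoeff, slice_apply]

theorem zetaHat_swap (s t : ℝ) : zetaHat ζ t s = - zetaHat ζ s t := by
  rw [zetaHat_eq, zetaHat_eq, ← integral_neg]
  refine integral_congr_ae (Filter.Eventually.of_forall fun z => ?_)
  simp only [sliceWedge, wedgeCoeff]
  ring

namespace IsPropagator

theorem continuousOn_slice_ball (hζ : IsPropagator L ζ) (s : ℝ) :
    ContinuousOn (slice ζ (bpt s)) (Metric.ball 0 1) :=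
  (hζ.contDiffOn_slice (bpt_mem_disk s)).continuousOn.mono (ball_subset_punctured s)

theorem continuousOn_sliceWedge (hζ : IsPropagator L ζ) (s t : ℝ) :
    ContinuousOn (sliceWedge ζ s t) (Metric.ball 0 1) := by
  have h := fun (s : ℝ) (w : ℂ) => (hζ.continuousOn_slice_ball s).clm_apply
    (continuousOn_const (c := w))
  exact ((h s 1).mul (h t Complex.I)).sub ((h s Complex.I).mul (h t 1))

/-- The product of the two singular factors is split by partial fractions: the triangle inequality
bounds the distance of `bpt s` and `bpt t` by the sum of the distances of `z` from them. After that,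
each term has a single singularity. -/
theorem abs_sliceWedge_le (hζ : IsPropagator L ζ) {s t : ℝ} (hst : bpt s ≠ bpt t) :
    ∃ K : ℝ, 0 ≤ K ∧ ∀ z ∈ Metric.ball (0 : ℂ) 1,
      |sliceWedge ζ s t z| ≤ K * (1 / ‖z - bpt s‖ + 1 / ‖z - bpt t‖) := by
  obtain ⟨C, hC0, hC⟩ := hζ.norm_slice_le
  have hd : 0 < ‖bpt s - bpt t‖ := norm_pos_iff.2 (sub_ne_zero.2 hst)
  refine ⟨2 * C ^ 2 / ‖bpt s - bpt t‖, by positivity, fun z hz => ?_⟩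
  have hzs := ball_subset_punctured s hz
  have hzt := ball_subset_punctured t hz
  have hps : 0 < ‖z - bpt s‖ := norm_pos_iff.2 (sub_ne_zero.2 hzs.2)
  have hpt : 0 < ‖z - bpt t‖ := norm_pos_iff.2 (sub_ne_zero.2 hzt.2)
  have h1 := hC _ (bpt_mem_disk s) z hzs 1
  have h2 := hC _ (bpt_mem_disk s) z hzs Complex.I
  have h3 := hC _ (bpt_mem_disk t) z hzt 1
  have h4 := hC _ (bpt_mem_disk t) z hzt Complex.I
  simp only [norm_one, Complex.norm_I, mul_one] at h1 h2 h3 h4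
  have h5 : |sliceWedge ζ s t z| ≤ 2 * (C / ‖z - bpt s‖ * (C / ‖z - bpt t‖)) := by
    rw [sliceWedge, wedgeCoeff]
    refine (abs_sub _ _).trans ?_
    rw [abs_mul, abs_mul, two_mul]
    gcongr
  refine h5.trans ?_
  have htri : ‖bpt s - bpt t‖ ≤ ‖z - bpt s‖ + ‖z - bpt t‖ := by
    have := norm_sub_le (z - bpt t) (z - bpt s)
    rw [show z - bpt t - (z - bpt s) = bpt s - bpt t by ring] at this
    linarith
  have e1 : 2 * (C / ‖z - bpt s‖ * (C / ‖z - bpt t‖)) =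
      2 * C ^ 2 / ‖bpt s - bpt t‖ * (‖bpt s - bpt t‖ / (‖z - bpt s‖ * ‖z - bpt t‖)) := by
    field_simp
  have e2 : 1 / ‖z - bpt s‖ + 1 / ‖z - bpt t‖ =
      (‖z - bpt s‖ + ‖z - bpt t‖) / (‖z - bpt s‖ * ‖z - bpt t‖) := by
    field_simp
    ring
  rw [e1, e2]
  gcongr

/-- The Jacobian `r` times each inverse distance is bounded by a function of the radius times a
function of the angle, and both are integrable. The majorant is thus integrable on the rectangle. -/
theorem integrableOn_polar (hζ : IsPropagator L ζ) {s t : ℝ} (hst : bpt s ≠ bpt t) :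
    IntegrableOn (fun p : ℝ × ℝ => p.1 * sliceWedge ζ s t (p.1 * bpt p.2))
      (Ioo 0 1 ×ˢ Ioo (-Real.pi) Real.pi) := by
  obtain ⟨K, hK0, hK⟩ := hζ.abs_sliceWedge_le hst
  have hpi : -Real.pi ≤ Real.pi := by linarith [Real.pi_pos]
  have hr : IntegrableOn (fun r : ℝ => K * (1 - r) ^ (-(1 / 2) : ℝ)) (Ioo 0 1) := by
    have := ((intervalIntegrable_iff_integrableOn_Ioc_of_le zero_le_one).1
      (intervalIntegrable_one_sub_rpow 0 1)).mono_set Ioo_subset_Ioc_self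
    exact Integrable.const_mul this K
  have hφ : IntegrableOn (fun φ => sinMajorant s φ + sinMajorant t φ) (Ioo (-Real.pi) Real.pi) :=
    ((intervalIntegrable_iff_integrableOn_Ioc_of_le hpi).1
      ((intervalIntegrable_sinMajorant s _ _).add (intervalIntegrable_sinMajorant t _ _))).mono_set
      Ioo_subset_Ioc_self
  have hprod : IntegrableOn (fun p : ℝ × ℝ => K * (1 - p.1) ^ (-(1 / 2) : ℝ) *
      (sinMajorant s p.2 + sinMajorant t p.2)) (Ioo 0 1 ×ˢ Ioo (-Real.pi) Real.pi) := by
    have := Integrable.mul_prod hr hφ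
    rwa [Measure.prod_restrict] at this
  have hmeas : MeasurableSet (Ioo (0 : ℝ) 1 ×ˢ Ioo (-Real.pi) Real.pi) :=
    measurableSet_Ioo.prod measurableSet_Ioo
  refine Integrable.mono' hprod ?_ ?_
  · refine ContinuousOn.aestronglyMeasurable ?_ hmeas
    exact continuousOn_fst.mul ((hζ.continuousOn_sliceWedge s t).comp continuous_rpt.continuousOn
      fun p hp => rpt_mem_ball ⟨hp.1.1.le, hp.1.2⟩ _)
  · rw [ae_restrict_iff' hmeas]
    have hae : ∀ s : ℝ, ∀ᵐ p : ℝ × ℝ, Real.sin ((p.2 - s) / 2) ≠ 0 := fun s =>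
      (Measure.quasiMeasurePreserving_snd (μ := volume) (ν := volume)).ae (ae_sin_ne_zero s)
    filter_upwards [hae s, hae t] with p hs ht hp
    rw [Real.norm_eq_abs, abs_mul, abs_of_pos hp.1.1]
    have h1 := hK _ (rpt_mem_ball ⟨hp.1.1.le, hp.1.2⟩ p.2)
    have h2 := div_norm_rpt_sub_le hp.1.1.le hp.1.2 hs
    have h3 := div_norm_rpt_sub_le hp.1.1.le hp.1.2 ht
    calc p.1 * |sliceWedge ζ s t (p.1 * bpt p.2)|
        ≤ p.1 * (K * (1 / ‖(p.1 : ℂ) * bpt p.2 - bpt s‖ + 1 / ‖(p.1 : ℂ) * bpt p.2 - bpt t‖)) :=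
          mul_le_mul_of_nonneg_left h1 hp.1.1.le
      _ = K * (p.1 / ‖(p.1 : ℂ) * bpt p.2 - bpt s‖ + p.1 / ‖(p.1 : ℂ) * bpt p.2 - bpt t‖) := by
          ring
      _ ≤ K * ((1 - p.1) ^ (-(1 / 2) : ℝ) * sinMajorant s p.2 +
          (1 - p.1) ^ (-(1 / 2) : ℝ) * sinMajorant t p.2) :=
          mul_le_mul_of_nonneg_left (add_le_add h2 h3) hK0
      _ = _ := by ring

/-- `zetaHat` in polar coordinates. -/
theorem zetaHat_polar (hζ : IsPropagator L ζ) {s t : ℝ} (hst : bpt s ≠ bpt t) (x : ℝ) :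
    IntervalIntegrable (fun r => ∫ φ in x..(x + 2 * Real.pi), r * sliceWedge ζ s t (r * bpt φ))
      volume 0 1 ∧
    zetaHat ζ s t =
      ∫ r in (0 : ℝ)..1, ∫ φ in x..(x + 2 * Real.pi), r * sliceWedge ζ s t (r * bpt φ) := by
  have hpi : -Real.pi ≤ Real.pi := by linarith [Real.pi_pos]
  have hint := hζ.integrableOn_polar hst
  have hshift : ∀ r : ℝ, ∫ φ in x..(x + 2 * Real.pi), r * sliceWedge ζ s t (r * bpt φ) =
      ∫ φ in Ioo (-Real.pi) Real.pi, r * sliceWedge ζ s t (r * bpt φ) := by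
    intro r
    have hper : Function.Periodic (fun φ => r * sliceWedge ζ s t (r * bpt φ)) (2 * Real.pi) :=
      fun φ => by simp only [bpt_periodic φ]
    rw [hper.intervalIntegral_add_eq x (-Real.pi),
      show -Real.pi + 2 * Real.pi = Real.pi by ring, intervalIntegral.integral_of_le hpi,
      integral_Ioc_eq_integral_Ioo]
  simp only [hshift]
  have hint' : Integrable (fun p : ℝ × ℝ => p.1 * sliceWedge ζ s t (p.1 * bpt p.2))
      ((volume.restrict (Ioo 0 1)).prod (volume.restrict (Ioo (-Real.pi) Real.pi))) := by
    rwa [Measure.prod_restrict]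
  have hdm : MeasurableSet disk := Metric.isClosed_closedBall.measurableSet
  refine ⟨?_, ?_⟩
  · rw [intervalIntegrable_iff_integrableOn_Ioo_of_le zero_le_one]
    exact hint'.integral_prod_left
  · rw [intervalIntegral.integral_of_le zero_le_one, integral_Ioc_eq_integral_Ioo,
      zetaHat_eq, ← integral_indicator hdm,
      ← Complex.integral_comp_polarCoord_symm, ← setIntegral_prod _ hint]
    refine (setIntegral_eq_of_subset_of_ae_sdiff_eq_zero
      (s := Ioo (0 : ℝ) 1 ×ˢ Ioo (-Real.pi) Real.pi)
      (measurableSet_Ioi.prod measurableSet_Ioo).nullMeasurableSet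
      (prod_mono Ioo_subset_Ioi_self le_rfl) ?_).trans ?_
    -- Outside the rectangle the indicator of the disk vanishes, except possibly on the circle of
    -- radius one, a null set.
    · have hae : ∀ᵐ p : ℝ × ℝ, p.1 ≠ 1 :=
        (Measure.quasiMeasurePreserving_fst (μ := volume) (ν := volume)).ae
          (show ∀ᵐ r : ℝ, r ≠ 1 by simp [ae_iff])
      filter_upwards [hae] with p hp1 hp
      rw [indicator_of_notMem, smul_zero]
      intro hmem
      have h1 : |p.1| ≤ 1 := by
        have := Complex.norm_polarCoord_symm p
        rw [← this]
        simpa only [disk, Metric.mem_closedBall, dist_zero_right] using hmem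
      exact hp.2 ⟨⟨hp.1.1, lt_of_le_of_ne (le_of_abs_le h1) hp1⟩, hp.1.2⟩
    · refine setIntegral_congr_fun (measurableSet_Ioo.prod measurableSet_Ioo) fun p hp => ?_
      have h1 : Complex.polarCoord.symm p = p.1 * bpt p.2 := by
        rw [Complex.polarCoord_symm_apply, bpt, Complex.exp_mul_I]
        simp
      simp only [h1]
      rw [indicator_of_mem (rpt_mem_disk hp.1.1.le hp.1.2.le _), smul_eq_mul]

/-- The boundary integral of a primitive against a propagator, as a radial limit. -/
theorem tendsto_boundary_integral (hζ : IsPropagator L ζ) {s t : ℝ} {f : ℂ → ℝ}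
    (hf : ∀ z ∈ punctured (bpt s), HasFDerivWithinAt f (slice ζ (bpt s) z) (punctured (bpt s)) z)
    {x y : ℝ} (hxy : x ≤ y) (ht : ∀ φ ∈ Icc x y, bpt φ ≠ bpt t) {M : ℝ}
    (hM : ∀ φ ∈ Icc x y, |f (bpt φ)| ≤ M) :
    Filter.Tendsto (fun R : ℝ => ∫ φ in x..y, f (R * bpt φ) *
        (R * slice ζ (bpt t) (R * bpt φ) (btan φ))) (𝓝[<] 1)
      (𝓝 (∫ φ in x..y, f (bpt φ) * slice ζ (bpt t) (bpt φ) (btan φ))) := by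
  obtain ⟨C, hC0, hC⟩ := hζ.norm_slice_le
  have hηc : ContinuousOn (fun p : ℝ × ℝ => slice ζ (bpt t) (p.1 * bpt p.2) (btan p.2))
      (Icc 0 1 ×ˢ Icc x y) := by
    have h1 : ContinuousOn (fun p : ℝ × ℝ => slice ζ (bpt t) (p.1 * bpt p.2))
        (Icc 0 1 ×ˢ Icc x y) := by
      refine (hζ.contDiffOn_slice (bpt_mem_disk t)).continuousOn.comp continuous_rpt.continuousOn
        fun p hp => ⟨rpt_mem_disk hp.1.1 hp.1.2 _, fun h => ?_⟩
      rcases hp.1.2.lt_or_eq with h1 | h1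
      · exact rpt_ne_bpt hp.1.1 h1 t p.2 h
      · rw [mem_singleton_iff, h1, Complex.ofReal_one, one_mul] at h
        exact ht _ hp.2 h
    exact h1.clm_apply (continuous_btan.comp continuous_snd).continuousOn
  obtain ⟨C', hC'⟩ := (isCompact_Icc.prod isCompact_Icc).exists_bound_of_continuousOn hηc
  -- The slice estimate integrated along a radius from `1 / 2` to the boundary bounds the growth of
  -- `f`. The factor 2 compensates the factor `ρ ≥ 1 / 2` in `div_norm_rpt_sub_le`.
  set N : ℝ := ∫ ρ in (1 / 2 : ℝ)..1, 2 * C * (1 - ρ) ^ (-(1 / 2) : ℝ) with hN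
  have hradial : ∀ φ, Real.sin ((φ - s) / 2) ≠ 0 → ∀ R ∈ Ico (1 / 2 : ℝ) 1,
      |f (R * bpt φ)| ≤ |f (bpt φ)| + N * sinMajorant s φ := by
    intro φ hφ R hR
    have hmem : ∀ ρ ∈ Icc R 1, (ρ : ℂ) * bpt φ ∈ punctured (bpt s) := by
      intro ρ hρ
      have h0 : 0 ≤ ρ := by linarith [hρ.1, hR.1]
      refine ⟨rpt_mem_disk h0 hρ.2 _, fun h => ?_⟩
      rcases hρ.2.lt_or_eq with h1 | h1
      · exact rpt_ne_bpt h0 h1 s φ h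
      · rw [mem_singleton_iff, h1, Complex.ofReal_one, one_mul] at h
        exact bpt_ne_of_sin_ne_zero hφ h
    have hd : ∀ ρ ∈ Icc R 1, HasDerivWithinAt (fun ρ : ℝ => f (ρ * bpt φ))
        (slice ζ (bpt s) (ρ * bpt φ) (bpt φ)) (Icc R 1) ρ := fun ρ hρ =>
      (hf _ (hmem ρ hρ)).comp_hasDerivWithinAt ρ (hasDerivAt_rpt_radius ρ φ).hasDerivWithinAt hmem
    have hc : ContinuousOn (fun ρ : ℝ => slice ζ (bpt s) (ρ * bpt φ) (bpt φ)) (Icc R 1) :=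
      ((hζ.contDiffOn_slice (bpt_mem_disk s)).continuousOn.comp
        (f := fun ρ : ℝ => (ρ : ℂ) * bpt φ) (by fun_prop) hmem).clm_apply continuousOn_const
    have hFTC := intervalIntegral.integral_eq_sub_of_hasDeriv_right_of_le hR.2.le
      (fun ρ hρ => (hd ρ hρ).continuousWithinAt)
      (fun ρ hρ => ((hd ρ ⟨hρ.1.le, hρ.2.le⟩).hasDerivAt
        (Icc_mem_nhds hρ.1 hρ.2)).hasDerivWithinAt)
      (hc.intervalIntegrable_of_Icc hR.2.le)
    have hg : ∀ a b : ℝ, IntervalIntegrable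
        (fun ρ : ℝ => 2 * C * (1 - ρ) ^ (-(1 / 2) : ℝ) * sinMajorant s φ) volume a b := fun a b =>
      ((intervalIntegrable_one_sub_rpow a b).const_mul (2 * C)).mul_const _
    have hle : ‖∫ ρ in R..1, slice ζ (bpt s) (ρ * bpt φ) (bpt φ)‖ ≤
        ∫ ρ in R..1, 2 * C * (1 - ρ) ^ (-(1 / 2) : ℝ) * sinMajorant s φ := by
      refine intervalIntegral.norm_integral_le_of_norm_le hR.2.le ?_ (hg _ _)
      have hne : ∀ᵐ ρ : ℝ, ρ ≠ 1 := by simp [ae_iff]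
      filter_upwards [hne] with ρ hρ1 hρ
      have hρ0 : 1 / 2 ≤ ρ := hR.1.trans hρ.1.le
      have hρ2 : ρ < 1 := lt_of_le_of_ne hρ.2 hρ1
      have h1 := hC _ (bpt_mem_disk s) _ (hmem ρ ⟨hρ.1.le, hρ.2⟩) (bpt φ)
      have h2 := div_norm_rpt_sub_le (by linarith) hρ2 hφ
      rw [norm_bpt, mul_one] at h1
      rw [Real.norm_eq_abs]
      refine h1.trans ?_
      have h3 : C / ‖(ρ : ℂ) * bpt φ - bpt s‖ ≤ 2 * C * (ρ / ‖(ρ : ℂ) * bpt φ - bpt s‖) := by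
        rw [← mul_div_assoc]
        gcongr
        nlinarith
      refine h3.trans ?_
      rw [mul_assoc (2 * C)]
      gcongr
    have hle2 : ∫ ρ in R..1, 2 * C * (1 - ρ) ^ (-(1 / 2) : ℝ) * sinMajorant s φ ≤
        N * sinMajorant s φ := by
      rw [hN, ← intervalIntegral.integral_mul_const]
      refine intervalIntegral.integral_mono_interval hR.1 hR.2.le le_rfl ?_ (hg _ _)
      refine (ae_restrict_iff' measurableSet_Ioc).2 (Filter.Eventually.of_forall fun ρ hρ => ?_)
      have : 0 ≤ 1 - ρ := by linarith [hρ.2]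
      have := sinMajorant_nonneg s φ
      simp only [Pi.zero_apply]
      positivity
    rw [hFTC] at hle
    simp only [Complex.ofReal_one, one_mul] at hle
    have h1 := hle.trans hle2
    rw [Real.norm_eq_abs, abs_sub_comm] at h1
    linarith [abs_sub_abs_le_abs_sub (f (R * bpt φ)) (f (bpt φ))]
  have hbd : ∀ᶠ R : ℝ in 𝓝[<] 1, R ∈ Ico (1 / 2 : ℝ) 1 := Ico_mem_nhdsLT (by norm_num)
  -- The slice at `t` is bounded by `C'` since the arc avoids `bpt t`. The singular point `bpt s`
  -- may lie on the arc; there `f` is dominated by the integrable `sinMajorant`.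
  refine intervalIntegral.tendsto_integral_filter_of_dominated_convergence
    (fun φ => (M + N * sinMajorant s φ) * C') ?_ ?_ ?_ ?_
  · filter_upwards [hbd] with R hR
    have hR' : R ∈ Ico (0 : ℝ) 1 := ⟨by linarith [hR.1], hR.2⟩
    have hcf : Continuous fun φ => f (R * bpt φ) := by
      refine continuous_iff_continuousAt.2 fun φ => ?_
      have h1 := ((hf _ (ball_subset_punctured s (rpt_mem_ball hR' φ))).hasFDerivAt
        (ball_mem_nhds_punctured (rpt_mem_ball hR' φ))).continuousAt
      exact ContinuousAt.comp (f := fun φ : ℝ => (R : ℂ) * bpt φ) h1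
        (continuous_const.mul continuous_bpt).continuousAt
    have hcη : Continuous fun φ => slice ζ (bpt t) (R * bpt φ) (btan φ) :=
      ((hζ.continuousOn_slice_ball t).comp_continuous (continuous_const.mul continuous_bpt)
        fun φ => rpt_mem_ball hR' φ).clm_apply continuous_btan
    exact (hcf.mul (continuous_const.mul hcη)).aestronglyMeasurable
  · filter_upwards [hbd] with R hR
    filter_upwards [ae_sin_ne_zero s] with φ hφ hmem
    rw [uIoc_of_le hxy] at hmem
    have hmem' : φ ∈ Icc x y := ⟨hmem.1.le, hmem.2⟩
    have h1 := hradial φ hφ R hR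
    have h2 := hC' (R, φ) ⟨⟨by linarith [hR.1], hR.2.le⟩, hmem'⟩
    rw [Real.norm_eq_abs] at h2
    rw [Real.norm_eq_abs, abs_mul, abs_mul, abs_of_nonneg (by linarith [hR.1] : 0 ≤ R)]
    refine mul_le_mul (h1.trans (by linarith [hM φ hmem'])) ?_ (by have := hR.1; positivity) ?_
    · exact (mul_le_of_le_one_left (abs_nonneg _) hR.2.le).trans h2
    · exact (abs_nonneg _).trans (h1.trans (by linarith [hM φ hmem']))
  · exact (((intervalIntegrable_const (c := M)).add
      ((intervalIntegrable_sinMajorant s x y).const_mul N)).mul_const C')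
  · filter_upwards [ae_sin_ne_zero s] with φ hφ hmem
    rw [uIoc_of_le hxy] at hmem
    have hmem' : φ ∈ Icc x y := ⟨hmem.1.le, hmem.2⟩
    have hlim : ∀ (u : ℝ), bpt φ ≠ bpt u → Filter.Tendsto (fun R : ℝ => (R : ℂ) * bpt φ) (𝓝[<] 1)
        (𝓝[punctured (bpt u)] (bpt φ)) := by
      intro u hu
      refine tendsto_nhdsWithin_iff.2 ⟨?_, ?_⟩
      · have : Continuous fun R : ℝ => (R : ℂ) * bpt φ := by fun_prop
        have h1 := this.tendsto 1
        rw [Complex.ofReal_one, one_mul] at h1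
        exact h1.mono_left nhdsWithin_le_nhds
      · filter_upwards [hbd] with R hR
        exact ball_subset_punctured u (rpt_mem_ball ⟨by linarith [hR.1], hR.2⟩ φ)
    have hφs := bpt_ne_of_sin_ne_zero hφ
    have h1 : Filter.Tendsto (fun R : ℝ => f (R * bpt φ)) (𝓝[<] 1) (𝓝 (f (bpt φ))) :=
      (hf _ ⟨bpt_mem_disk φ, hφs⟩).continuousWithinAt.tendsto.comp (hlim s hφs)
    have h2 : Filter.Tendsto (fun R : ℝ => slice ζ (bpt t) (R * bpt φ)) (𝓝[<] 1)
        (𝓝 (slice ζ (bpt t) (bpt φ))) :=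
      ((hζ.contDiffOn_slice (bpt_mem_disk t)).continuousOn _
        ⟨bpt_mem_disk φ, ht φ hmem'⟩).tendsto.comp (hlim t (ht φ hmem'))
    have h3 : Filter.Tendsto (fun R : ℝ => slice ζ (bpt t) (R * bpt φ) (btan φ)) (𝓝[<] 1)
        (𝓝 (slice ζ (bpt t) (bpt φ) (btan φ))) := 
      ((ContinuousLinearMap.apply ℝ ℝ (btan φ)).continuous.tendsto _).comp h2
    have h4 : Filter.Tendsto (fun R : ℝ => R) (𝓝[<] 1) (𝓝 1) :=
      Filter.tendsto_id.mono_left nhdsWithin_le_nhds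
    simpa using h1.mul (h4.mul h3)

end IsPropagator

end ZetaHat


end

section

open Filter Topology

/-! ### Boundary values of primitives -/

/-- The component along `∂₁` of the pulled back propagator. -/
def bdryU (ζ : ℂ × ℂ → (ℂ × ℂ →L[ℝ] ℝ)) (s u : ℝ) : ℝ := ζ (bpt u, bpt s) (btan u, 0)

/-- The component along `∂₂` of the pulled back propagator. -/
def bdryV (ζ : ℂ × ℂ → (ℂ × ℂ →L[ℝ] ℝ)) (s u : ℝ) : ℝ := ζ (bpt u, bpt s) (0, btan s)

/-- The primitive along `∂₁` of the pulled back propagator. -/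
def bdryPrim (L : L3) (ζ : ℂ × ℂ → (ℂ × ℂ →L[ℝ] ℝ)) (s u : ℝ) : ℝ :=
  - ∫ u' in u..(L.θ 1), bdryU ζ s u'

variable {L : L3} {ζ : ℂ × ℂ → (ℂ × ℂ →L[ℝ] ℝ)}

theorem slice_bpt_btan (s φ : ℝ) : slice ζ (bpt s) (bpt φ) (btan φ) = bdryU ζ s φ := slice_apply ..

namespace L3

theorem bpt_ne {s φ : ℝ} (hs : s ∈ Ioo (L.θ 1) (L.θ 0 + 2 * Real.pi))
    (hφ : φ ∈ Icc (L.θ 0) (L.θ 0 + 2 * Real.pi)) (h : φ ≠ s) : bpt φ ≠ bpt s := by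
  have h01 : L.θ 0 < L.θ 1 := L.θ_lt (by decide)
  refine bpt_ne_bpt h ?_
  rw [abs_lt]
  constructor <;> linarith [hφ.1, hφ.2, hs.1, hs.2]

end L3

namespace IsPropagator

theorem continuousAt_bdryU (hζ : IsPropagator L ζ) {s φ : ℝ} (h : bpt φ ≠ bpt s) :
    ContinuousAt (bdryU ζ s) φ := by
  have h1 := (hζ.contDiffOn_slice (bpt_mem_disk s)).continuousOn (bpt φ) ⟨bpt_mem_disk φ, h⟩
  have h2 : Tendsto bpt (𝓝 φ) (𝓝[punctured (bpt s)] (bpt φ)) := by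
    refine tendsto_nhdsWithin_iff.2 ⟨continuous_bpt.continuousAt, ?_⟩
    filter_upwards [(isOpen_ne_fun continuous_bpt continuous_const).mem_nhds h] with u hu
    exact ⟨bpt_mem_disk u, hu⟩
  have h3 : ContinuousAt (fun u => slice ζ (bpt s) (bpt u)) φ := h1.tendsto.comp h2
  simpa only [slice_bpt_btan] using h3.clm_apply continuous_btan.continuousAt

theorem hasDerivAt_primitive {s φ : ℝ} {f : ℂ → ℝ}
    (hf : ∀ z ∈ punctured (bpt s), HasFDerivWithinAt f (slice ζ (bpt s) z) (punctured (bpt s)) z)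
    (h : bpt φ ≠ bpt s) : HasDerivAt (fun φ => f (bpt φ)) (bdryU ζ s φ) φ := by
  have h3 : ∀ᶠ u in 𝓝 φ, bpt u ∈ punctured (bpt s) := by
    filter_upwards [(isOpen_ne_fun continuous_bpt continuous_const).mem_nhds h] with u hu
    exact ⟨bpt_mem_disk u, hu⟩
  have := (hf _ ⟨bpt_mem_disk φ, h⟩).comp_hasDerivAt φ (hasDerivAt_bpt φ) h3
  rwa [slice_bpt_btan] at this

theorem bdryU_eq_zero (hζ : IsPropagator L ζ) {s φ : ℝ}
    (hs : s ∈ Ioo (L.θ 1) (L.θ 0 + 2 * Real.pi)) (hφ : φ ∈ L.arcB) (h : φ ≠ s) :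
    bdryU ζ s φ = 0 := by
  have h01 : L.θ 0 < L.θ 1 := L.θ_lt (by decide)
  rw [← slice_bpt_btan]
  exact hζ.slice_boundary_eta hφ (bpt_mem_disk s)
    (L3.bpt_ne (L := L) hs ⟨by linarith [hφ.1], hφ.2⟩ h)

theorem integral_bdryU (hζ : IsPropagator L ζ) {s x y : ℝ} (hxy : x ≤ y) {f : ℂ → ℝ}
    (hf : ∀ z ∈ punctured (bpt s), HasFDerivWithinAt f (slice ζ (bpt s) z) (punctured (bpt s)) z)
    (h : ∀ φ ∈ Icc x y, bpt φ ≠ bpt s) : ∫ φ in x..y, bdryU ζ s φ = f (bpt y) - f (bpt x) := by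
  have hc : ContinuousOn (bdryU ζ s) (Icc x y) := fun φ hφ =>
    (hζ.continuousAt_bdryU (h φ hφ)).continuousWithinAt
  refine intervalIntegral.integral_eq_sub_of_hasDerivAt (f := fun φ => f (bpt φ)) (fun φ hφ => ?_)
    (hc.intervalIntegrable_of_Icc hxy)
  rw [uIcc_of_le hxy] at hφ
  exact hasDerivAt_primitive hf (h φ hφ)

/-- The boundary values of the primitive that vanishes on the arc between `∂₁` and the
singularity. -/
theorem exists_normalized_primitive (hζ : IsPropagator L ζ) {s : ℝ}
    (hs : s ∈ Ioo (L.θ 1) (L.θ 0 + 2 * Real.pi)) :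
    ∃ f : ℂ → ℝ,
      (∀ z ∈ punctured (bpt s),
        HasFDerivWithinAt f (slice ζ (bpt s) z) (punctured (bpt s)) z) ∧
      (∀ φ ∈ Icc (L.θ 0) (L.θ 1), f (bpt φ) = bdryPrim L ζ s φ) ∧
      (∀ φ ∈ Ico (L.θ 1) s, f (bpt φ) = 0) ∧
      (∀ φ ∈ Ioc s (L.θ 0 + 2 * Real.pi), f (bpt φ) = -1) := by
  have h01 : L.θ 0 < L.θ 1 := L.θ_lt (by decide)
  obtain ⟨f₀, -, hf₀⟩ := hζ.exists_primitive_slice s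
  have hf : ∀ z ∈ punctured (bpt s), HasFDerivWithinAt (fun z => f₀ z - f₀ (bpt (L.θ 1)))
      (slice ζ (bpt s) z) (punctured (bpt s)) z := fun z hz => (hf₀ z hz).sub_const _
  refine ⟨_, hf, fun φ hφ => ?_, fun φ hφ => ?_, fun φ hφ => ?_⟩
  · rw [bdryPrim, hζ.integral_bdryU hφ.2 hf₀ fun x hx => L3.bpt_ne hs
      ⟨hφ.1.trans hx.1, by linarith [hx.2, hs.1, hs.2]⟩ (by linarith [hx.2, hs.1])]
    ring
  · rw [← hζ.integral_bdryU hφ.1 hf₀ fun x hx => L3.bpt_ne hs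
      ⟨h01.le.trans hx.1, by linarith [hx.2, hφ.2, hs.2]⟩ (by linarith [hx.2, hφ.2])]
    rw [intervalIntegral.integral_congr (g := fun _ => 0), intervalIntegral.integral_zero]
    intro x hx
    rw [uIcc_of_le hφ.1] at hx
    exact hζ.bdryU_eq_zero hs ⟨hx.1, by linarith [hx.2, hφ.2, hs.2]⟩ (by linarith [hx.2, hφ.2])
  · have h1 : f₀ (bpt φ) = f₀ (bpt (L.θ 0 + 2 * Real.pi)) := by
      have h := hζ.integral_bdryU hφ.2 hf₀ fun x hx => L3.bpt_ne hs
        ⟨by linarith [hx.1, hφ.1, hs.1], hx.2⟩ (by linarith [hx.1, hφ.1])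
      rw [intervalIntegral.integral_congr (g := fun _ => 0), intervalIntegral.integral_zero] at h
      · linarith
      intro x hx
      rw [uIcc_of_le hφ.2] at hx
      exact hζ.bdryU_eq_zero hs ⟨by linarith [hx.1, hφ.1, hs.1], hx.2⟩ (by linarith [hx.1, hφ.1])
    have h2 := hζ.integral_bdryU h01.le hf₀ fun x hx => L3.bpt_ne hs
        ⟨hx.1, by linarith [hx.2, hs.1, hs.2]⟩ (by linarith [hx.2, hs.1])
    have h3 : ∫ u in (L.θ 0)..(L.θ 1), bdryU ζ s u = 1 := hζ.integral_boundary hs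
    rw [h1, bpt_periodic]
    linarith

theorem continuousOn_bdryU (hζ : IsPropagator L ζ) {s : ℝ}
    (hs : s ∈ Ioo (L.θ 1) (L.θ 0 + 2 * Real.pi)) :
    ContinuousOn (bdryU ζ s) (Icc (L.θ 0) (L.θ 1)) := fun φ hφ =>
  (hζ.continuousAt_bdryU (L3.bpt_ne hs ⟨hφ.1, by linarith [hφ.2, hs.1, hs.2]⟩
    (by linarith [hφ.2, hs.1]))).continuousWithinAt

theorem hasDerivAt_of_normalized {s : ℝ} (hs : s ∈ Ioo (L.θ 1) (L.θ 0 + 2 * Real.pi)) {f : ℂ → ℝ}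
    (hf : ∀ z ∈ punctured (bpt s), HasFDerivWithinAt f (slice ζ (bpt s) z) (punctured (bpt s)) z)
    {φ : ℝ} (hφ : φ ∈ Icc (L.θ 0) (L.θ 1)) :
    HasDerivAt (fun φ => f (bpt φ)) (bdryU ζ s φ) φ :=
  hasDerivAt_primitive hf (L3.bpt_ne hs ⟨hφ.1, by linarith [hφ.2, hs.1, hs.2]⟩
    (by linarith [hφ.2, hs.1]))

/-- The pairing `∫ P(s, u) ∂_u P(t, u) du` of boundary primitives. -/
def _root_.PSM.bdryPair (L : L3) (ζ : ℂ × ℂ → (ℂ × ℂ →L[ℝ] ℝ)) (s t : ℝ) : ℝ :=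
  ∫ u in (L.θ 0)..(L.θ 1), bdryPrim L ζ s u * bdryU ζ t u

/-- Integration by parts: both normalised primitives are `-1` at the first end of `∂₁` and `0` at
the last, so their product contributes `0 - 1`. -/
theorem bdryPair_add_swap (hζ : IsPropagator L ζ) {s t : ℝ}
    (hs : s ∈ Ioo (L.θ 1) (L.θ 0 + 2 * Real.pi)) (ht : t ∈ Ioo (L.θ 1) (L.θ 0 + 2 * Real.pi)) :
    bdryPair L ζ s t + bdryPair L ζ t s = -1 := by
  have h01 : L.θ 0 < L.θ 1 := L.θ_lt (by decide)
  obtain ⟨f, hf, hf1, hf2, hf3⟩ := hζ.exists_normalized_primitive hs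
  obtain ⟨g, hg, hg1, hg2, hg3⟩ := hζ.exists_normalized_primitive ht
  have e1 : bdryPair L ζ s t = ∫ u in (L.θ 0)..(L.θ 1), f (bpt u) * bdryU ζ t u :=
    intervalIntegral.integral_congr fun u hu => by
      rw [uIcc_of_le h01.le] at hu
      simp only [hf1 u hu]
  have e2 : bdryPair L ζ t s = ∫ u in (L.θ 0)..(L.θ 1), bdryU ζ s u * g (bpt u) :=
    intervalIntegral.integral_congr fun u hu => by
      rw [uIcc_of_le h01.le] at hu
      simp only [hg1 u hu, mul_comm]
  rw [e1, e2, intervalIntegral.integral_mul_deriv_eq_deriv_mul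
    (fun u hu => hasDerivAt_of_normalized hs hf (by rwa [uIcc_of_le h01.le] at hu))
    (fun u hu => hasDerivAt_of_normalized ht hg (by rwa [uIcc_of_le h01.le] at hu))
    ((hζ.continuousOn_bdryU hs).intervalIntegrable_of_Icc h01.le)
    ((hζ.continuousOn_bdryU ht).intervalIntegrable_of_Icc h01.le)]
  have a1 := hf2 _ ⟨le_rfl, hs.1⟩
  have a2 := hf3 _ ⟨hs.2, le_rfl⟩
  have a4 := hg3 _ ⟨ht.2, le_rfl⟩
  rw [bpt_periodic] at a2 a4
  rw [a1, a2, a4]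
  ring

/-- The radial limit of the boundary terms in Green's formula. -/
theorem tendsto_green (hζ : IsPropagator L ζ) {s t : ℝ} (hst : bpt s ≠ bpt t) {f : ℂ → ℝ}
    (hf : ∀ z ∈ punctured (bpt s), HasFDerivWithinAt f (slice ζ (bpt s) z) (punctured (bpt s)) z)
    (x : ℝ) :
    Tendsto (fun R : ℝ => ∫ φ in x..(x + 2 * Real.pi), f (R * bpt φ) *
        (R * slice ζ (bpt t) (R * bpt φ) (btan φ))) (𝓝[<] 1) (𝓝 (zetaHat ζ s t)) := by
  obtain ⟨h1, h2⟩ := hζ.zetaHat_polar hst x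
  rw [h2]
  have h3 : Tendsto (fun R : ℝ => ∫ r in (0 : ℝ)..R, ∫ φ in x..(x + 2 * Real.pi),
      r * sliceWedge ζ s t (r * bpt φ)) (𝓝[<] 1) (𝓝 (∫ r in (0 : ℝ)..1,
        ∫ φ in x..(x + 2 * Real.pi), r * sliceWedge ζ s t (r * bpt φ))) := by
    have h4 := intervalIntegral.continuousOn_primitive_interval (μ := volume)
      (a := 0) (b := 1) ((intervalIntegrable_iff').1 h1)
    have h5 := (h4 1 right_mem_uIcc).tendsto
    refine h5.mono_left ?_
    rw [← nhdsWithin_Ioo_eq_nhdsLT (zero_lt_one' ℝ), uIcc_of_le zero_le_one]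
    exact nhdsWithin_mono _ Ioo_subset_Icc_self
  refine h3.congr' ?_
  filter_upwards [Ioo_mem_nhdsLT (zero_lt_one' ℝ)] with R hR
  have hsub := fun s => ball_subset_punctured s
  refine green_polar (η' := fun z => fderivWithin ℝ (slice ζ (bpt t)) (punctured (bpt t)) z)
    (fun z hz => (hf z (hsub s hz)).hasFDerivAt (ball_mem_nhds_punctured hz))
    (fun z hz => ?_) (fun z hz => hζ.symm_fderivWithin_slice (bpt_mem_disk t) (hsub t hz))
    (hζ.continuousOn_slice_ball s) ?_ x ⟨hR.1.le, hR.2⟩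
  · exact ((hζ.contDiffOn_slice (bpt_mem_disk t)).differentiableOn (by simp) z
      (hsub t hz)).hasFDerivWithinAt.hasFDerivAt (ball_mem_nhds_punctured hz)
  · exact ((hζ.contDiffOn_slice (bpt_mem_disk t)).continuousOn_fderivWithin
      (uniqueDiff_punctured _) (by simp)).mono (hsub t)

theorem exists_bound_normalized (hζ : IsPropagator L ζ) {s : ℝ}
    (hs : s ∈ Ioo (L.θ 1) (L.θ 0 + 2 * Real.pi)) {f : ℂ → ℝ}
    (hf1 : ∀ φ ∈ Icc (L.θ 0) (L.θ 1), f (bpt φ) = bdryPrim L ζ s φ)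
    (hf2 : ∀ φ ∈ Ico (L.θ 1) s, f (bpt φ) = 0)
    (hf3 : ∀ φ ∈ Ioc s (L.θ 0 + 2 * Real.pi), f (bpt φ) = -1) :
    ∃ M : ℝ, ∀ φ ∈ Icc (L.θ 0) (L.θ 0 + 2 * Real.pi), |f (bpt φ)| ≤ M := by
  have h01 : L.θ 0 < L.θ 1 := L.θ_lt (by decide)
  have hc : ContinuousOn (bdryPrim L ζ s) (Icc (L.θ 0) (L.θ 1)) := by
    have h := intervalIntegral.continuousOn_primitive_interval_left (μ := volume) (a := L.θ 0)
      (b := L.θ 1) (f := bdryU ζ s) (((hζ.continuousOn_bdryU hs).intervalIntegrable_of_Icc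
        h01.le |> (intervalIntegrable_iff').1))
    rw [uIcc_of_le h01.le] at h
    exact h.neg
  obtain ⟨M, hM⟩ := isCompact_Icc.exists_bound_of_continuousOn hc
  -- The value at the singular point is not controlled by the hypotheses, but it is one number and
  -- enters the bound as such.
  refine ⟨|M| + 1 + |f (bpt s)|, fun φ hφ => ?_⟩
  have p1 := abs_nonneg M
  have p2 := abs_nonneg (f (bpt s))
  rcases le_total φ (L.θ 1) with h | h
  · have := hM φ ⟨hφ.1, h⟩
    rw [hf1 φ ⟨hφ.1, h⟩, ← Real.norm_eq_abs]
    linarith [le_abs_self M]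
  · rcases lt_trichotomy φ s with h' | h' | h'
    · rw [hf2 φ ⟨h, h'⟩, abs_zero]; positivity
    · rw [h']; linarith
    · rw [hf3 φ ⟨h', hφ.2⟩, abs_neg, abs_one]; linarith

theorem intervalIntegrable_rpt (hζ : IsPropagator L ζ) {s t : ℝ} {f : ℂ → ℝ}
    (hf : ∀ z ∈ punctured (bpt s), HasFDerivWithinAt f (slice ζ (bpt s) z) (punctured (bpt s)) z)
    {R : ℝ} (hR : R ∈ Ioo (0 : ℝ) 1) (x y : ℝ) :
    IntervalIntegrable (fun φ => f (R * bpt φ) * (R * slice ζ (bpt t) (R * bpt φ) (btan φ)))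
      volume x y := by
  have hm : ∀ φ : ℝ, (R : ℂ) * bpt φ ∈ Metric.ball (0 : ℂ) 1 := rpt_mem_ball ⟨hR.1.le, hR.2⟩
  have hc : Continuous fun φ : ℝ => (R : ℂ) * bpt φ := continuous_const.mul continuous_bpt
  have h1 : Continuous fun φ : ℝ => f (R * bpt φ) := by
    have : ContinuousOn f (Metric.ball 0 1) := fun z hz =>
      ((hf z (ball_subset_punctured s hz)).hasFDerivAt
        (ball_mem_nhds_punctured hz)).continuousAt.continuousWithinAt
    exact this.comp_continuous hc hm
  have h2 : Continuous fun φ : ℝ => slice ζ (bpt t) (R * bpt φ) (btan φ) :=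
    ((hζ.continuousOn_slice_ball t).comp_continuous hc hm).clm_apply continuous_btan
  exact (h1.mul (continuous_const.mul h2)).intervalIntegrable x y

theorem hasDerivAt_rpt {s : ℝ} {f : ℂ → ℝ}
    (hf : ∀ z ∈ punctured (bpt s), HasFDerivWithinAt f (slice ζ (bpt s) z) (punctured (bpt s)) z)
    {R : ℝ} (hR : R ∈ Ioo (0 : ℝ) 1) (φ : ℝ) :
    HasDerivAt (fun φ : ℝ => f (R * bpt φ)) (R * slice ζ (bpt s) (R * bpt φ) (btan φ)) φ := by
  have hm := rpt_mem_ball ⟨hR.1.le, hR.2⟩ φ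
  have h := ((hf _ (ball_subset_punctured s hm)).hasFDerivAt
    (ball_mem_nhds_punctured hm)).comp_hasDerivAt φ (hasDerivAt_rpt_angle R φ)
  rwa [map_rmul] at h

theorem tendsto_rpt_of_ne {s : ℝ} {f : ℂ → ℝ}
    (hf : ∀ z ∈ punctured (bpt s), HasFDerivWithinAt f (slice ζ (bpt s) z) (punctured (bpt s)) z)
    {φ : ℝ} (h : bpt φ ≠ bpt s) :
    Tendsto (fun R : ℝ => f (R * bpt φ)) (𝓝[<] 1) (𝓝 (f (bpt φ))) := by
  refine (hf _ ⟨bpt_mem_disk φ, h⟩).continuousWithinAt.tendsto.comp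
    (tendsto_nhdsWithin_iff.2 ⟨?_, ?_⟩)
  · have : Continuous fun R : ℝ => (R : ℂ) * bpt φ := by fun_prop
    have h1 := this.tendsto 1
    rw [Complex.ofReal_one, one_mul] at h1
    exact h1.mono_left nhdsWithin_le_nhds
  · filter_upwards [Ioo_mem_nhdsLT (zero_lt_one' ℝ)] with R hR
    exact ball_subset_punctured s (rpt_mem_ball ⟨hR.1.le, hR.2⟩ φ)

/-- In Green's boundary integral `f` is singular at `s` and the slice at `t`, so the circle is cut
at a point `m` between them. Up to `m` the integral converges as it stands. After `m` integration by
parts trades the singular slice at `t` for its primitive `g` and leaves the slice at `s`, which is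
regular there. On the boundary circle the slices vanish tangentially off `∂₁`, so only the integral
over `∂₁` and the values of `f g` at the cuts survive. -/
theorem zetaHat_eq_of_lt (hζ : IsPropagator L ζ) {s t : ℝ}
    (hs : s ∈ Ioo (L.θ 1) (L.θ 0 + 2 * Real.pi)) (ht : t ∈ Ioo (L.θ 1) (L.θ 0 + 2 * Real.pi))
    (hst : s < t) : zetaHat ζ s t = bdryPair L ζ s t + 1 := by
  have h01 : L.θ 0 < L.θ 1 := L.θ_lt (by decide)
  obtain ⟨f, hf, hf1, hf2, hf3⟩ := hζ.exists_normalized_primitive hs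
  obtain ⟨g, hg, hg1, hg2, hg3⟩ := hζ.exists_normalized_primitive ht
  obtain ⟨M, hM⟩ := hζ.exists_bound_normalized hs hf1 hf2 hf3
  obtain ⟨N, hN⟩ := hζ.exists_bound_normalized ht hg1 hg2 hg3
  set e := L.θ 0 + 2 * Real.pi with he
  obtain ⟨m, hsm, hmt⟩ := exists_between hst
  have hme : m ≤ e := hmt.le.trans ht.2.le
  have h1m : L.θ 1 ≤ m := hs.1.le.trans hsm.le
  have lim1 := hζ.tendsto_boundary_integral (t := t) hf (x := L.θ 0) (y := m) (h01.le.trans h1m)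
    (fun φ hφ => L3.bpt_ne ht ⟨hφ.1, hφ.2.trans hme⟩ (by linarith [hφ.2])) (M := M)
    (fun φ hφ => hM φ ⟨hφ.1, hφ.2.trans hme⟩)
  have lim2 := hζ.tendsto_boundary_integral (t := s) hg (x := m) (y := e) hme
    (fun φ hφ => L3.bpt_ne hs ⟨h01.le.trans (h1m.trans hφ.1), hφ.2⟩ (by linarith [hφ.1])) (M := N)
    (fun φ hφ => hN φ ⟨h01.le.trans (h1m.trans hφ.1), hφ.2⟩)
  have v1 : ∫ φ in (L.θ 0)..m, f (bpt φ) * slice ζ (bpt t) (bpt φ) (btan φ) =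
      bdryPair L ζ s t := by
    simp only [slice_bpt_btan]
    have z : EqOn (fun φ => f (bpt φ) * bdryU ζ t φ) (fun _ => 0) (uIcc (L.θ 1) m) := by
      intro φ hφ
      rw [uIcc_of_le h1m] at hφ
      simp only
      rw [hζ.bdryU_eq_zero ht ⟨hφ.1, hφ.2.trans hme⟩ (by linarith [hφ.2]), mul_zero]
    have hi : IntervalIntegrable (fun φ => f (bpt φ) * bdryU ζ t φ) volume (L.θ 0) (L.θ 1) := by
      have hc : ContinuousOn (fun φ => f (bpt φ)) (Icc (L.θ 0) (L.θ 1)) := fun φ hφ =>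
        (hasDerivAt_of_normalized hs hf hφ).continuousAt.continuousWithinAt
      exact (hc.mul (hζ.continuousOn_bdryU ht)).intervalIntegrable_of_Icc h01.le
    rw [← intervalIntegral.integral_add_adjacent_intervals hi
      ((intervalIntegrable_congr fun x hx => z (uIoc_subset_uIcc hx)).2
        (intervalIntegrable_const (c := (0 : ℝ)))),
      intervalIntegral.integral_congr z, intervalIntegral.integral_zero, add_zero]
    refine intervalIntegral.integral_congr fun u hu => ?_
    rw [uIcc_of_le h01.le] at hu
    simp only [hf1 u hu]
  have v2 : ∫ φ in m..e, g (bpt φ) * slice ζ (bpt s) (bpt φ) (btan φ) = 0 := by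
    rw [intervalIntegral.integral_congr (g := fun _ => 0), intervalIntegral.integral_zero]
    intro φ hφ
    rw [uIcc_of_le hme] at hφ
    simp only [slice_bpt_btan]
    rw [hζ.bdryU_eq_zero hs ⟨h1m.trans hφ.1, hφ.2⟩ (by linarith [hφ.1]), mul_zero]
  rw [v1] at lim1
  rw [v2] at lim2
  have hne : ∀ {r : ℝ}, r ∈ Ioo (L.θ 1) e → ∀ φ ∈ Icc (L.θ 1) e, φ ≠ r → bpt φ ≠ bpt r :=
    fun hr φ hφ h => L3.bpt_ne hr ⟨h01.le.trans hφ.1, hφ.2⟩ h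
  have hm : m ∈ Icc (L.θ 1) e := ⟨h1m, hme⟩
  have he' : e ∈ Icc (L.θ 1) e := ⟨h1m.trans hme, le_rfl⟩
  have b1 := tendsto_rpt_of_ne hf (hne hs m hm hsm.ne')
  have b2 := tendsto_rpt_of_ne hf (hne hs e he' hs.2.ne')
  have b3 := tendsto_rpt_of_ne hg (hne ht m hm hmt.ne)
  have b4 := tendsto_rpt_of_ne hg (hne ht e he' ht.2.ne')
  rw [hf3 m ⟨hsm, hme⟩] at b1
  rw [hf3 e ⟨hs.2, le_rfl⟩] at b2
  rw [hg2 m ⟨h1m, hmt⟩] at b3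
  rw [hg3 e ⟨ht.2, le_rfl⟩] at b4
  -- At the end of the turn both primitives are `-1`, at `m` the second one is `0`: the product
  -- contributes `1`.
  have key := (lim1.add (((b2.mul b4).sub (b1.mul b3)).sub lim2))
  refine tendsto_nhds_unique (hζ.tendsto_green
    (hne ht s ⟨hs.1.le, hs.2.le⟩ hst.ne) hf (L.θ 0)) ?_
  refine (key.congr' ?_).trans_eq (by norm_num)
  filter_upwards [Ioo_mem_nhdsLT (zero_lt_one' ℝ)] with R hR
  rw [← he, ← intervalIntegral.integral_add_adjacent_intervals
    (hζ.intervalIntegrable_rpt hf hR (L.θ 0) m) (hζ.intervalIntegrable_rpt hf hR m e)]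
  congr 1
  have hcs : ∀ r, IntervalIntegrable (fun φ => R * slice ζ (bpt r) (R * bpt φ) (btan φ))
      volume m e := fun r => by
    have hm : ∀ φ : ℝ, (R : ℂ) * bpt φ ∈ Metric.ball (0 : ℂ) 1 := rpt_mem_ball ⟨hR.1.le, hR.2⟩
    have hc : Continuous fun φ : ℝ => (R : ℂ) * bpt φ := continuous_const.mul continuous_bpt
    exact (continuous_const.mul (((hζ.continuousOn_slice_ball r).comp_continuous hc
      hm).clm_apply continuous_btan)).intervalIntegrable _ _
  rw [intervalIntegral.integral_mul_deriv_eq_deriv_mul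
    (fun φ _ => hasDerivAt_rpt hf hR φ) (fun φ _ => hasDerivAt_rpt hg hR φ) (hcs s) (hcs t)]
  simp only [mul_comm]

/-- The order `t < s` follows from antisymmetry of `zetaHat`, with the constant absorbed by
`bdryPair_add_swap`. -/
theorem zetaHat_eq_bdryPair (hζ : IsPropagator L ζ) {s t : ℝ}
    (hs : s ∈ Ioo (L.θ 1) (L.θ 0 + 2 * Real.pi)) (ht : t ∈ Ioo (L.θ 1) (L.θ 0 + 2 * Real.pi))
    (hst : s ≠ t) : zetaHat ζ s t = bdryPair L ζ s t + if s < t then 1 else 0 := by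
  rcases hst.lt_or_gt with h | h
  · rw [if_pos h, hζ.zetaHat_eq_of_lt hs ht h]
  · rw [if_neg h.not_gt, add_zero, zetaHat_swap, hζ.zetaHat_eq_of_lt ht hs h]
    linarith [hζ.bdryPair_add_swap hs ht]

end IsPropagator


end

section

open Filter Topology

variable {L : L3} {ζ : ℂ × ℂ → (ℂ × ℂ →L[ℝ] ℝ)}

/-! ### The kernels on the boundary -/

namespace L3

/-- Half of the smaller distance between `∂₁` and `∂₂`. -/
def gap (L : L3) : ℝ := min (L.θ 2 - L.θ 1) (L.θ 0 + 2 * Real.pi - L.θ 5) / 2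

/-- An open interval around `∂₁`. -/
def nbhdX (L : L3) : Set ℝ := Ioo (L.θ 0 - L.gap) (L.θ 1 + L.gap)

/-- An open interval around `∂₂`. -/
def nbhdE (L : L3) : Set ℝ := Ioo (L.θ 1 + L.gap) (L.θ 0 + 2 * Real.pi - L.gap)

theorem gap_pos (L : L3) : 0 < L.gap := by
  have h1 : L.θ 1 < L.θ 2 := L.θ_lt (by decide)
  have h2 := L.lt_period
  exact half_pos (lt_min (by linarith) (by linarith))

theorem gap_lt_left (L : L3) : L.θ 1 + L.gap < L.θ 2 := by
  have h1 : L.θ 1 < L.θ 2 := L.θ_lt (by decide)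
  have : L.gap ≤ (L.θ 2 - L.θ 1) / 2 := by
    rw [gap]; gcongr; exact min_le_left _ _
  linarith

theorem gap_lt_right (L : L3) : L.θ 5 < L.θ 0 + 2 * Real.pi - L.gap := by
  have h1 := L.lt_period
  have : L.gap ≤ (L.θ 0 + 2 * Real.pi - L.θ 5) / 2 := by
    rw [gap]; gcongr; exact min_le_right _ _
  linarith

theorem Icc_subset_nbhdX (L : L3) : Icc (L.θ 0) (L.θ 1) ⊆ L.nbhdX := fun u hu => by
  have := L.gap_pos
  exact ⟨by linarith [hu.1], by linarith [hu.2]⟩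

theorem nbhdE_subset (L : L3) : L.nbhdE ⊆ Ioo (L.θ 1) (L.θ 0 + 2 * Real.pi) := fun u hu => by
  have := L.gap_pos
  exact ⟨by linarith [hu.1], by linarith [hu.2]⟩

theorem isOpen_nbhdX (L : L3) : IsOpen L.nbhdX := isOpen_Ioo

theorem isOpen_nbhdE (L : L3) : IsOpen L.nbhdE := isOpen_Ioo

theorem convex_nbhdX (L : L3) : Convex ℝ L.nbhdX := convex_Ioo _ _

theorem convex_nbhdE (L : L3) : Convex ℝ L.nbhdE := convex_Ioo _ _

theorem lo_lt_hi (L : L3) (k : Fin 2) : L.lo k < L.hi k := by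
  fin_cases k
  · exact L.θ_lt (by decide)
  · exact L.θ_lt (by decide)

theorem Icc_subset_nbhdE (L : L3) (k : Fin 2) : Icc (L.lo k) (L.hi k) ⊆ L.nbhdE := by
  have h1 := L.gap_lt_left
  have h2 := L.gap_lt_right
  have h3 : L.θ 2 < L.θ 3 := L.θ_lt (by decide)
  have h4 : L.θ 3 < L.θ 4 := L.θ_lt (by decide)
  have h5 : L.θ 4 < L.θ 5 := L.θ_lt (by decide)
  intro u hu
  fin_cases k
  · have hu' : L.θ 2 ≤ u ∧ u ≤ L.θ 3 := hu
    exact ⟨by linarith [hu'.1], by linarith [hu'.2]⟩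
  · have hu' : L.θ 4 ≤ u ∧ u ≤ L.θ 5 := hu
    exact ⟨by linarith [hu'.1], by linarith [hu'.2]⟩

theorem mem_conf {v u : ℝ} (hv : v ∈ L.nbhdE) (hu : u ∈ L.nbhdX) : (bpt u, bpt v) ∈ conf := by
  refine ⟨bpt_mem_disk u, bpt_mem_disk v, bpt_ne_bpt ?_ ?_⟩
  · linarith [hv.1, hu.2]
  · rw [abs_lt]
    constructor <;> linarith [hv.1, hu.2, hv.2, hu.1]

end L3

/-- The kernel on `∂₂ × ∂₁` along `∂₁`. -/
def kerU (ζ : ℂ × ℂ → (ℂ × ℂ →L[ℝ] ℝ)) (p : ℝ × ℝ) : ℂ := (bdryU ζ p.1 p.2 : ℂ)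

/-- The kernel on `∂₂ × ∂₁` along `∂₂`. -/
def kerV (ζ : ℂ × ℂ → (ℂ × ℂ →L[ℝ] ℝ)) (p : ℝ × ℝ) : ℂ := (bdryV ζ p.1 p.2 : ℂ)

/-- The common derivative of the two kernels on `∂₂ × ∂₁`. -/
def kerD (ζ : ℂ × ℂ → (ℂ × ℂ →L[ℝ] ℝ)) (p : ℝ × ℝ) : ℂ :=
  (fderivWithin ℝ ζ conf (bpt p.2, bpt p.1) (0, btan p.1) (btan p.2, 0) : ℝ)

/-- The smooth part of the kernel on `∂₂ × ∂₂`. -/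
def kerQ (L : L3) (ζ : ℂ × ℂ → (ℂ × ℂ →L[ℝ] ℝ)) (p : ℝ × ℝ) : ℂ := (bdryPair L ζ p.1 p.2 : ℂ)

namespace IsPropagator

theorem contDiffOn_bdry (hζ : IsPropagator L ζ) :
    ContDiffOn ℝ ∞ (fun p : ℝ × ℝ => ζ (bpt p.2, bpt p.1)) (L.nbhdE ×ˢ L.nbhdX) :=
  hζ.smooth.comp (f := fun p : ℝ × ℝ => (bpt p.2, bpt p.1))
    ((contDiff_bpt.comp contDiff_snd).prodMk (contDiff_bpt.comp contDiff_fst)).contDiffOn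
    fun _ hp => L3.mem_conf hp.1 hp.2

theorem contDiffOn_bdryU (hζ : IsPropagator L ζ) :
    ContDiffOn ℝ ∞ (fun p : ℝ × ℝ => bdryU ζ p.1 p.2) (L.nbhdE ×ˢ L.nbhdX) :=
  hζ.contDiffOn_bdry.clm_apply
    ((contDiff_btan.comp contDiff_snd).prodMk contDiff_const).contDiffOn

theorem contDiffOn_bdryV (hζ : IsPropagator L ζ) :
    ContDiffOn ℝ ∞ (fun p : ℝ × ℝ => bdryV ζ p.1 p.2) (L.nbhdE ×ˢ L.nbhdX) :=
  hζ.contDiffOn_bdry.clm_apply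
    (contDiff_const.prodMk (contDiff_btan.comp contDiff_fst)).contDiffOn

theorem contDiffOn_kerU (hζ : IsPropagator L ζ) :
    ContDiffOn ℝ ∞ (kerU ζ) (L.nbhdE ×ˢ L.nbhdX) :=
  Complex.ofRealCLM.contDiff.comp_contDiffOn hζ.contDiffOn_bdryU

theorem contDiffOn_kerV (hζ : IsPropagator L ζ) :
    ContDiffOn ℝ ∞ (kerV ζ) (L.nbhdE ×ˢ L.nbhdX) :=
  Complex.ofRealCLM.contDiff.comp_contDiffOn hζ.contDiffOn_bdryV

theorem hasDerivAt_snd (hζ : IsPropagator L ζ) {u v : ℝ} (h : (bpt u, bpt v) ∈ conf) (w : ℂ × ℂ) :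
    HasDerivAt (fun v => ζ (bpt u, bpt v) w)
      (fderivWithin ℝ ζ conf (bpt u, bpt v) (0, btan v) w) v := by
  have h2 : HasDerivAt (fun v => (bpt u, bpt v)) ((0 : ℂ), btan v) v :=
    (hasDerivAt_const v (bpt u)).prodMk (hasDerivAt_bpt v)
  have h3 : ∀ᶠ v' in 𝓝 v, (bpt u, bpt v') ∈ conf := by
    have h4 : IsOpen {v' : ℝ | bpt u ≠ bpt v'} := isOpen_ne_fun continuous_const continuous_bpt
    filter_upwards [h4.mem_nhds h.2.2] with v' hv'
    exact ⟨bpt_mem_disk u, bpt_mem_disk v', hv'⟩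
  have h5 : HasDerivAt (fun v => ζ (bpt u, bpt v))
      (fderivWithin ℝ ζ conf (bpt u, bpt v) (0, btan v)) v :=
    (hζ.hasFDerivWithinAt h).comp_hasDerivAt v h2 h3
  have h6 := h5.clm_apply (hasDerivAt_const v w)
  rwa [map_zero, add_zero] at h6

theorem hasDerivAt_kerU (hζ : IsPropagator L ζ) {v u : ℝ} (hv : v ∈ L.nbhdE) (hu : u ∈ L.nbhdX) :
    HasDerivAt (fun v => kerU ζ (v, u)) (kerD ζ (v, u)) v :=
  (hζ.hasDerivAt_snd (L3.mem_conf hv hu) (btan u, 0)).ofReal_comp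

theorem hasDerivAt_kerV (hζ : IsPropagator L ζ) {v u : ℝ} (hv : v ∈ L.nbhdE) (hu : u ∈ L.nbhdX) :
    HasDerivAt (fun u => kerV ζ (v, u)) (kerD ζ (v, u)) u := by
  have h := hζ.hasDerivAt_fst (bpt_mem_disk v) (L3.mem_conf hv hu).2.2 (0, btan v)
  rw [hζ.closed _ (L3.mem_conf hv hu)] at h
  exact h.ofReal_comp

/-- The ends of `∂₁` also belong to the complementary arc, the first one after a full turn, and
there all components in the direction of the second point vanish. -/
theorem kerV_eq_zero (hζ : IsPropagator L ζ) {v u : ℝ} (hv : v ∈ L.nbhdE)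
    (hu : u = L.θ 0 ∨ u = L.θ 1) : kerV ζ (v, u) = 0 := by
  have h01 : L.θ 0 < L.θ 1 := L.θ_lt (by decide)
  have hpi := Real.pi_pos
  have h1 : u ∈ Icc (L.θ 0) (L.θ 1) := by rcases hu with rfl | rfl <;> constructor <;> linarith
  have h2 : ∃ u', bpt u' = bpt u ∧ u' ∈ L.arcB := by
    have hL := L.nbhdE_subset hv
    rcases hu with rfl | rfl
    · exact ⟨_, bpt_periodic _, by linarith [hL.1, hL.2], le_rfl⟩
    · exact ⟨_, rfl, le_rfl, by linarith [hL.1, hL.2]⟩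
  obtain ⟨u', e, hu'⟩ := h2
  have hne := (L3.mem_conf hv (L.Icc_subset_nbhdX h1)).2.2
  simp only [kerV, bdryV]
  rw [← e] at hne ⊢
  rw [hζ.zeta_boundary_eta hu' (bpt_mem_disk v) hne, Complex.ofReal_zero]

theorem integral_kerU (hζ : IsPropagator L ζ) {v : ℝ} (hv : v ∈ L.nbhdE) :
    ∫ u in (L.θ 0)..(L.θ 1), kerU ζ (v, u) = 1 := by
  simp only [kerU]
  rw [intervalIntegral.integral_ofReal]
  have : ∫ u in (L.θ 0)..(L.θ 1), bdryU ζ v u = 1 := hζ.integral_boundary (L.nbhdE_subset hv)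
  rw [this, Complex.ofReal_one]

/-- The pulled back propagator as a one-form on `∂₂ × ∂₁`. -/
def _root_.PSM.bdryForm (ζ : ℂ × ℂ → (ℂ × ℂ →L[ℝ] ℝ)) (p : ℝ × ℝ) : ℝ × ℝ →L[ℝ] ℝ :=
  bdryV ζ p.1 p.2 • ContinuousLinearMap.fst ℝ ℝ ℝ
    + bdryU ζ p.1 p.2 • ContinuousLinearMap.snd ℝ ℝ ℝ

/-- Both mixed partial derivatives are `kerD`, by closedness of the propagator tested on a tangent
vector of `∂₂` and one of `∂₁`. -/
theorem bdryForm_closed (hζ : IsPropagator L ζ) : ∀ p ∈ L.nbhdE ×ˢ L.nbhdX, ∀ x y,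
    fderivWithin ℝ (bdryForm ζ) (L.nbhdE ×ˢ L.nbhdX) p x y =
      fderivWithin ℝ (bdryForm ζ) (L.nbhdE ×ˢ L.nbhdX) p y x := by
  intro p hp x y
  have hop : IsOpen (L.nbhdE ×ˢ L.nbhdX) := L.isOpen_nbhdE.prod L.isOpen_nbhdX
  have hU := ((hζ.contDiffOn_bdryU.contDiffAt (hop.mem_nhds hp)).differentiableAt
    (by simp)).hasFDerivAt
  have hV := ((hζ.contDiffOn_bdryV.contDiffAt (hop.mem_nhds hp)).differentiableAt
    (by simp)).hasFDerivAt
  set U' := fderiv ℝ (fun p : ℝ × ℝ => bdryU ζ p.1 p.2) p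
  set V' := fderiv ℝ (fun p : ℝ × ℝ => bdryV ζ p.1 p.2) p
  have e : U' (1, 0) = V' (0, 1) := by
    have h1 := hU.comp_hasDerivAt p.1 ((hasDerivAt_id p.1).prodMk (hasDerivAt_const p.1 p.2))
    have h2 := hV.comp_hasDerivAt p.2 ((hasDerivAt_const p.2 p.1).prodMk (hasDerivAt_id p.2))
    have h3 := h1.ofReal_comp.unique (hζ.hasDerivAt_kerU hp.1 hp.2)
    have h4 := h2.ofReal_comp.unique (hζ.hasDerivAt_kerV hp.1 hp.2)
    exact Complex.ofReal_injective (h3.trans h4.symm)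
  have hF : HasFDerivAt (bdryForm ζ) (V'.smulRight (ContinuousLinearMap.fst ℝ ℝ ℝ)
      + U'.smulRight (ContinuousLinearMap.snd ℝ ℝ ℝ)) p :=
    (hV.smul_const (ContinuousLinearMap.fst ℝ ℝ ℝ)).add
      (hU.smul_const (ContinuousLinearMap.snd ℝ ℝ ℝ))
  rw [fderivWithin_of_isOpen hop hp, hF.fderiv]
  have hdec : ∀ z : ℝ × ℝ, z = z.1 • ((1, 0) : ℝ × ℝ) + z.2 • ((0, 1) : ℝ × ℝ) := fun z => by simp
  have hUx : ∀ z, U' z = z.1 * U' (1, 0) + z.2 * U' (0, 1) := fun z => by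
    conv_lhs => rw [hdec z, map_add, map_smul, map_smul, smul_eq_mul, smul_eq_mul]
  have hVx : ∀ z, V' z = z.1 * V' (1, 0) + z.2 * V' (0, 1) := fun z => by
    conv_lhs => rw [hdec z, map_add, map_smul, map_smul, smul_eq_mul, smul_eq_mul]
  simp only [add_apply, ContinuousLinearMap.smulRight_apply,
    smul_apply, ContinuousLinearMap.coe_fst', ContinuousLinearMap.coe_snd',
    smul_eq_mul]
  rw [hUx x, hVx x, hUx y, hVx y, e]
  ring

/-- The primitive along `∂₁` is smooth in both variables, and its derivative along `∂₂` is the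
kernel along `∂₂`. -/
theorem bdryPrim_spec (hζ : IsPropagator L ζ) :
    ∃ F : ℝ × ℝ → ℝ, ContDiffOn ℝ ∞ F (L.nbhdE ×ˢ L.nbhdX) ∧
      (∀ v ∈ L.nbhdE, ∀ u ∈ Icc (L.θ 0) (L.θ 1), bdryPrim L ζ v u = F (v, u)) ∧
      ∀ v ∈ L.nbhdE, ∀ u ∈ L.nbhdX, HasDerivAt (fun v => F (v, u)) (bdryV ζ v u) v := by
  have h01 : L.θ 0 < L.θ 1 := L.θ_lt (by decide)
  have hop : IsOpen (L.nbhdE ×ˢ L.nbhdX) := L.isOpen_nbhdE.prod L.isOpen_nbhdX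
  set ϖ : ℝ × ℝ → ℝ × ℝ →L[ℝ] ℝ := bdryForm ζ with hϖ
  have hs : ContDiffOn ℝ ∞ ϖ (L.nbhdE ×ˢ L.nbhdX) :=
    (hζ.contDiffOn_bdryV.smul contDiffOn_const).add (hζ.contDiffOn_bdryU.smul contDiffOn_const)
  obtain ⟨F, hF, hF'⟩ := exists_primitive (L.convex_nbhdE.prod L.convex_nbhdX)
    hop.uniqueDiffOn hs hζ.bdryForm_closed
  have hFd : ∀ p ∈ L.nbhdE ×ˢ L.nbhdX, HasFDerivAt F (ϖ p) p := fun p hp =>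
    (hF' p hp).hasFDerivAt (hop.mem_nhds hp)
  have hFv : ∀ v ∈ L.nbhdE, ∀ u ∈ L.nbhdX, HasDerivAt (fun v => F (v, u)) (bdryV ζ v u) v := by
    intro v hv u hu
    have := (hFd (v, u) ⟨hv, hu⟩).comp_hasDerivAt v
      ((hasDerivAt_id v).prodMk (hasDerivAt_const v u))
    exact this.congr_deriv (by simp [hϖ, bdryForm])
  have hFu : ∀ v ∈ L.nbhdE, ∀ u ∈ L.nbhdX, HasDerivAt (fun u => F (v, u)) (bdryU ζ v u) u := by
    intro v hv u hu
    have := (hFd (v, u) ⟨hv, hu⟩).comp_hasDerivAt u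
      ((hasDerivAt_const u v).prodMk (hasDerivAt_id u))
    exact this.congr_deriv (by simp [hϖ, bdryForm])
  have h1m : L.θ 1 ∈ Icc (L.θ 0) (L.θ 1) := ⟨h01.le, le_rfl⟩
  -- At the last end of `∂₁` the component along `∂₂` vanishes, so the primitive is constant in `v`
  -- there. It therefore differs from `bdryPrim` by one constant for all `v`.
  have hconst : ∀ v ∈ L.nbhdE, ∀ w ∈ L.nbhdE, F (v, L.θ 1) = F (w, L.θ 1) := by
    intro v hv w hw
    refine L.isOpen_nbhdE.is_const_of_deriv_eq_zero (f := fun v => F (v, L.θ 1))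
      L.convex_nbhdE.isPreconnected (fun x hx => ((hFv x hx _
        (L.Icc_subset_nbhdX h1m)).differentiableAt.differentiableWithinAt)) (fun x hx => ?_) hv hw
    rw [(hFv x hx _ (L.Icc_subset_nbhdX h1m)).deriv]
    simpa [kerV] using hζ.kerV_eq_zero hx (Or.inr rfl)
  have hne : L.θ 2 ∈ L.nbhdE := L.Icc_subset_nbhdE 0 ⟨le_rfl, (L.lo_lt_hi 0).le⟩
  refine ⟨fun p => F p - F (L.θ 2, L.θ 1), hF.sub contDiffOn_const, fun v hv u hu => ?_,
    fun v hv u hu => (hFv v hv u hu).sub_const _⟩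
  rw [bdryPrim, intervalIntegral.integral_eq_sub_of_hasDerivAt (f := fun u => F (v, u))]
  · simp only [hconst _ hne v hv]
    ring
  · intro x hx
    rw [uIcc_of_le hu.2] at hx
    exact hFu v hv x (L.Icc_subset_nbhdX ⟨hu.1.trans hx.1, hx.2⟩)
  · exact ((hζ.continuousOn_bdryU (L.nbhdE_subset hv)).mono
      (Icc_subset_Icc_left hu.1)).intervalIntegrable_of_Icc hu.2

/-- Once `bdryPrim` is replaced by a primitive that is smooth in both variables, this is an integral
over `∂₁` of a smooth kernel. Nothing happens on the diagonal: the jump of `zetaHat` is entirely in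
the step function. -/
theorem contDiffOn_kerQ (hζ : IsPropagator L ζ) :
    ContDiffOn ℝ ∞ (kerQ L ζ) (L.nbhdE ×ˢ L.nbhdE) := by
  have h01 : L.θ 0 < L.θ 1 := L.θ_lt (by decide)
  obtain ⟨F, hF, hF1, hF2⟩ := hζ.bdryPrim_spec
  have hk : ContDiffOn ℝ ∞ (fun q : (ℝ × ℝ) × ℝ => (F (q.1.1, q.2) : ℂ) * kerU ζ (q.1.2, q.2))
      ((L.nbhdE ×ˢ L.nbhdE) ×ˢ L.nbhdX) := by
    refine ContDiffOn.mul ?_ ?_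
    · exact Complex.ofRealCLM.contDiff.comp_contDiffOn
        (hF.comp (f := fun q : (ℝ × ℝ) × ℝ => (q.1.1, q.2)) (by fun_prop)
          fun q hq => ⟨hq.1.1, hq.2⟩)
    · exact hζ.contDiffOn_kerU.comp (f := fun q : (ℝ × ℝ) × ℝ => (q.1.2, q.2)) (by fun_prop)
        fun q hq => ⟨hq.1.2, hq.2⟩
  refine (contDiffOn_kernel_integral (L.convex_nbhdE.prod L.convex_nbhdE)
    (L.isOpen_nbhdE.prod L.isOpen_nbhdE) L.isOpen_nbhdX h01.le L.Icc_subset_nbhdX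
    (φ := fun _ => 1) continuousOn_const hk).congr fun p hp => ?_
  simp only [kerQ, bdryPair]
  rw [← intervalIntegral.integral_ofReal]
  refine intervalIntegral.integral_congr fun u hu => ?_
  rw [uIcc_of_le h01.le] at hu
  simp only [hF1 p.1 hp.1 u hu, kerU, one_mul, Complex.ofReal_mul]

theorem hasDerivAt_kerQ (hζ : IsPropagator L ζ) {v w : ℝ} (hv : v ∈ L.nbhdE) (hw : w ∈ L.nbhdE) :
    HasDerivAt (fun v => kerQ L ζ (v, w))
      (∫ u in (L.θ 0)..(L.θ 1), kerV ζ (v, u) * kerU ζ (w, u)) v := by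
  have h01 : L.θ 0 < L.θ 1 := L.θ_lt (by decide)
  obtain ⟨F, hF, hF1, hF2⟩ := hζ.bdryPrim_spec
  have h := hasDerivAt_kernel_integral L.convex_nbhdE L.isOpen_nbhdE h01.le L.Icc_subset_nbhdX
    (φ := fun u => kerU ζ (w, u)) (k := fun p => (F p : ℂ)) (k' := kerV ζ)
    (hζ.contDiffOn_kerU.continuousOn.comp (f := fun u => (w, u)) (by fun_prop)
      fun u hu => ⟨hw, L.Icc_subset_nbhdX hu⟩)
    (Complex.continuous_ofReal.comp_continuousOn hF.continuousOn)
    hζ.contDiffOn_kerV.continuousOn (fun x hx u hu => (hF2 x hx u hu).ofReal_comp) hv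
  have e : ∫ u in (L.θ 0)..(L.θ 1), kerV ζ (v, u) * kerU ζ (w, u) =
      ∫ u in (L.θ 0)..(L.θ 1), kerU ζ (w, u) * kerV ζ (v, u) := by simp only [mul_comm]
  rw [e]
  refine h.congr_of_eventuallyEq ?_
  filter_upwards [L.isOpen_nbhdE.mem_nhds hv] with x hx
  simp only [kerQ, bdryPair]
  rw [← intervalIntegral.integral_ofReal]
  refine intervalIntegral.integral_congr fun u hu => ?_
  rw [uIcc_of_le h01.le] at hu
  simp only [hF1 x hx u hu, kerU, Complex.ofReal_mul, mul_comm]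

theorem zetaHat_eq_kerQ (hζ : IsPropagator L ζ) {v w : ℝ} (hv : v ∈ L.nbhdE) (hw : w ∈ L.nbhdE)
    (h : v ≠ w) : (zetaHat ζ v w : ℂ) = kerQ L ζ (v, w) + if v < w then 1 else 0 := by
  rw [hζ.zetaHat_eq_bdryPair (L.nbhdE_subset hv) (L.nbhdE_subset hw) h, Complex.ofReal_add, kerQ]
  split_ifs <;> simp

end IsPropagator


end

section

/-! ### Integral operators with kernels -/

/-- Kernels on `[a, b] × [c, d]` whose integral operators, in both directions, preserve smoothness
and satisfy Fubini's theorem. -/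
structure IsKernel (κ : ℝ → ℝ → ℂ) (a b c d : ℝ) : Prop where
  lt_fst : a < b
  lt_snd : c < d
  int_snd : ∀ φ, ContDiffOn ℝ ∞ φ (Icc c d) → ∀ v ∈ Icc a b,
    IntervalIntegrable (fun u => κ v u * φ u) volume c d
  int_fst : ∀ φ, ContDiffOn ℝ ∞ φ (Icc a b) → ∀ u ∈ Icc c d,
    IntervalIntegrable (fun v => κ v u * φ v) volume a b
  smooth_snd : ∀ φ, ContDiffOn ℝ ∞ φ (Icc c d) →
    ContDiffOn ℝ ∞ (fun v => ∫ u in c..d, κ v u * φ u) (Icc a b)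
  smooth_fst : ∀ φ, ContDiffOn ℝ ∞ φ (Icc a b) →
    ContDiffOn ℝ ∞ (fun u => ∫ v in a..b, κ v u * φ v) (Icc c d)
  fubini : ∀ ψ, ContDiffOn ℝ ∞ ψ (Icc a b) → ∀ φ, ContDiffOn ℝ ∞ φ (Icc c d) →
    ∫ v in a..b, ψ v * ∫ u in c..d, κ v u * φ u = ∫ u in c..d, (∫ v in a..b, κ v u * ψ v) * φ u

namespace IsKernel

variable {κ κ' : ℝ → ℝ → ℂ} {a b c d : ℝ}

theorem swap (h : IsKernel κ a b c d) : IsKernel (fun u v => κ v u) c d a b where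
  lt_fst := h.lt_snd
  lt_snd := h.lt_fst
  int_snd := h.int_fst
  int_fst := h.int_snd
  smooth_snd := h.smooth_fst
  smooth_fst := h.smooth_snd
  fubini ψ hψ φ hφ := by
    have := h.fubini φ hφ ψ hψ
    simp only [mul_comm _ (φ _), mul_comm _ (ψ _)] at this ⊢
    exact this.symm

theorem integral_congr_off_diag (hcd : c ≤ d) {v : ℝ} (h : ∀ u ∈ Icc c d, v ≠ u → κ' v u = κ v u)
    (φ : ℝ → ℂ) :
    (IntervalIntegrable (fun u => κ v u * φ u) volume c d →
      IntervalIntegrable (fun u => κ' v u * φ u) volume c d) ∧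
    ∫ u in c..d, κ' v u * φ u = ∫ u in c..d, κ v u * φ u := by
  have hae : ∀ᵐ u : ℝ, u ∈ Set.uIoc c d → κ v u * φ u = κ' v u * φ u := by
    have : ∀ᵐ u : ℝ, u ≠ v := by simp [ae_iff]
    filter_upwards [this] with u hu hmem
    rw [uIoc_of_le hcd] at hmem
    rw [h u ⟨hmem.1.le, hmem.2⟩ hu.symm]
  exact ⟨fun hi => hi.congr_ae ((ae_restrict_iff' measurableSet_uIoc).2 hae),
    (intervalIntegral.integral_congr_ae hae).symm⟩

/-- The values of a kernel on the diagonal do not matter. -/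
theorem congr_off_diag (h : IsKernel κ a b c d)
    (e : ∀ v ∈ Icc a b, ∀ u ∈ Icc c d, v ≠ u → κ' v u = κ v u) : IsKernel κ' a b c d := by
  have e1 : ∀ v ∈ Icc a b, ∀ φ : ℝ → ℂ, _ := fun v hv φ =>
    integral_congr_off_diag h.lt_snd.le (e v hv) φ
  have e2 : ∀ u ∈ Icc c d, ∀ φ : ℝ → ℂ, _ := fun u hu φ =>
    integral_congr_off_diag (κ := fun u v => κ v u) (κ' := fun u v => κ' v u) h.lt_fst.le
      (v := u) (fun v hv huv => e v hv u hu huv.symm) φ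
  refine ⟨h.lt_fst, h.lt_snd, fun φ hφ v hv => (e1 v hv φ).1 (h.int_snd φ hφ v hv),
    fun φ hφ u hu => (e2 u hu φ).1 (h.int_fst φ hφ u hu),
    fun φ hφ => (h.smooth_snd φ hφ).congr fun v hv => (e1 v hv φ).2,
    fun φ hφ => (h.smooth_fst φ hφ).congr fun u hu => (e2 u hu φ).2, fun ψ hψ φ hφ => ?_⟩
  rw [intervalIntegral.integral_congr (g := fun v => ψ v * ∫ u in c..d, κ v u * φ u),
    h.fubini ψ hψ φ hφ]
  · refine intervalIntegral.integral_congr fun u hu => ?_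
    rw [uIcc_of_le h.lt_snd.le] at hu
    rw [(e2 u hu ψ).2]
  · intro v hv
    rw [uIcc_of_le h.lt_fst.le] at hv
    simp only
    rw [(e1 v hv φ).2]

theorem add (h : IsKernel κ a b c d) (h' : IsKernel κ' a b c d) :
    IsKernel (fun v u => κ v u + κ' v u) a b c d := by
  have e1 : ∀ φ, ContDiffOn ℝ ∞ φ (Icc c d) → ∀ v ∈ Icc a b,
      ∫ u in c..d, (κ v u + κ' v u) * φ u =
        (∫ u in c..d, κ v u * φ u) + ∫ u in c..d, κ' v u * φ u := fun φ hφ v hv => by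
    simp only [add_mul]
    exact intervalIntegral.integral_add (h.int_snd φ hφ v hv) (h'.int_snd φ hφ v hv)
  have e2 : ∀ φ, ContDiffOn ℝ ∞ φ (Icc a b) → ∀ u ∈ Icc c d,
      ∫ v in a..b, (κ v u + κ' v u) * φ v =
        (∫ v in a..b, κ v u * φ v) + ∫ v in a..b, κ' v u * φ v := fun φ hφ u hu => by
    simp only [add_mul]
    exact intervalIntegral.integral_add (h.int_fst φ hφ u hu) (h'.int_fst φ hφ u hu)
  refine ⟨h.lt_fst, h.lt_snd, fun φ hφ v hv => ?_, fun φ hφ u hu => ?_,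
    fun φ hφ => ((h.smooth_snd φ hφ).add (h'.smooth_snd φ hφ)).congr (e1 φ hφ),
    fun φ hφ => ((h.smooth_fst φ hφ).add (h'.smooth_fst φ hφ)).congr (e2 φ hφ),
    fun ψ hψ φ hφ => ?_⟩
  · simpa only [add_mul] using (h.int_snd φ hφ v hv).add (h'.int_snd φ hφ v hv)
  · simpa only [add_mul] using (h.int_fst φ hφ u hu).add (h'.int_fst φ hφ u hu)
  · have i1 : ∀ {k : ℝ → ℝ → ℂ}, IsKernel k a b c d →
        IntervalIntegrable (fun v => ψ v * ∫ u in c..d, k v u * φ u) volume a b := fun hk =>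
      (hψ.mul (hk.smooth_snd φ hφ)).continuousOn.intervalIntegrable_of_Icc hk.lt_fst.le
    have i2 : ∀ {k : ℝ → ℝ → ℂ}, IsKernel k a b c d →
        IntervalIntegrable (fun u => (∫ v in a..b, k v u * ψ v) * φ u) volume c d := fun hk =>
      ((hk.smooth_fst ψ hψ).mul hφ).continuousOn.intervalIntegrable_of_Icc hk.lt_snd.le
    rw [intervalIntegral.integral_congr (g := fun v => ψ v * (∫ u in c..d, κ v u * φ u) +
        ψ v * ∫ u in c..d, κ' v u * φ u), intervalIntegral.integral_add (i1 h) (i1 h'),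
      h.fubini ψ hψ φ hφ, h'.fubini ψ hψ φ hφ, ← intervalIntegral.integral_add (i2 h) (i2 h')]
    · refine intervalIntegral.integral_congr fun u hu => ?_
      rw [uIcc_of_le h.lt_snd.le] at hu
      rw [e2 ψ hψ u hu, add_mul]
    · intro v hv
      rw [uIcc_of_le h.lt_fst.le] at hv
      simp only
      rw [e1 φ hφ v hv, mul_add]

theorem of_contDiffOn {k : ℝ × ℝ → ℂ} {V U : Set ℝ} (hV : Convex ℝ V) (hVo : IsOpen V)
    (hU : Convex ℝ U) (hUo : IsOpen U) (hk : ContDiffOn ℝ ∞ k (V ×ˢ U)) (hab : a < b) (hcd : c < d)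
    (hI : Icc a b ⊆ V) (hJ : Icc c d ⊆ U) : IsKernel (fun v u => k (v, u)) a b c d := by
  have hk' : ContDiffOn ℝ ∞ (fun p : ℝ × ℝ => k (p.2, p.1)) (U ×ˢ V) :=
    hk.comp (f := fun p : ℝ × ℝ => (p.2, p.1)) (by fun_prop) fun p hp => ⟨hp.2, hp.1⟩
  have c1 : ∀ v ∈ Icc a b, ContinuousOn (fun u => k (v, u)) (Icc c d) := fun v hv =>
    hk.continuousOn.comp (f := fun u => (v, u)) (by fun_prop) fun u hu => ⟨hI hv, hJ hu⟩
  have c2 : ∀ u ∈ Icc c d, ContinuousOn (fun v => k (v, u)) (Icc a b) := fun u hu =>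
    hk.continuousOn.comp (f := fun v => (v, u)) (by fun_prop) fun v hv => ⟨hI hv, hJ hu⟩
  refine ⟨hab, hcd, fun φ hφ v hv => ((c1 v hv).mul hφ.continuousOn).intervalIntegrable_of_Icc
      hcd.le, fun φ hφ u hu => ((c2 u hu).mul hφ.continuousOn).intervalIntegrable_of_Icc hab.le,
    fun φ hφ => ?_, fun φ hφ => ?_, fun ψ hψ φ hφ => ?_⟩
  · simp only [mul_comm _ (φ _)]
    exact (contDiffOn_kernel_integral hV hVo hUo hcd.le hJ hφ.continuousOn hk).mono hI
  · simp only [mul_comm _ (φ _)]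
    exact (contDiffOn_kernel_integral hU hUo hVo hab.le hI hφ.continuousOn hk').mono hJ
  · have hF : ContinuousOn (Function.uncurry fun v u => ψ v * (k (v, u) * φ u))
        (Icc a b ×ˢ Icc c d) :=
      (hψ.continuousOn.comp continuousOn_fst fun p hp => hp.1).mul
        ((hk.continuousOn.mono (prod_mono hI hJ)).mul
          (hφ.continuousOn.comp continuousOn_snd fun p hp => hp.2))
    have hi : IntegrableOn (Function.uncurry fun v u => ψ v * (k (v, u) * φ u))
        (uIoc a b ×ˢ uIoc c d) := by
      rw [uIoc_of_le hab.le, uIoc_of_le hcd.le]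
      exact (hF.integrableOn_compact (isCompact_Icc.prod isCompact_Icc)).mono_set
        (prod_mono Ioc_subset_Icc_self Ioc_subset_Icc_self)
    have := intervalIntegral_intervalIntegral_swap hi
    simp only [intervalIntegral.integral_const_mul] at this
    rw [this]
    refine intervalIntegral.integral_congr fun u _ => ?_
    rw [← intervalIntegral.integral_mul_const]
    refine intervalIntegral.integral_congr fun v _ => ?_
    ring

end IsKernel

/-! ### The step kernel -/

theorem hasDerivWithinAt_integral_left {φ : ℝ → ℂ} {a b : ℝ} (hab : a < b)
    (hφ : ContinuousOn φ (Icc a b)) {v : ℝ} (hv : v ∈ Icc a b) :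
    HasDerivWithinAt (fun v => ∫ u in v..b, φ u) (-φ v) (Icc a b) v := by
  -- Extended continuously to the line, the integrand has a two-sided primitive also at the end
  -- points.
  set ψ := IccExtend hab.le (domRestrict (Icc a b) φ)
  have hψ : Continuous ψ := (continuousOn_iff_continuous_domRestrict.1 hφ).Icc_extend'
  have e : ∀ u ∈ Icc a b, ψ u = φ u := fun u hu => by simp [ψ, IccExtend_of_mem _ _ hu, domRestrict]
  have h := (hψ.integral_hasStrictDerivAt b v).hasDerivAt.neg.hasDerivWithinAt (s := Icc a b)
  rw [← e v hv]
  refine h.congr_of_mem (fun w hw => ?_) hv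
  simp only [Pi.neg_apply]
  rw [← intervalIntegral.integral_symm]
  refine intervalIntegral.integral_congr fun u hu => ?_
  rw [uIcc_of_le hw.2] at hu
  exact (e u ⟨hw.1.trans hu.1, hu.2⟩).symm

theorem hasDerivWithinAt_integral_right {φ : ℝ → ℂ} {a b : ℝ} (hab : a < b)
    (hφ : ContinuousOn φ (Icc a b)) {v : ℝ} (hv : v ∈ Icc a b) :
    HasDerivWithinAt (fun v => ∫ u in a..v, φ u) (φ v) (Icc a b) v := by
  have h := (hasDerivWithinAt_integral_left hab hφ hv).const_sub (∫ u in a..b, φ u)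
  rw [neg_neg] at h
  refine h.congr_of_mem (fun w hw => ?_) hv
  have hi : ∀ x ∈ Icc a b, ∀ y ∈ Icc a b, IntervalIntegrable φ volume x y := fun x hx y hy =>
    (hφ.mono ((ordConnected_Icc.uIcc_subset hx hy))).intervalIntegrable
  have ha : a ∈ Icc a b := ⟨le_rfl, hab.le⟩
  have hb : b ∈ Icc a b := ⟨hab.le, le_rfl⟩
  rw [← intervalIntegral.integral_add_adjacent_intervals (hi a ha w hw) (hi w hw b hb)]
  ring

theorem contDiffOn_of_hasDerivWithinAt {f f' : ℝ → ℂ} {s : Set ℝ} (hs : UniqueDiffOn ℝ s)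
    (hf' : ContDiffOn ℝ ∞ f' s) (h : ∀ x ∈ s, HasDerivWithinAt f (f' x) s x) :
    ContDiffOn ℝ ∞ f s :=
  (contDiffOn_infty_iff_derivWithin hs).2 ⟨fun x hx => (h x hx).differentiableWithinAt,
    hf'.congr fun x hx => (h x hx).derivWithin (hs x hx)⟩

/-- The kernel of the integral from the first variable on. -/
def stepKernel (v u : ℝ) : ℂ := if v < u then 1 else 0

theorem stepKernel_integral {φ : ℝ → ℂ} {a b : ℝ} (hφ : ContinuousOn φ (Icc a b))
    {v : ℝ} (hv : v ∈ Icc a b) :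
    IntervalIntegrable (fun u => stepKernel v u * φ u) volume a b ∧
      ∫ u in a..b, stepKernel v u * φ u = ∫ u in v..b, φ u := by
  have h0 : EqOn (fun _ => (0 : ℂ)) (fun u => stepKernel v u * φ u) (uIoc a v) := fun u hu => by
    rw [uIoc_of_le hv.1] at hu
    simp [stepKernel, hu.2.not_gt]
  have h1 : EqOn φ (fun u => stepKernel v u * φ u) (uIoc v b) := fun u hu => by
    rw [uIoc_of_le hv.2] at hu
    simp [stepKernel, hu.1]
  have i0 := (intervalIntegrable_congr h0).1 (intervalIntegrable_const (μ := volume))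
  have i1 := (intervalIntegrable_congr (μ := volume) h1).1
    ((hφ.mono (Icc_subset_Icc_left hv.1)).intervalIntegrable_of_Icc hv.2)
  refine ⟨i0.trans i1, ?_⟩
  rw [← intervalIntegral.integral_add_adjacent_intervals i0 i1,
    ← intervalIntegral.integral_congr_ae (.of_forall h0), ← intervalIntegral.integral_congr_ae (.of_forall h1)]
  simp

theorem stepKernel_integral_fst {φ : ℝ → ℂ} {a b : ℝ} (hφ : ContinuousOn φ (Icc a b))
    {u : ℝ} (hu : u ∈ Icc a b) :
    IntervalIntegrable (fun v => stepKernel v u * φ v) volume a b ∧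
      ∫ v in a..b, stepKernel v u * φ v = ∫ v in a..u, φ v := by
  have h0 : EqOn (fun _ => (0 : ℂ)) (fun v => stepKernel v u * φ v) (uIoc u b) := fun v hv => by
    rw [uIoc_of_le hu.2] at hv
    simp [stepKernel, hv.1.not_gt]
  -- The open interval is used because the step kernel vanishes at `v = u`.
  have h1 : EqOn φ (fun v => stepKernel v u * φ v) (uIoo a u) := fun v hv => by
    rw [uIoo_of_le hu.1] at hv
    simp [stepKernel, hv.2]
  have i0 := (intervalIntegrable_congr h0).1 (intervalIntegrable_const (μ := volume))
  have i1 := (intervalIntegrable_congr_uIoo (μ := volume) h1).1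
    ((hφ.mono (Icc_subset_Icc_right hu.2)).intervalIntegrable_of_Icc hu.1)
  refine ⟨i1.trans i0, ?_⟩
  rw [← intervalIntegral.integral_add_adjacent_intervals i1 i0,
    ← intervalIntegral.integral_congr_ae (.of_forall h0), ← intervalIntegral.integral_congr_uIoo h1]
  simp

/-- The two operators are the primitives taken from the last and from the first end point. The
Fubini property is integration by parts for the product of two such primitives, which vanishes at
both ends. -/
theorem isKernel_step {a b : ℝ} (hab : a < b) : IsKernel stepKernel a b a b := by
  have s1 : ∀ φ : ℝ → ℂ, ContDiffOn ℝ ∞ φ (Icc a b) →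
      ContDiffOn ℝ ∞ (fun v => ∫ u in v..b, φ u) (Icc a b) := fun φ hφ =>
    contDiffOn_of_hasDerivWithinAt (uniqueDiffOn_Icc hab) hφ.neg
      fun v hv => hasDerivWithinAt_integral_left hab hφ.continuousOn hv
  have s2 : ∀ φ : ℝ → ℂ, ContDiffOn ℝ ∞ φ (Icc a b) →
      ContDiffOn ℝ ∞ (fun v => ∫ u in a..v, φ u) (Icc a b) := fun φ hφ =>
    contDiffOn_of_hasDerivWithinAt (uniqueDiffOn_Icc hab) hφ
      fun v hv => hasDerivWithinAt_integral_right hab hφ.continuousOn hv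
  refine ⟨hab, hab, fun φ hφ v hv => (stepKernel_integral hφ.continuousOn hv).1,
    fun φ hφ v hv => (stepKernel_integral_fst hφ.continuousOn hv).1,
    fun φ hφ => (s1 φ hφ).congr fun v hv => (stepKernel_integral hφ.continuousOn hv).2,
    fun φ hφ => (s2 φ hφ).congr fun v hv => (stepKernel_integral_fst hφ.continuousOn hv).2,
    fun ψ hψ φ hφ => ?_⟩
  rw [intervalIntegral.integral_congr (g := fun v => ψ v * ∫ u in v..b, φ u),
    intervalIntegral.integral_congr (a := a) (b := b)
      (f := fun u => (∫ v in a..b, stepKernel v u * ψ v) * φ u)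
      (g := fun u => (∫ v in a..u, ψ v) * φ u)]
  · have key := intervalIntegral.integral_eq_sub_of_hasDeriv_right_of_le hab.le
      (f := fun v => (∫ u in a..v, ψ u) * ∫ u in v..b, φ u)
      (f' := fun v => ψ v * (∫ u in v..b, φ u) - (∫ u in a..v, ψ u) * φ v)
      (((s2 ψ hψ).mul (s1 φ hφ)).continuousOn) (fun v hv => ?_) ?_
    · rw [intervalIntegral.integral_sub] at key
      · simpa [sub_eq_zero] using key
      · exact ((hψ.mul (s1 φ hφ)).continuousOn).intervalIntegrable_of_Icc hab.le
      · exact (((s2 ψ hψ).mul hφ).continuousOn).intervalIntegrable_of_Icc hab.le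
    · have hv' : v ∈ Icc a b := ⟨hv.1.le, hv.2.le⟩
      have := ((hasDerivWithinAt_integral_right hab hψ.continuousOn hv').mul
        (hasDerivWithinAt_integral_left hab hφ.continuousOn hv')).hasDerivAt
        (Icc_mem_nhds hv.1 hv.2)
      exact (this.congr_deriv (by ring)).hasDerivWithinAt
    · exact (((hψ.mul (s1 φ hφ)).sub ((s2 ψ hψ).mul hφ)).continuousOn).intervalIntegrable_of_Icc
        hab.le
  · intro u hu
    rw [uIcc_of_le hab.le] at hu
    simp only
    rw [(stepKernel_integral_fst hψ.continuousOn hu).2]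
  · intro v hv
    rw [uIcc_of_le hab.le] at hv
    simp only
    rw [(stepKernel_integral hφ.continuousOn hv).2]


end

section

/-! ### Integral operators on Grassmann valued functions -/

section Kint

variable {n : ℕ} {κ κ' : ℝ → ℝ → ℂ} {a b c d : ℝ} {f g : ℝ → Coef n}

theorem SmoothCoef.hasWInt (hab : a ≤ b) (hf : SmoothCoef f (Icc a b)) :
    HasWInt f a b (wint a b f) := by
  obtain ⟨m, φ, e, hφ, hfe⟩ := hf
  have h : HasWInt (fun t => ∑ k, φ k t • e k) a b (∑ k, (∫ t in a..b, φ k t) • e k) :=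
    HasWInt.finsetSum _ fun k _ =>
      hasWInt_smul ((hφ k).continuousOn.intervalIntegrable_of_Icc hab) _
  exact (h.congr hab hfe).hasWInt_wint

/-- Integration by parts. -/
theorem wint_mul_wderiv {f' g' : ℝ → Coef n} (hab : a < b) (hf : SmoothCoef f (Icc a b))
    (hg : SmoothCoef g (Icc a b)) (hf' : ∀ t ∈ Icc a b, HasWDeriv f (f' t) (Icc a b) t)
    (hg' : ∀ t ∈ Icc a b, HasWDeriv g (g' t) (Icc a b) t) :
    wint a b (fun t => f' t * g t) = f b * g b - f a * g a - wint a b (fun t => f t * g' t) := by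
  have hu := uniqueDiffOn_Icc hab
  obtain ⟨F, hF, hF'⟩ := hf.exists_deriv hu
  obtain ⟨G, hG, hG'⟩ := hg.exists_deriv hu
  have hfs : SmoothCoef f' (Icc a b) := hF.congr fun t ht => (hf' t ht).unique (hF' t ht) (hu t ht)
  have hgs : SmoothCoef g' (Icc a b) := hG.congr fun t ht => (hg' t ht).unique (hG' t ht) (hu t ht)
  have key := HasWInt.of_hasWDeriv (f := fun t => f t * g t) hab.le
    (fun t ht => (hf' t ht).mul (hg' t ht) hf hg (hu t ht) ht)
    (((hfs.mul hg).hasWInt hab.le).add ((hf.mul hgs).hasWInt hab.le))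
  rw [← key, add_sub_cancel_right]

/-- The integral operator with kernel `κ` on Grassmann valued functions. -/
def kint (c d : ℝ) (κ : ℝ → ℝ → ℂ) (f : ℝ → Coef n) (v : ℝ) : Coef n :=
  wint c d fun u => κ v u • f u

theorem HasParity.kint {p : ZMod 2} (hcd : c ≤ d) (h : ∀ t ∈ Icc c d, HasParity p (f t)) (v : ℝ) :
    HasParity p (kint c d κ f v) := HasParity.wint hcd fun t ht => (h t ht).smul _

namespace IsKernel

theorem hasWInt_sum (h : IsKernel κ a b c d) {ι : Type*} [Fintype ι] {φ : ι → ℝ → ℂ}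
    {e : ι → Coef n} (hφ : ∀ k, ContDiffOn ℝ ∞ (φ k) (Icc c d))
    (hf : ∀ t ∈ Icc c d, f t = ∑ k, φ k t • e k) {v : ℝ} (hv : v ∈ Icc a b) :
    HasWInt (fun u => κ v u • f u) c d (∑ k, (∫ u in c..d, κ v u * φ k u) • e k) := by
  have h1 : HasWInt (fun u => ∑ k, (κ v u * φ k u) • e k) c d
      (∑ k, (∫ u in c..d, κ v u * φ k u) • e k) :=
    HasWInt.finsetSum _ fun k _ => hasWInt_smul (h.int_snd _ (hφ k) v hv) _
  refine h1.congr h.lt_snd.le fun u hu => ?_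
  rw [hf u hu, Finset.smul_sum]
  simp only [mul_smul]

theorem kint_eq (h : IsKernel κ a b c d) {ι : Type*} [Fintype ι] {φ : ι → ℝ → ℂ}
    {e : ι → Coef n} (hφ : ∀ k, ContDiffOn ℝ ∞ (φ k) (Icc c d))
    (hf : ∀ t ∈ Icc c d, f t = ∑ k, φ k t • e k) {v : ℝ} (hv : v ∈ Icc a b) :
    kint c d κ f v = ∑ k, (∫ u in c..d, κ v u * φ k u) • e k :=
  (h.hasWInt_sum hφ hf hv).wint_eq

theorem hasWInt (h : IsKernel κ a b c d) (hf : SmoothCoef f (Icc c d)) {v : ℝ}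
    (hv : v ∈ Icc a b) : HasWInt (fun u => κ v u • f u) c d (kint c d κ f v) := by
  obtain ⟨m, φ, e, hφ, hfe⟩ := hf
  exact (h.hasWInt_sum hφ hfe hv).hasWInt_wint

theorem smoothCoef_kint (h : IsKernel κ a b c d) (hf : SmoothCoef f (Icc c d)) :
    SmoothCoef (kint c d κ f) (Icc a b) := by
  obtain ⟨m, φ, e, hφ, hfe⟩ := hf
  exact ⟨m, _, e, fun k => h.smooth_snd _ (hφ k), fun v hv => h.kint_eq hφ hfe hv⟩

/-- Fubini's theorem. -/
theorem wint_mul_kint (h : IsKernel κ a b c d) (hg : SmoothCoef g (Icc a b))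
    (hf : SmoothCoef f (Icc c d)) :
    wint a b (fun v => g v * kint c d κ f v) =
      wint c d (fun u => kint a b (fun u v => κ v u) g u * f u) := by
  obtain ⟨m, φ, e, hφ, hfe⟩ := hf
  obtain ⟨m', ψ, e', hψ, hge⟩ := hg
  have h1 : HasWInt (fun v => ∑ p : Fin m' × Fin m,
        (ψ p.1 v * ∫ u in c..d, κ v u * φ p.2 u) • (e' p.1 * e p.2)) a b
      (∑ p : Fin m' × Fin m, (∫ v in a..b, ψ p.1 v * ∫ u in c..d, κ v u * φ p.2 u) •
        (e' p.1 * e p.2)) :=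
    HasWInt.finsetSum _ fun p _ => hasWInt_smul
      (((hψ p.1).mul (h.smooth_snd _ (hφ p.2))).continuousOn.intervalIntegrable_of_Icc
        h.lt_fst.le) _
  have h2 : HasWInt (fun u => ∑ p : Fin m' × Fin m,
        ((∫ v in a..b, κ v u * ψ p.1 v) * φ p.2 u) • (e' p.1 * e p.2)) c d
      (∑ p : Fin m' × Fin m, (∫ u in c..d, (∫ v in a..b, κ v u * ψ p.1 v) * φ p.2 u) •
        (e' p.1 * e p.2)) :=
    HasWInt.finsetSum _ fun p _ => hasWInt_smul
      (((h.smooth_fst _ (hψ p.1)).mul (hφ p.2)).continuousOn.intervalIntegrable_of_Icc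
        h.lt_snd.le) _
  rw [(h1.congr h.lt_fst.le fun v hv => ?_).wint_eq, (h2.congr h.lt_snd.le fun u hu => ?_).wint_eq]
  · exact Finset.sum_congr rfl fun p _ => by rw [h.fubini _ (hψ p.1) _ (hφ p.2)]
  · rw [hfe u hu, h.swap.kint_eq hψ hge hu, Finset.sum_mul_sum, ← Finset.sum_product']
    exact Finset.sum_congr rfl fun p _ => smul_mul_smul_comm ..
  · rw [hge v hv, h.kint_eq hφ hfe hv, Finset.sum_mul_sum, ← Finset.sum_product']
    exact Finset.sum_congr rfl fun p _ => smul_mul_smul_comm ..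

theorem kint_add (h : IsKernel κ a b c d) (hf : SmoothCoef f (Icc c d))
    (hg : SmoothCoef g (Icc c d)) {v : ℝ} (hv : v ∈ Icc a b) :
    kint c d κ (fun u => f u + g u) v = kint c d κ f v + kint c d κ g v :=
  (((h.hasWInt hf hv).add (h.hasWInt hg hv)).congr h.lt_snd.le
    fun _ _ => smul_add ..).wint_eq

theorem kint_smul (h : IsKernel κ a b c d) (hf : SmoothCoef f (Icc c d)) {v : ℝ}
    (hv : v ∈ Icc a b) (z : ℂ) : kint c d κ (fun u => z • f u) v = z • kint c d κ f v :=
  (((h.hasWInt hf hv).const_smul z).congr h.lt_snd.le fun _ _ => smul_comm ..).wint_eq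

/-- The derivative of an integral operator, allowing for a jump of the kernel on the diagonal. -/
theorem hasWDeriv_kint (h : IsKernel κ a b c d) (h' : IsKernel κ' a b c d) (ε : ℂ)
    (hε : ε = 0 ∨ Icc a b ⊆ Icc c d)
    (hd : ∀ φ, ContDiffOn ℝ ∞ φ (Icc c d) → ∀ v ∈ Icc a b,
      HasDerivWithinAt (fun v => ∫ u in c..d, κ v u * φ u)
        ((∫ u in c..d, κ' v u * φ u) + ε * φ v) (Icc a b) v)
    (hf : SmoothCoef f (Icc c d)) {v : ℝ} (hv : v ∈ Icc a b) :
    HasWDeriv (kint c d κ f) (kint c d κ' f v + ε • f v) (Icc a b) v := by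
  obtain ⟨m, φ, e, hφ, hfe⟩ := hf
  have h1 := HasWDeriv.finsetSum Finset.univ fun k _ => hasWDeriv_smul (hd (φ k) (hφ k) v hv) (e k)
  have h2 : ε • f v = ∑ k, (ε * φ k v) • e k := by
    -- The jump term uses the expansion of `f` at `v`, which is available only if `v` lies in the
    -- interval on which `f` is smooth.
    rcases hε with rfl | hε
    · simp
    · rw [hfe v (hε hv), Finset.smul_sum]
      simp only [mul_smul]
  rw [h'.kint_eq hφ hfe hv, h2, ← Finset.sum_add_distrib]
  simp only [← add_smul]
  exact h1.congr (fun w hw => h.kint_eq hφ hfe hw) hv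

/-- The bilinear pairing with a kernel. -/
def _root_.PSM.kpair (a b c d : ℝ) (κ : ℝ → ℝ → ℂ) (g f : ℝ → Coef n) : Coef n :=
  wint a b fun v => g v * kint c d κ f v

theorem kpair_add_left (h : IsKernel κ a b c d) {g' : ℝ → Coef n} (hg : SmoothCoef g (Icc a b))
    (hg' : SmoothCoef g' (Icc a b)) (hf : SmoothCoef f (Icc c d)) :
    kpair a b c d κ (fun v => g v + g' v) f = kpair a b c d κ g f + kpair a b c d κ g' f :=
  ((((hg.mul (h.smoothCoef_kint hf)).hasWInt h.lt_fst.le).add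
    ((hg'.mul (h.smoothCoef_kint hf)).hasWInt h.lt_fst.le)).congr h.lt_fst.le
    fun _ _ => add_mul ..).wint_eq

theorem kpair_add_right (h : IsKernel κ a b c d) {f' : ℝ → Coef n} (hg : SmoothCoef g (Icc a b))
    (hf : SmoothCoef f (Icc c d)) (hf' : SmoothCoef f' (Icc c d)) :
    kpair a b c d κ g (fun v => f v + f' v) = kpair a b c d κ g f + kpair a b c d κ g f' :=
  ((((hg.mul (h.smoothCoef_kint hf)).hasWInt h.lt_fst.le).add
    ((hg.mul (h.smoothCoef_kint hf')).hasWInt h.lt_fst.le)).congr h.lt_fst.le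
    fun v hv => by rw [h.kint_add hf hf' hv, mul_add]).wint_eq

theorem kpair_smul_left (h : IsKernel κ a b c d) (hg : SmoothCoef g (Icc a b))
    (hf : SmoothCoef f (Icc c d)) (z : ℂ) :
    kpair a b c d κ (fun v => z • g v) f = z • kpair a b c d κ g f :=
  ((((hg.mul (h.smoothCoef_kint hf)).hasWInt h.lt_fst.le).const_smul z).congr h.lt_fst.le
    fun _ _ => smul_mul_assoc ..).wint_eq

theorem kpair_smul_right (h : IsKernel κ a b c d) (hg : SmoothCoef g (Icc a b))
    (hf : SmoothCoef f (Icc c d)) (z : ℂ) :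
    kpair a b c d κ g (fun v => z • f v) = z • kpair a b c d κ g f :=
  ((((hg.mul (h.smoothCoef_kint hf)).hasWInt h.lt_fst.le).const_smul z).congr h.lt_fst.le
    fun v hv => by
      rw [h.kint_smul hf hv, mul_smul_comm]).wint_eq

end IsKernel

theorem HasParity.kpair {p q : ZMod 2} (hab : a ≤ b) (hcd : c ≤ d)
    (hg : ∀ t ∈ Icc a b, HasParity p (g t)) (hf : ∀ t ∈ Icc c d, HasParity q (f t)) :
    HasParity (p + q) (kpair a b c d κ g f) :=
  HasParity.wint hab fun t ht => (hg t ht).mul (HasParity.kint hcd hf t)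

end Kint

/-! ### The kernels of the effective action -/

variable {L : L3} {ζ : ℂ × ℂ → (ℂ × ℂ →L[ℝ] ℝ)}

/-- The kernel of the interaction term. -/
def kerZ (ζ : ℂ × ℂ → (ℂ × ℂ →L[ℝ] ℝ)) (v w : ℝ) : ℂ := (zetaHat ζ v w : ℂ)

/-- The smooth part of the derivative of the kernel of the interaction term. -/
def kerC (L : L3) (ζ : ℂ × ℂ → (ℂ × ℂ →L[ℝ] ℝ)) (v w : ℝ) : ℂ :=
  ∫ u in (L.θ 0)..(L.θ 1), kerV ζ (v, u) * kerU ζ (w, u)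

namespace L3

theorem θ01 (L : L3) : L.θ 0 < L.θ 1 := L.θ_lt (by decide)

theorem lt_of_mem {k l : Fin 2} (hkl : k < l) {v u : ℝ} (hv : v ∈ Icc (L.lo k) (L.hi k))
    (hu : u ∈ Icc (L.lo l) (L.hi l)) : v < u := by
  have h4 : L.θ 3 < L.θ 4 := L.θ_lt (by decide)
  have hk : k = 0 := by fin_cases k <;> fin_cases l <;> simp_all
  have hl : l = 1 := by fin_cases k <;> fin_cases l <;> simp_all
  subst hk hl
  have h1 : v ≤ L.θ 3 := hv.2
  have h2 : L.θ 4 ≤ u := hu.1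
  linarith

end L3

namespace IsPropagator

theorem contDiffOn_kerD (hζ : IsPropagator L ζ) :
    ContDiffOn ℝ ∞ (kerD ζ) (L.nbhdE ×ˢ L.nbhdX) := by
  have h1 : ContDiffOn ℝ ∞ (fderivWithin ℝ ζ conf) conf :=
    hζ.smooth.fderivWithin uniqueDiff_conf (by simp)
  have hb : ContDiff ℝ ∞ fun p : ℝ × ℝ => (bpt p.2, bpt p.1) :=
    (contDiff_bpt.comp contDiff_snd).prodMk (contDiff_bpt.comp contDiff_fst)
  have hb1 : ContDiff ℝ ∞ fun p : ℝ × ℝ => ((0, btan p.1) : ℂ × ℂ) :=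
    contDiff_const.prodMk (contDiff_btan.comp contDiff_fst)
  have hb2 : ContDiff ℝ ∞ fun p : ℝ × ℝ => ((btan p.2, 0) : ℂ × ℂ) :=
    (contDiff_btan.comp contDiff_snd).prodMk contDiff_const
  have h2 : ContDiffOn ℝ ∞ (fun p : ℝ × ℝ => fderivWithin ℝ ζ conf (bpt p.2, bpt p.1))
      (L.nbhdE ×ˢ L.nbhdX) := h1.comp hb.contDiffOn fun p hp => L3.mem_conf hp.1 hp.2
  exact Complex.ofRealCLM.contDiff.comp_contDiffOn
    ((h2.clm_apply hb1.contDiffOn).clm_apply hb2.contDiffOn)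

theorem isKernel_of_contDiffOn {κ : ℝ × ℝ → ℂ} (hκ : ContDiffOn ℝ ∞ κ (L.nbhdE ×ˢ L.nbhdX))
    (k : Fin 2) : IsKernel (fun v u => κ (v, u)) (L.lo k) (L.hi k) (L.θ 0) (L.θ 1) :=
  IsKernel.of_contDiffOn L.convex_nbhdE L.isOpen_nbhdE L.convex_nbhdX L.isOpen_nbhdX hκ
    (L.lo_lt_hi k) L.θ01 (L.Icc_subset_nbhdE k) L.Icc_subset_nbhdX

theorem isKernel_of_contDiffOn_sq {κ : ℝ × ℝ → ℂ} (hκ : ContDiffOn ℝ ∞ κ (L.nbhdE ×ˢ L.nbhdE))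
    (k l : Fin 2) : IsKernel (fun v u => κ (v, u)) (L.lo k) (L.hi k) (L.lo l) (L.hi l) :=
  IsKernel.of_contDiffOn L.convex_nbhdE L.isOpen_nbhdE L.convex_nbhdE L.isOpen_nbhdE hκ
    (L.lo_lt_hi k) (L.lo_lt_hi l) (L.Icc_subset_nbhdE k) (L.Icc_subset_nbhdE l)

theorem isKernelU (hζ : IsPropagator L ζ) (k : Fin 2) :
    IsKernel (fun v u => kerU ζ (v, u)) (L.lo k) (L.hi k) (L.θ 0) (L.θ 1) :=
  isKernel_of_contDiffOn hζ.contDiffOn_kerU k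

theorem isKernelV (hζ : IsPropagator L ζ) (k : Fin 2) :
    IsKernel (fun v u => kerV ζ (v, u)) (L.lo k) (L.hi k) (L.θ 0) (L.θ 1) :=
  isKernel_of_contDiffOn hζ.contDiffOn_kerV k

theorem isKernelD (hζ : IsPropagator L ζ) (k : Fin 2) :
    IsKernel (fun v u => kerD ζ (v, u)) (L.lo k) (L.hi k) (L.θ 0) (L.θ 1) :=
  isKernel_of_contDiffOn hζ.contDiffOn_kerD k

theorem contDiffOn_kerC (hζ : IsPropagator L ζ) :
    ContDiffOn ℝ ∞ (fun p : ℝ × ℝ => kerC L ζ p.1 p.2) (L.nbhdE ×ˢ L.nbhdE) := by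
  have hk : ContDiffOn ℝ ∞ (fun q : (ℝ × ℝ) × ℝ => kerV ζ (q.1.1, q.2) * kerU ζ (q.1.2, q.2))
      ((L.nbhdE ×ˢ L.nbhdE) ×ˢ L.nbhdX) :=
    (hζ.contDiffOn_kerV.comp (f := fun q : (ℝ × ℝ) × ℝ => (q.1.1, q.2)) (by fun_prop)
      fun q hq => ⟨hq.1.1, hq.2⟩).mul
    (hζ.contDiffOn_kerU.comp (f := fun q : (ℝ × ℝ) × ℝ => (q.1.2, q.2)) (by fun_prop)
      fun q hq => ⟨hq.1.2, hq.2⟩)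
  refine (contDiffOn_kernel_integral (L.convex_nbhdE.prod L.convex_nbhdE)
    (L.isOpen_nbhdE.prod L.isOpen_nbhdE) L.isOpen_nbhdX L.θ01.le L.Icc_subset_nbhdX
    (φ := fun _ => 1) continuousOn_const hk).congr fun p _ => ?_
  simp only [kerC, one_mul]

theorem isKernelC (hζ : IsPropagator L ζ) (k l : Fin 2) :
    IsKernel (kerC L ζ) (L.lo k) (L.hi k) (L.lo l) (L.hi l) :=
  isKernel_of_contDiffOn_sq hζ.contDiffOn_kerC k l

/-- On two different intervals the order of the points is fixed, so the kernel is constant; only a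
single interval sees the jump. -/
theorem isKernelStep (L : L3) (k l : Fin 2) :
    IsKernel stepKernel (L.lo k) (L.hi k) (L.lo l) (L.hi l) := by
  rcases lt_trichotomy k l with h | rfl | h
  · refine (isKernel_of_contDiffOn_sq (κ := fun _ => 1) contDiffOn_const k l).congr_off_diag
      fun v hv u hu _ => ?_
    simp [stepKernel, L3.lt_of_mem h hv hu]
  · exact isKernel_step (L.lo_lt_hi k)
  · refine (isKernel_of_contDiffOn_sq (κ := fun _ => 0) contDiffOn_const k l).congr_off_diag
      fun v hv u hu _ => ?_
    simp [stepKernel, (L3.lt_of_mem h hu hv).le]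

theorem isKernelQ (hζ : IsPropagator L ζ) (k l : Fin 2) :
    IsKernel (fun v w => kerQ L ζ (v, w)) (L.lo k) (L.hi k) (L.lo l) (L.hi l) :=
  isKernel_of_contDiffOn_sq hζ.contDiffOn_kerQ k l

theorem kerZ_eq (hζ : IsPropagator L ζ) (k l : Fin 2) : ∀ v ∈ Icc (L.lo k) (L.hi k),
    ∀ u ∈ Icc (L.lo l) (L.hi l), v ≠ u → kerZ ζ v u = kerQ L ζ (v, u) + stepKernel v u :=
  fun _ hv _ hu hvu =>
    hζ.zetaHat_eq_kerQ (L.Icc_subset_nbhdE k hv) (L.Icc_subset_nbhdE l hu) hvu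

theorem isKernelZ (hζ : IsPropagator L ζ) (k l : Fin 2) :
    IsKernel (kerZ ζ) (L.lo k) (L.hi k) (L.lo l) (L.hi l) :=
  ((hζ.isKernelQ k l).add (isKernelStep L k l)).congr_off_diag (hζ.kerZ_eq k l)

/-- If both points run through the same interval, the operator integrates from `v` on, and the lower
limit gives `-1`. Otherwise the kernel does not depend on `v`. -/
theorem hasDerivWithinAt_step (k l : Fin 2) {φ : ℝ → ℂ}
    (hφ : ContDiffOn ℝ ∞ φ (Icc (L.lo l) (L.hi l))) {v : ℝ} (hv : v ∈ Icc (L.lo k) (L.hi k)) :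
    HasDerivWithinAt (fun v => ∫ u in (L.lo l)..(L.hi l), stepKernel v u * φ u)
      ((if k = l then -1 else 0) * φ v) (Icc (L.lo k) (L.hi k)) v := by
  rcases eq_or_ne k l with rfl | hkl
  · rw [if_pos rfl, neg_one_mul]
    exact (hasDerivWithinAt_integral_left (L.lo_lt_hi k) hφ.continuousOn hv).congr_of_mem
      (fun w hw => (stepKernel_integral hφ.continuousOn hw).2) hv
  · rw [if_neg hkl, zero_mul]
    refine (hasDerivWithinAt_const v _
      (∫ u in (L.lo l)..(L.hi l), stepKernel v u * φ u)).congr_of_mem (fun w hw => ?_) hv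
    refine intervalIntegral.integral_congr fun u hu => ?_
    rw [uIcc_of_le (L.lo_lt_hi l).le] at hu
    rcases hkl.lt_or_gt with h | h
    · simp [stepKernel, L3.lt_of_mem h hv hu, L3.lt_of_mem h hw hu]
    · simp [stepKernel, (L3.lt_of_mem h hu hv).not_gt, (L3.lt_of_mem h hu hw).not_gt]

/-- This is the differential of `ζ̂` in weak form. The smooth part comes from `hasDerivAt_kerQ`; the
jump on the diagonal is responsible for the term `E ∧ E` of the boundary operator. -/
theorem hasWDeriv_kintZ (hζ : IsPropagator L ζ) {n : ℕ} (k l : Fin 2) {f : ℝ → Coef n}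
    (hf : SmoothCoef f (Icc (L.lo l) (L.hi l))) {v : ℝ} (hv : v ∈ Icc (L.lo k) (L.hi k)) :
    HasWDeriv (kint (L.lo l) (L.hi l) (kerZ ζ) f)
      (kint (L.lo l) (L.hi l) (kerC L ζ) f v + (if k = l then -1 else 0 : ℂ) • f v)
      (Icc (L.lo k) (L.hi k)) v := by
  refine (hζ.isKernelZ k l).hasWDeriv_kint (hζ.isKernelC k l) _ ?_ (fun φ hφ v hv => ?_) hf hv
  · rcases eq_or_ne k l with rfl | h
    · exact Or.inr le_rfl
    · exact Or.inl (if_neg h)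
  · have h1 := hasDerivAt_kernel_integral L.convex_nbhdE L.isOpen_nbhdE (L.lo_lt_hi l).le
      (L.Icc_subset_nbhdE l) hφ.continuousOn hζ.contDiffOn_kerQ.continuousOn
      hζ.contDiffOn_kerC.continuousOn (fun x hx u hu => hζ.hasDerivAt_kerQ hx hu)
      (L.Icc_subset_nbhdE k hv)
    have h2 := h1.hasDerivWithinAt (s := Icc (L.lo k) (L.hi k))
    simp only [mul_comm (φ _)] at h2
    refine (h2.add (hasDerivWithinAt_step k l hφ hv)).congr_of_mem (fun w hw => ?_) hv
    rw [(IsKernel.integral_congr_off_diag (κ := fun v u => kerQ L ζ (v, u) + stepKernel v u)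
      (L.lo_lt_hi l).le (hζ.kerZ_eq k l w hw) φ).2]
    simp only [add_mul]
    exact intervalIntegral.integral_add ((hζ.isKernelQ k l).int_snd φ hφ w hw)
      ((isKernelStep L k l).int_snd φ hφ w hw)

theorem hasWDeriv_kintU (hζ : IsPropagator L ζ) {n : ℕ} (k : Fin 2) {f : ℝ → Coef n}
    (hf : SmoothCoef f (Icc (L.θ 0) (L.θ 1))) {v : ℝ} (hv : v ∈ Icc (L.lo k) (L.hi k)) :
    HasWDeriv (kint (L.θ 0) (L.θ 1) (fun v u => kerU ζ (v, u)) f)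
      (kint (L.θ 0) (L.θ 1) (fun v u => kerD ζ (v, u)) f v) (Icc (L.lo k) (L.hi k)) v := by
  have := (hζ.isKernelU k).hasWDeriv_kint (hζ.isKernelD k) 0 (Or.inl rfl) (fun φ hφ v hv => ?_)
    hf hv
  · simpa using this
  · have h1 := hasDerivAt_kernel_integral L.convex_nbhdE L.isOpen_nbhdE L.θ01.le
      L.Icc_subset_nbhdX hφ.continuousOn hζ.contDiffOn_kerU.continuousOn
      hζ.contDiffOn_kerD.continuousOn (fun x hx u hu => hζ.hasDerivAt_kerU hx hu)
      (L.Icc_subset_nbhdE k hv)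
    simp only [mul_comm (φ _)] at h1
    simpa using h1.hasDerivWithinAt

theorem hasWDeriv_kintV (hζ : IsPropagator L ζ) {n : ℕ} (k : Fin 2) {f : ℝ → Coef n}
    (hf : SmoothCoef f (Icc (L.lo k) (L.hi k))) {u : ℝ} (hu : u ∈ Icc (L.θ 0) (L.θ 1)) :
    HasWDeriv (kint (L.lo k) (L.hi k) (fun u v => kerV ζ (v, u)) f)
      (kint (L.lo k) (L.hi k) (fun u v => kerD ζ (v, u)) f u) (Icc (L.θ 0) (L.θ 1)) u := by
  have hs : ∀ {g : ℝ × ℝ → ℂ}, ContinuousOn g (L.nbhdE ×ˢ L.nbhdX) →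
      ContinuousOn (fun p : ℝ × ℝ => g (p.2, p.1)) (L.nbhdX ×ˢ L.nbhdE) := fun hg =>
    hg.comp (f := fun p : ℝ × ℝ => (p.2, p.1)) (by fun_prop) fun p hp => ⟨hp.2, hp.1⟩
  have := (hζ.isKernelV k).swap.hasWDeriv_kint (hζ.isKernelD k).swap 0 (Or.inl rfl)
    (fun φ hφ u hu => ?_) hf hu
  · simpa using this
  · have h1 := hasDerivAt_kernel_integral L.convex_nbhdX L.isOpen_nbhdX (L.lo_lt_hi k).le
      (L.Icc_subset_nbhdE k) hφ.continuousOn (hs hζ.contDiffOn_kerV.continuousOn)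
      (hs hζ.contDiffOn_kerD.continuousOn) (fun x hx u hu => hζ.hasDerivAt_kerV hu hx)
      (L.Icc_subset_nbhdX hu)
    simp only [mul_comm (φ _)] at h1
    simpa using h1.hasDerivWithinAt

end IsPropagator


end

section

variable {d : ℕ} {L : L3} {ζ : ℂ × ℂ → (ℂ × ℂ →L[ℝ] ℝ)} {A : Matrix (Fin d) (Fin d) ℝ}

/-! ### Boundary fields -/

section Fields

variable {X δX : Fin d → SForm d} {E δE : Fin 2 → Fin d → SForm d}

theorem IsXField.smooth_zero (h : IsXField L X) (i : Fin d) :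
    SmoothCoef (X i).zero (Icc (L.θ 0) (L.θ 1)) := (h i).1.1

theorem IsXField.smooth_one (h : IsXField L X) (i : Fin d) :
    SmoothCoef (X i).one (Icc (L.θ 0) (L.θ 1)) := (h i).1.2

theorem IsXField.even (h : IsXField L X) (i : Fin d) :
    ∀ t ∈ Icc (L.θ 0) (L.θ 1), HasParity 0 ((X i).zero t) := fun t ht => ((h i).2 t ht).1

theorem IsXField.odd (h : IsXField L X) (i : Fin d) :
    ∀ t ∈ Icc (L.θ 0) (L.θ 1), HasParity 1 ((X i).one t) := fun t ht => by
  simpa using ((h i).2 t ht).2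

theorem IsEField.smooth_zero (h : IsEField L E) (k : Fin 2) (i : Fin d) :
    SmoothCoef (E k i).zero (Icc (L.lo k) (L.hi k)) := (h k i).1.1

theorem IsEField.smooth_one (h : IsEField L E) (k : Fin 2) (i : Fin d) :
    SmoothCoef (E k i).one (Icc (L.lo k) (L.hi k)) := (h k i).1.2

theorem IsEField.odd (h : IsEField L E) (k : Fin 2) (i : Fin d) :
    ∀ t ∈ Icc (L.lo k) (L.hi k), HasParity 1 ((E k i).zero t) := fun t ht => ((h k i).2.1 t ht).1

theorem IsEField.even (h : IsEField L E) (k : Fin 2) (i : Fin d) :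
    ∀ t ∈ Icc (L.lo k) (L.hi k), HasParity 0 ((E k i).one t) := fun t ht =>
  ((h k i).2.1 t ht).2

theorem SForm.IsSmooth.shift {a b : ℝ} {ϖ δ : SForm d} (h : ϖ.IsSmooth a b) (h' : δ.IsSmooth a b)
    (t : ℝ) : (ϖ.shift δ t).IsSmooth a b :=
  ⟨h.1.add (h'.1.const_smul _), h.2.add (h'.2.const_smul _)⟩

theorem SForm.HasTotalParity.shift {a b : ℝ} {p : ZMod 2} {ϖ δ : SForm d}
    (h : ϖ.HasTotalParity p a b) (h' : δ.HasTotalParity p a b) (t : ℝ) :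
    (ϖ.shift δ t).HasTotalParity p a b := fun s hs =>
  ⟨(h s hs).1.add ((h' s hs).1.smul _), (h s hs).2.add ((h' s hs).2.smul _)⟩

theorem IsXField.shift (h : IsXField L X) (h' : IsXField L δX) (t : ℝ) :
    IsXField L fun i => (X i).shift (δX i) t := fun i =>
  ⟨(h i).1.shift (h' i).1 t, (h i).2.shift (h' i).2 t⟩

theorem IsEField.shift (h : IsEField L E) (h' : IsEField L δE) (t : ℝ) :
    IsEField L fun k i => (E k i).shift (δE k i) t := fun k i =>
  ⟨(h k i).1.shift (h' k i).1 t, (h k i).2.1.shift (h' k i).2.1 t,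
    by simp [SForm.shift, (h k i).2.2.1, (h' k i).2.2.1],
    by simp [SForm.shift, (h k i).2.2.2, (h' k i).2.2.2]⟩

end Fields

/-! ### The effective action as a quadratic form -/

/-- The pairing of the free part of the effective action. -/
def freePair (L : L3) (ζ : ℂ × ℂ → (ℂ × ℂ →L[ℝ] ℝ)) (k : Fin 2) (E X : SForm d) : Coef d :=
  kpair (L.lo k) (L.hi k) (L.θ 0) (L.θ 1) (fun v u => kerU ζ (v, u)) E.one X.zero
    + kpair (L.lo k) (L.hi k) (L.θ 0) (L.θ 1) (fun v u => kerV ζ (v, u)) E.zero X.one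

/-- The pairing of the interaction part of the effective action. -/
def pertPair (L : L3) (ζ : ℂ × ℂ → (ℂ × ℂ →L[ℝ] ℝ)) (k l : Fin 2) (E E' : SForm d) : Coef d :=
  kpair (L.lo k) (L.hi k) (L.lo l) (L.hi l) (kerZ ζ) E.one E'.one

/-- The free part of the effective action. -/
def freeSum (L : L3) (ζ : ℂ × ℂ → (ℂ × ℂ →L[ℝ] ℝ)) (E : Fin 2 → Fin d → SForm d)
    (X : Fin d → SForm d) : Coef d := ∑ k, ∑ i, freePair L ζ k (E k i) (X i)

/-- The interaction part of the effective action. -/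
def pertSum (L : L3) (ζ : ℂ × ℂ → (ℂ × ℂ →L[ℝ] ℝ)) (A : Matrix (Fin d) (Fin d) ℝ)
    (E E' : Fin 2 → Fin d → SForm d) : Coef d :=
  ∑ k, ∑ l, ∑ i, ∑ j, (A i j : ℂ) • pertPair L ζ k l (E k i) (E' l j)

/-- The sign is that of `∫ dv du f = - dv ∫ f` in the integration over the second variable. -/
theorem integral_integralSnd {a b a' b' : ℝ} (hab : a ≤ b) {ϖ : BiForm d} {f : ℝ → Coef d}
    {c : Coef d} (h : ∀ v ∈ Icc a b, HasWInt (ϖ.c11 v) a' b' (f v)) (hf : HasWInt f a b c) :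
    (ϖ.integralSnd a' b').integral a b = -c :=
  (hf.neg.congr hab fun v hv => by
    simp only [BiForm.integralSnd, (h v hv).wint_eq]).wint_eq

theorem coe_algebraMap_mul (z : ℂ) (a b : Coef d) :
    a * algebraMap ℂ (Coef d) z * b = a * (z • b) := by
  rw [mul_assoc, ← Algebra.smul_def]

/-- The minus sign of the action cancels the one of the double integral. The odd function `E.zero`
passes two form symbols, so no sign is left there either. -/
theorem freeAction_eq (hζ : IsPropagator L ζ) {Φ : Fields d} (hΦ : IsField L Φ) (k : Fin 2) :
    freeAction L ζ k Φ = ∑ i, freePair L ζ k (Φ.E k i) (Φ.X i) := by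
  obtain ⟨hX, hE⟩ := hΦ
  rw [freeAction, ← Finset.sum_neg_distrib]
  refine Finset.sum_congr rfl fun i _ => ?_
  have hU := hζ.isKernelU k
  have hV := hζ.isKernelV k
  rw [integral_integralSnd (L.lo_lt_hi k).le
    (f := fun v => (Φ.E k i).one v * kint (L.θ 0) (L.θ 1) (fun v u => kerU ζ (v, u)) (Φ.X i).zero v
      + (Φ.E k i).zero v * kint (L.θ 0) (L.θ 1) (fun v u => kerV ζ (v, u)) (Φ.X i).one v)
    (fun v hv => ?_)
    ((((hE.smooth_one k i).mul (hU.smoothCoef_kint (hX.smooth_zero i))).hasWInt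
      (L.lo_lt_hi k).le).add (((hE.smooth_zero k i).mul
        (hV.smoothCoef_kint (hX.smooth_one i))).hasWInt (L.lo_lt_hi k).le)), neg_neg]
  · rfl
  refine (((hU.hasWInt (hX.smooth_zero i) hv).mul_left ((Φ.E k i).one v)).add
    ((hV.hasWInt (hX.smooth_one i) hv).mul_left ((Φ.E k i).zero v))).congr L.θ01.le fun u _ => ?_
  simp only [BiForm.wedge, BiForm.fst, BiForm.snd, boundaryPropagator, BiForm.ofOneForm, inv_zero,
    zero_mul, mul_zero, add_zero, zero_add, sub_zero, inv_mul, inv_algebraMap]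
  rw [(hE.even k i v hv).inv_even, (hE.odd k i v hv).inv_odd, inv_neg, (hE.odd k i v hv).inv_odd,
    neg_neg, coe_algebraMap_mul, coe_algebraMap_mul]
  rfl

theorem pertIntegral_eq (hζ : IsPropagator L ζ) {Φ : Fields d} (hΦ : IsField L Φ) (k l : Fin 2) :
    pertIntegral L ζ A k l Φ =
      -∑ i, ∑ j, (A i j : ℂ) • pertPair L ζ k l (Φ.E k i) (Φ.E l j) := by
  obtain ⟨hX, hE⟩ := hΦ
  simp only [pertIntegral, ← Finset.sum_neg_distrib]
  refine Finset.sum_congr rfl fun i _ => Finset.sum_congr rfl fun j _ => ?_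
  have hZ := hζ.isKernelZ k l
  rw [integral_integralSnd (L.lo_lt_hi k).le
    (f := fun v => (Φ.E k i).one v * kint (L.lo l) (L.hi l) (kerZ ζ) (Φ.E l j).one v)
    (fun v hv => ?_)
    (((hE.smooth_one k i).mul (hZ.smoothCoef_kint (hE.smooth_one l j))).hasWInt
      (L.lo_lt_hi k).le), smul_neg]
  · rfl
  refine ((hZ.hasWInt (hE.smooth_one l j) hv).mul_left ((Φ.E k i).one v)).congr
    (L.lo_lt_hi l).le fun u _ => ?_
  simp only [BiForm.wedge, BiForm.fst, BiForm.snd, BiForm.ofFun, inv_zero,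
    zero_mul, mul_zero, add_zero, zero_add, sub_zero, inv_mul, inv_algebraMap]
  rw [(hE.even k i v hv).inv_even, coe_algebraMap_mul]
  rfl

/-- Fubini's theorem exchanges the two points, `zetaHat` is antisymmetric, and the one-form
components of `E` are even and commute. -/
theorem pertPair_swap (hζ : IsPropagator L ζ) (k l : Fin 2) {E E' : SForm d}
    (hE : SmoothCoef E.one (Icc (L.lo k) (L.hi k))) (hE' : SmoothCoef E'.one (Icc (L.lo l) (L.hi l)))
    (he : ∀ t ∈ Icc (L.lo k) (L.hi k), HasParity 0 (E.one t)) :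
    pertPair L ζ k l E E' = -pertPair L ζ l k E' E := by
  have hZ := hζ.isKernelZ k l
  have hs : (fun u v => kerZ ζ v u) = fun u v => -kerZ ζ u v := by
    funext u v
    rw [kerZ, zetaHat_swap, Complex.ofReal_neg, kerZ]
  rw [pertPair, kpair, hZ.wint_mul_kint hE hE', hs]
  have hZ' := hζ.isKernelZ l k
  have key := ((hE'.mul (hZ'.smoothCoef_kint hE)).hasWInt (L.lo_lt_hi l).le).neg
  refine (key.congr (L.lo_lt_hi l).le fun u hu => ?_).wint_eq
  have h1 : kint (L.lo k) (L.hi k) (fun u v => -kerZ ζ u v) E.one u =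
      -kint (L.lo k) (L.hi k) (kerZ ζ) E.one u :=
    ((hZ'.hasWInt hE hu).neg.congr (L.lo_lt_hi k).le fun _ _ => neg_smul ..).wint_eq
  rw [h1, neg_mul, ((HasParity.kint (L.lo_lt_hi k).le he u).commute _).eq]

/-- The sign from exchanging the points is cancelled by the skew symmetry of `A`. -/
theorem pertSum_swap (hζ : IsPropagator L ζ) (hA : A.transpose = -A)
    {E E' : Fin 2 → Fin d → SForm d} (hE : IsEField L E) (hE' : IsEField L E') :
    pertSum L ζ A E E' = pertSum L ζ A E' E := by
  have hA' : ∀ i j, A i j = -A j i := fun i j => by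
    have := congrFun (congrFun hA j) i
    simpa using this
  rw [pertSum, Finset.sum_comm]
  refine Finset.sum_congr rfl fun l _ => Finset.sum_congr rfl fun k _ => ?_
  rw [Finset.sum_comm]
  refine Finset.sum_congr rfl fun j _ => Finset.sum_congr rfl fun i _ => ?_
  rw [hA' i j, pertPair_swap hζ k l (hE.smooth_one k i) (hE'.smooth_one l j) (hE.even k i)]
  simp

/-- The effective action as a quadratic form. -/
theorem effAction_eq (hζ : IsPropagator L ζ) (hA : A.transpose = -A) {Φ : Fields d}
    (hΦ : IsField L Φ) :
    effAction L ζ A Φ = freeSum L ζ Φ.E Φ.X - (1 / 2 : ℂ) • pertSum L ζ A Φ.E Φ.E := by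
  have hA' : ∀ i j, A i j = -A j i := fun i j => by
    have := congrFun (congrFun hA j) i
    simpa using this
  have hE := hΦ.2
  -- The mixed term appears once in the action and twice, in both orders, in `pertSum`. As the two
  -- are equal, the factor `1 / 2` becomes common to all terms.
  have h10 : ∑ i, ∑ j, (A i j : ℂ) • pertPair L ζ 1 0 (Φ.E 1 i) (Φ.E 0 j) =
      ∑ i, ∑ j, (A i j : ℂ) • pertPair L ζ 0 1 (Φ.E 0 i) (Φ.E 1 j) := by
    rw [Finset.sum_comm]
    refine Finset.sum_congr rfl fun i _ => Finset.sum_congr rfl fun j _ => ?_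
    rw [hA' j i, pertPair_swap hζ 1 0 (hE.smooth_one 1 j) (hE.smooth_one 0 i) (hE.even 1 j)]
    simp
  rw [effAction, freeAction_eq hζ hΦ, freeAction_eq hζ hΦ, pertIntegral_eq hζ hΦ,
    pertIntegral_eq hζ hΦ, pertIntegral_eq hζ hΦ, freeSum, pertSum]
  simp only [Fin.sum_univ_two, h10]
  module

/-! ### Variations -/

section Variation

variable {X δX : Fin d → SForm d} {E δE E' : Fin 2 → Fin d → SForm d}

theorem freeSum_shift_right (hζ : IsPropagator L ζ) (hE : IsEField L E) (hX : IsXField L X)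
    (hδ : IsXField L δX) (t : ℝ) :
    freeSum L ζ E (fun i => (X i).shift (δX i) t) =
      freeSum L ζ E X + (t : ℂ) • freeSum L ζ E δX := by
  simp only [freeSum, Finset.smul_sum, ← Finset.sum_add_distrib]
  refine Finset.sum_congr rfl fun k _ => Finset.sum_congr rfl fun i _ => ?_
  simp only [freePair, SForm.shift]
  rw [(hζ.isKernelU k).kpair_add_right (hE.smooth_one k i) (hX.smooth_zero i)
      ((hδ.smooth_zero i).const_smul _),
    (hζ.isKernelU k).kpair_smul_right (hE.smooth_one k i) (hδ.smooth_zero i),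
    (hζ.isKernelV k).kpair_add_right (hE.smooth_zero k i) (hX.smooth_one i)
      ((hδ.smooth_one i).const_smul _),
    (hζ.isKernelV k).kpair_smul_right (hE.smooth_zero k i) (hδ.smooth_one i)]
  module

theorem freeSum_shift_left (hζ : IsPropagator L ζ) (hE : IsEField L E) (hX : IsXField L X)
    (hδ : IsEField L δE) (t : ℝ) :
    freeSum L ζ (fun k i => (E k i).shift (δE k i) t) X =
      freeSum L ζ E X + (t : ℂ) • freeSum L ζ δE X := by
  simp only [freeSum, Finset.smul_sum, ← Finset.sum_add_distrib]
  refine Finset.sum_congr rfl fun k _ => Finset.sum_congr rfl fun i _ => ?_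
  simp only [freePair, SForm.shift]
  rw [(hζ.isKernelU k).kpair_add_left (hE.smooth_one k i) ((hδ.smooth_one k i).const_smul _)
      (hX.smooth_zero i),
    (hζ.isKernelU k).kpair_smul_left (hδ.smooth_one k i) (hX.smooth_zero i),
    (hζ.isKernelV k).kpair_add_left (hE.smooth_zero k i) ((hδ.smooth_zero k i).const_smul _)
      (hX.smooth_one i),
    (hζ.isKernelV k).kpair_smul_left (hδ.smooth_zero k i) (hX.smooth_one i)]
  module

theorem pertSum_shift_right (hζ : IsPropagator L ζ) (hE : IsEField L E) (hE' : IsEField L E')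
    (hδ : IsEField L δE) (t : ℝ) :
    pertSum L ζ A E (fun k i => (E' k i).shift (δE k i) t) =
      pertSum L ζ A E E' + (t : ℂ) • pertSum L ζ A E δE := by
  simp only [pertSum, Finset.smul_sum, ← Finset.sum_add_distrib]
  refine Finset.sum_congr rfl fun k _ => Finset.sum_congr rfl fun l _ =>
    Finset.sum_congr rfl fun i _ => Finset.sum_congr rfl fun j _ => ?_
  simp only [pertPair, SForm.shift]
  rw [(hζ.isKernelZ k l).kpair_add_right (hE.smooth_one k i) (hE'.smooth_one l j)
      ((hδ.smooth_one l j).const_smul _),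
    (hζ.isKernelZ k l).kpair_smul_right (hE.smooth_one k i) (hδ.smooth_one l j)]
  module

theorem pertSum_shift (hζ : IsPropagator L ζ) (hA : A.transpose = -A) (hE : IsEField L E)
    (hδ : IsEField L δE) (t : ℝ) :
    pertSum L ζ A (fun k i => (E k i).shift (δE k i) t) (fun k i => (E k i).shift (δE k i) t) =
      pertSum L ζ A E E + (t : ℂ) • (2 : ℂ) • pertSum L ζ A δE E
        + ((t : ℂ) ^ 2) • pertSum L ζ A δE δE := by
  rw [pertSum_shift_right hζ (hE.shift hδ t) hE hδ, pertSum_swap hζ hA (hE.shift hδ t) hE,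
    pertSum_swap hζ hA (hE.shift hδ t) hδ, pertSum_shift_right hζ hE hE hδ,
    pertSum_shift_right hζ hδ hE hδ, pertSum_swap hζ hA hE hδ]
  module

theorem even_freeSum (hE : IsEField L E) (hX : IsXField L X) :
    HasParity 0 (freeSum L ζ E X) := by
  refine HasParity.sum _ fun k _ => HasParity.sum _ fun i _ => ?_
  exact (HasParity.kpair (L.lo_lt_hi k).le L.θ01.le (hE.even k i) (hX.even i)).add
    (HasParity.kpair (p := 1) (q := 1) (L.lo_lt_hi k).le L.θ01.le (hE.odd k i) (hX.odd i))

theorem even_pertSum (hE : IsEField L E) (hE' : IsEField L E') :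
    HasParity 0 (pertSum L ζ A E E') :=
  HasParity.sum _ fun k _ => HasParity.sum _ fun l _ => HasParity.sum _ fun i _ =>
    HasParity.sum _ fun j _ => (HasParity.kpair (L.lo_lt_hi k).le (L.lo_lt_hi l).le
      (hE.even k i) (hE'.even l j)).smul _

end Variation


end

section

variable {d : ℕ} {L : L3} {ζ : ℂ × ℂ → (ℂ × ℂ →L[ℝ] ℝ)} {A : Matrix (Fin d) (Fin d) ℝ}
  {X δX : Fin d → SForm d} {E δE E' : Fin 2 → Fin d → SForm d}

/-! ### Functional derivatives of the effective action -/

namespace SForm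

/-- Multiplication of a form by a coefficient from the right. -/
def mulRight (ϖ : SForm d) (c : Coef d) : SForm d := ⟨fun t => ϖ.zero t * c, fun t => ϖ.one t * c⟩

theorem IsSmooth.mulRight {a b : ℝ} {ϖ : SForm d} (h : ϖ.IsSmooth a b) (c : Coef d) :
    (ϖ.mulRight c).IsSmooth a b := ⟨h.1.mul (.const c), h.2.mul (.const c)⟩

theorem wedge_mulRight (ϖ τ : SForm d) (c : Coef d) :
    ϖ.wedge (τ.mulRight c) = (ϖ.wedge τ).mulRight c := by
  ext t
  · simp [wedge, mulRight, mul_assoc]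
  · simp [wedge, mulRight, mul_assoc, add_mul]

theorem integral_mulRight {a b : ℝ} {ϖ : SForm d} (hab : a ≤ b)
    (h : SmoothCoef ϖ.one (Icc a b)) (c : Coef d) :
    (ϖ.mulRight c).integral a b = ϖ.integral a b * c := ((h.hasWInt hab).mul_right c).wint_eq

theorem smoothCoef_inv {f : ℝ → Coef d} {s : Set ℝ} (h : SmoothCoef f s) :
    SmoothCoef (fun t => inv (f t)) s := h.linear invₗ

theorem IsSmooth.wedge {a b : ℝ} {ϖ τ : SForm d} (h : ϖ.IsSmooth a b) (h' : τ.IsSmooth a b) :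
    (ϖ.wedge τ).IsSmooth a b :=
  ⟨h.1.mul h'.1, (h.2.mul h'.1).add ((smoothCoef_inv h.1).mul h'.2)⟩

theorem integral_wedge_mulRight {a b : ℝ} {ϖ τ : SForm d} (hab : a ≤ b) (h : ϖ.IsSmooth a b)
    (h' : τ.IsSmooth a b) (c : Coef d) :
    (ϖ.wedge (τ.mulRight c)).integral a b = (ϖ.wedge τ).integral a b * c := by
  rw [wedge_mulRight, integral_mulRight hab (h.wedge h').2]

end SForm

/-- The derivative of the effective action along `X`. -/
def gradX (L : L3) (ζ : ℂ × ℂ → (ℂ × ℂ →L[ℝ] ℝ)) (E : Fin 2 → Fin d → SForm d) (i : Fin d) :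
    SForm d :=
  ⟨fun u => -∑ k, kint (L.lo k) (L.hi k) (fun u v => kerV ζ (v, u)) (E k i).zero u,
    fun u => ∑ k, kint (L.lo k) (L.hi k) (fun u v => kerU ζ (v, u)) (E k i).one u⟩

/-- The derivative of the effective action along `E`. -/
def gradE (L : L3) (ζ : ℂ × ℂ → (ℂ × ℂ →L[ℝ] ℝ)) (A : Matrix (Fin d) (Fin d) ℝ)
    (X : Fin d → SForm d) (E : Fin 2 → Fin d → SForm d) (i : Fin d) : SForm d :=
  ⟨fun v => kint (L.θ 0) (L.θ 1) (fun v u => kerU ζ (v, u)) (X i).zero v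
      - ∑ l, ∑ j, (A i j : ℂ) • kint (L.lo l) (L.hi l) (kerZ ζ) (E l j).one v,
    fun v => -kint (L.θ 0) (L.θ 1) (fun v u => kerV ζ (v, u)) (X i).one v⟩

theorem isSmooth_gradX (hζ : IsPropagator L ζ) (hE : IsEField L E) (i : Fin d) :
    (gradX L ζ E i).IsSmooth (L.θ 0) (L.θ 1) :=
  ⟨(SmoothCoef.sum _ fun k _ => (hζ.isKernelV k).swap.smoothCoef_kint (hE.smooth_zero k i)).neg,
    SmoothCoef.sum Finset.univ fun k _ => (hζ.isKernelU k).swap.smoothCoef_kint (hE.smooth_one k i)⟩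

theorem isSmooth_gradE (hζ : IsPropagator L ζ) (hX : IsXField L X) (hE : IsEField L E)
    (k : Fin 2) (i : Fin d) : (gradE L ζ A X E i).IsSmooth (L.lo k) (L.hi k) :=
  ⟨((hζ.isKernelU k).smoothCoef_kint (hX.smooth_zero i)).sub
      (SmoothCoef.sum _ fun l _ => SmoothCoef.sum _ fun j _ =>
        ((hζ.isKernelZ k l).smoothCoef_kint (hE.smooth_one l j)).const_smul _),
    ((hζ.isKernelV k).smoothCoef_kint (hX.smooth_one i)).neg⟩

theorem even_gradX_one (hE : IsEField L E) (i : Fin d) (u : ℝ) :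
    HasParity 0 ((gradX L ζ E i).one u) :=
  HasParity.sum Finset.univ fun k _ => HasParity.kint (L.lo_lt_hi k).le (hE.even k i) u

/-- Fubini's theorem brings the integration over `∂₂` inside. Moving the variation to the left
exchanges two odd factors in the one-form component, which explains the minus sign in `gradX`. -/
theorem freeSum_eq_gradX (hζ : IsPropagator L ζ) (hE : IsEField L E) (hδ : IsXField L δX) :
    freeSum L ζ E δX = ∑ i, ((δX i).wedge (gradX L ζ E i)).integral (L.θ 0) (L.θ 1) := by
  rw [freeSum, Finset.sum_comm]
  refine Finset.sum_congr rfl fun i _ => ?_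
  have h : HasWInt (fun u => ∑ k,
      (kint (L.lo k) (L.hi k) (fun u v => kerU ζ (v, u)) (E k i).one u * (δX i).zero u
      + kint (L.lo k) (L.hi k) (fun u v => kerV ζ (v, u)) (E k i).zero u * (δX i).one u))
      (L.θ 0) (L.θ 1) (∑ k, freePair L ζ k (E k i) (δX i)) := by
    refine HasWInt.finsetSum _ fun k _ => ?_
    have hU := hζ.isKernelU k
    have hV := hζ.isKernelV k
    rw [freePair, kpair, kpair, hU.wint_mul_kint (hE.smooth_one k i) (hδ.smooth_zero i),
      hV.wint_mul_kint (hE.smooth_zero k i) (hδ.smooth_one i)]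
    exact (((hU.swap.smoothCoef_kint (hE.smooth_one k i)).mul (hδ.smooth_zero i)).hasWInt
      L.θ01.le).add (((hV.swap.smoothCoef_kint (hE.smooth_zero k i)).mul
        (hδ.smooth_one i)).hasWInt L.θ01.le)
  refine ((h.congr L.θ01.le fun u hu => ?_).wint_eq).symm
  simp only [SForm.wedge, gradX, Finset.sum_add_distrib]
  rw [(hδ.even i u hu).inv_even, mul_neg, ← neg_mul, Finset.mul_sum, Finset.mul_sum, add_comm]
  congr 1
  · exact Finset.sum_congr rfl fun k _ => (hδ.even i u hu).commute _
  · refine Finset.sum_congr rfl fun k _ => ?_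
    rw [neg_mul, (hδ.odd i u hu).anticommute (HasParity.kint (L.lo_lt_hi k).le (hE.odd k i) u),
      neg_neg]

/-- The variation already stands on the left. Its odd component meets the form symbol of `gradE`,
and the minus sign in the one-form part of `gradE` compensates this. -/
theorem freeSum_sub_pertSum_eq_gradE (hζ : IsPropagator L ζ) (hX : IsXField L X)
    (hE : IsEField L E) (hδ : IsEField L δE) :
    freeSum L ζ δE X - pertSum L ζ A δE E =
      ∑ k, ∑ i, ((δE k i).wedge (gradE L ζ A X E i)).integral (L.lo k) (L.hi k) := by
  have e : pertSum L ζ A δE E =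
      ∑ k, ∑ i, ∑ l, ∑ j, (A i j : ℂ) • pertPair L ζ k l (δE k i) (E l j) :=
    Finset.sum_congr rfl fun k _ => Finset.sum_comm
  rw [e, freeSum, ← Finset.sum_sub_distrib]
  refine Finset.sum_congr rfl fun k _ => ?_
  rw [← Finset.sum_sub_distrib]
  refine Finset.sum_congr rfl fun i _ => ?_
  have hab := (L.lo_lt_hi k).le
  have h1 := (((hδ.smooth_one k i).mul
    ((hζ.isKernelU k).smoothCoef_kint (hX.smooth_zero i))).hasWInt hab).add
    (((hδ.smooth_zero k i).mul ((hζ.isKernelV k).smoothCoef_kint (hX.smooth_one i))).hasWInt hab)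
  have h2 : HasWInt (fun v => ∑ l, ∑ j, (A i j : ℂ) •
      ((δE k i).one v * kint (L.lo l) (L.hi l) (kerZ ζ) (E l j).one v)) (L.lo k) (L.hi k)
      (∑ l, ∑ j, (A i j : ℂ) • pertPair L ζ k l (δE k i) (E l j)) :=
    HasWInt.finsetSum _ fun l _ => HasWInt.finsetSum _ fun j _ =>
      (((hδ.smooth_one k i).mul ((hζ.isKernelZ k l).smoothCoef_kint
        (hE.smooth_one l j))).hasWInt hab).const_smul _
  refine (((h1.sub h2).congr hab fun v hv => ?_).wint_eq).symm
  simp only [SForm.wedge, gradE]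
  rw [(hδ.odd k i v hv).inv_odd, neg_mul_neg, mul_sub]
  simp only [Finset.mul_sum, mul_smul_comm]
  abel

theorem sum_integral_gradX (hζ : IsPropagator L ζ) (hE : IsEField L E) (hδ : IsXField L δX)
    (c : Coef d) :
    ∑ i, ((δX i).wedge ((gradX L ζ E i).mulRight c)).integral (L.θ 0) (L.θ 1) =
      freeSum L ζ E δX * c := by
  rw [freeSum_eq_gradX hζ hE hδ, Finset.sum_mul]
  exact Finset.sum_congr rfl fun i _ =>
    SForm.integral_wedge_mulRight L.θ01.le (hδ i).1 (isSmooth_gradX hζ hE i) c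

theorem sum_integral_gradE (hζ : IsPropagator L ζ) (hX : IsXField L X) (hE : IsEField L E)
    (hδ : IsEField L δE) (c : Coef d) :
    ∑ k, ∑ i, ((δE k i).wedge ((gradE L ζ A X E i).mulRight c)).integral (L.lo k) (L.hi k) =
      (freeSum L ζ δE X - pertSum L ζ A δE E) * c := by
  rw [freeSum_sub_pertSum_eq_gradE hζ hX hE hδ, Finset.sum_mul]
  refine Finset.sum_congr rfl fun k _ => ?_
  rw [Finset.sum_mul]
  exact Finset.sum_congr rfl fun i _ =>
    SForm.integral_wedge_mulRight (L.lo_lt_hi k).le (hδ k i).1 (isSmooth_gradE hζ hX hE k i) c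

/-! ### Functional derivatives of the state -/

/-- The state for the matrix `A`. -/
def expAction (L : L3) (ζ : ℂ × ℂ → (ℂ × ℂ →L[ℝ] ℝ)) (A : Matrix (Fin d) (Fin d) ℝ) (ħ : ℝ)
    (Φ : Fields d) : Coef d := gexp ((Complex.I / ħ) • effAction L ζ A Φ)

theorem even_effAction (hζ : IsPropagator L ζ) (hA : A.transpose = -A) {Φ : Fields d}
    (hΦ : IsField L Φ) : HasParity 0 (effAction L ζ A Φ) := by
  rw [effAction_eq hζ hA hΦ]
  exact (even_freeSum hΦ.2 hΦ.1).sub ((even_pertSum hΦ.2 hΦ.2).smul _)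

/-- The action is affine in `X`, so the curve in `hasWDeriv_gexp` has no quadratic term. -/
theorem hasWDeriv_expAction_X (hζ : IsPropagator L ζ) (hA : A.transpose = -A) (ħ : ℝ)
    {Φ : Fields d} (hΦ : IsField L Φ) (hδ : IsXField L δX) :
    HasWDeriv (fun t => expAction L ζ A ħ ⟨fun i => (Φ.X i).shift (δX i) t, Φ.E⟩)
      ((Complex.I / ħ) • (freeSum L ζ Φ.E δX * expAction L ζ A ħ Φ)) univ 0 := by
  have h := hasWDeriv_gexp ((even_effAction hζ hA hΦ).smul (Complex.I / ħ))
    ((even_freeSum (ζ := ζ) hΦ.2 hδ).smul (Complex.I / ħ)) HasParity.zero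
  rw [smul_mul_assoc] at h
  refine h.congr (fun t _ => ?_) (mem_univ _)
  have ht : IsField L ⟨fun i => (Φ.X i).shift (δX i) t, Φ.E⟩ := ⟨hΦ.1.shift hδ t, hΦ.2⟩
  rw [expAction, effAction_eq hζ hA ht, effAction_eq hζ hA hΦ,
    freeSum_shift_right hζ hΦ.2 hΦ.1 hδ]
  congr 1
  module

/-- The action is quadratic in `E`. Symmetry of `pertSum` doubles the linear term, which removes its
factor `1 / 2`. -/
theorem hasWDeriv_expAction_E (hζ : IsPropagator L ζ) (hA : A.transpose = -A) (ħ : ℝ)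
    {Φ : Fields d} (hΦ : IsField L Φ) (hδ : IsEField L δE) :
    HasWDeriv (fun t => expAction L ζ A ħ ⟨Φ.X, fun k i => (Φ.E k i).shift (δE k i) t⟩)
      ((Complex.I / ħ) • ((freeSum L ζ δE Φ.X - pertSum L ζ A δE Φ.E) * expAction L ζ A ħ Φ))
      univ 0 := by
  have h := hasWDeriv_gexp ((even_effAction hζ hA hΦ).smul (Complex.I / ħ))
    (((even_freeSum (ζ := ζ) hδ hΦ.1).sub (even_pertSum (ζ := ζ) (A := A) hδ hΦ.2)).smul
      (Complex.I / ħ))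
    ((even_pertSum (ζ := ζ) (A := A) hδ hδ).smul (-(1 / 2) * (Complex.I / ħ)))
  rw [smul_mul_assoc] at h
  refine h.congr (fun t _ => ?_) (mem_univ _)
  have ht : IsField L ⟨Φ.X, fun k i => (Φ.E k i).shift (δE k i) t⟩ := ⟨hΦ.1, hΦ.2.shift hδ t⟩
  rw [expAction, effAction_eq hζ hA ht, effAction_eq hζ hA hΦ,
    freeSum_shift_left hζ hΦ.2 hΦ.1 hδ, pertSum_shift hζ hA hΦ.2 hδ]
  congr 1
  module

/-- The functional derivatives of the state along `X`. -/
theorem hasXDeriv_expAction (hζ : IsPropagator L ζ) (hA : A.transpose = -A) (ħ : ℝ)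
    {Φ : Fields d} (hΦ : IsField L Φ) :
    HasXDeriv L (expAction L ζ A ħ) Φ
      fun i => (gradX L ζ Φ.E i).mulRight ((Complex.I / ħ) • expAction L ζ A ħ Φ) := by
  refine ⟨fun i => (isSmooth_gradX hζ hΦ.2 i).mulRight _, fun δ hδ => ?_⟩
  have h := hasWDeriv_expAction_X hζ hA ħ hΦ hδ
  rwa [← mul_smul_comm, ← sum_integral_gradX hζ hΦ.2 hδ] at h

/-- The functional derivatives of the state along `E`. -/
theorem hasEDeriv_expAction (hζ : IsPropagator L ζ) (hA : A.transpose = -A) (ħ : ℝ)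
    {Φ : Fields d} (hΦ : IsField L Φ) :
    HasEDeriv L (expAction L ζ A ħ) Φ
      fun _ i => (gradE L ζ A Φ.X Φ.E i).mulRight ((Complex.I / ħ) • expAction L ζ A ħ Φ) := by
  refine ⟨fun k i => (isSmooth_gradE hζ hΦ.1 hΦ.2 k i).mulRight _, fun δ hδ => ?_⟩
  have h := hasWDeriv_expAction_E hζ hA ħ hΦ hδ
  rwa [← mul_smul_comm, ← sum_integral_gradE hζ hΦ.1 hΦ.2 hδ] at h

/-- The functional derivatives along `X` of the functional derivatives of the state, multiplied
from the left by a coefficient. -/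
theorem hasXDeriv_mul_expAction (hζ : IsPropagator L ζ) (hA : A.transpose = -A) (ħ : ℝ)
    {Φ : Fields d} (hΦ : IsField L Φ) {F : Fields d → Coef d} {c : (Fin 2 → Fin d → SForm d) → Coef d}
    (hF : ∀ X, IsXField L X →
      F ⟨X, Φ.E⟩ = c Φ.E * ((Complex.I / ħ) • expAction L ζ A ħ ⟨X, Φ.E⟩)) :
    HasXDeriv L F Φ fun i => (gradX L ζ Φ.E i).mulRight
      ((Complex.I / ħ) ^ 2 • (c Φ.E * expAction L ζ A ħ Φ)) := by
  refine ⟨fun i => (isSmooth_gradX hζ hΦ.2 i).mulRight _, fun δ hδ => ?_⟩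
  have h := ((hasWDeriv_expAction_X hζ hA ħ hΦ hδ).const_smul (Complex.I / ħ)).mul_left (c Φ.E)
  have h' := h.congr (g := fun t => F ⟨fun i => (Φ.X i).shift (δ i) t, Φ.E⟩)
    (fun t _ => hF _ (hΦ.1.shift hδ t)) (mem_univ _)
  convert h' using 1
  -- The even element `freeSum` passes the coefficient `c`, whatever its parity.
  rw [sum_integral_gradX hζ hΦ.2 hδ, mul_smul_comm, mul_smul_comm, mul_smul_comm, smul_smul, ← pow_two, ← mul_assoc, ← mul_assoc,
    ((even_freeSum hΦ.2 hδ).commute (c Φ.E)).eq]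


end

section

variable {d : ℕ} {L : L3}

/-! ### Uniqueness of functional derivatives -/

/-- The fundamental lemma of the calculus of variations. -/
theorem eq_zero_of_forall_integral_mul {g : ℝ → ℂ} {a b : ℝ} (hab : a < b)
    (hg : ContDiffOn ℝ ∞ g (Icc a b))
    (h : ∀ φ : ℝ → ℂ, ContDiffOn ℝ ∞ φ (Icc a b) → φ a = 0 → φ b = 0 →
      ∫ t in a..b, φ t * g t = 0) : ∀ t ∈ Icc a b, g t = 0 := by
  -- The test function is the conjugate of `g` with a weight that is positive inside and zero at the
  -- ends, since variations of `E` have to vanish there.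
  have hφ : ContDiffOn ℝ ∞ (fun t => (starRingEnd ℂ (g t)) * (((t - a) * (b - t) : ℝ) : ℂ))
      (Icc a b) := by
    refine (Complex.conjCLE.contDiff.comp_contDiffOn hg).mul
      (Complex.ofRealCLM.contDiff.comp_contDiffOn (ContDiff.contDiffOn ?_))
    exact (contDiff_id.sub contDiff_const).mul (contDiff_const.sub contDiff_id)
  have h0 := h _ hφ (by simp) (by simp)
  have e : ∀ t, (starRingEnd ℂ (g t)) * (((t - a) * (b - t) : ℝ) : ℂ) * g t =
      ((Complex.normSq (g t) * ((t - a) * (b - t)) : ℝ) : ℂ) := fun t => by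
    rw [Complex.ofReal_mul (Complex.normSq _), Complex.normSq_eq_conj_mul_self]
    ring
  simp only [e] at h0
  rw [intervalIntegral.integral_ofReal, Complex.ofReal_eq_zero] at h0
  have hin : EqOn g (fun _ => 0) (Ioo a b) := by
    intro t ht
    by_contra hne
    refine absurd h0 (ne_of_gt (intervalIntegral.integral_pos hab ?_ (fun x hx => ?_)
      ⟨t, ⟨ht.1.le, ht.2.le⟩, ?_⟩))
    · refine (Complex.continuous_normSq.comp_continuousOn hg.continuousOn).mul ?_
      fun_prop
    · exact mul_nonneg (Complex.normSq_nonneg _)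
        (mul_nonneg (by linarith [hx.1]) (by linarith [hx.2]))
    · exact mul_pos (Complex.normSq_pos.2 hne) (mul_pos (by linarith [ht.1]) (by linarith [ht.2]))
  have := hin.of_subset_closure (t := Icc a b) hg.continuousOn continuousOn_const Ioo_subset_Icc_self
    (by rw [closure_Ioo hab.ne])
  exact fun t ht => this ht

theorem SmoothCoef.eq_of_forall_wint_smul {f g : ℝ → Coef d} {a b : ℝ} (hab : a < b)
    (hf : SmoothCoef f (Icc a b)) (hg : SmoothCoef g (Icc a b))
    (h : ∀ φ : ℝ → ℂ, ContDiffOn ℝ ∞ φ (Icc a b) → φ a = 0 → φ b = 0 →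
      wint a b (fun t => φ t • f t) = wint a b (fun t => φ t • g t)) :
    ∀ t ∈ Icc a b, f t = g t := by
  intro t ht
  refine Coef.ext_dual fun l => sub_eq_zero.1 ?_
  refine eq_zero_of_forall_integral_mul hab (g := fun t => l (f t) - l (g t))
    ((hf.contDiffOn_dual l).sub (hg.contDiffOn_dual l)) (fun φ hφ ha hb => ?_) t ht
  have h1 := ((SmoothCoef.smul hφ hf).hasWInt hab.le) l
  have h2 := ((SmoothCoef.smul hφ hg).hasWInt hab.le) l
  have h3 := h φ hφ ha hb
  simp only [map_smul, smul_eq_mul] at h1 h2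
  simp only [mul_sub]
  rw [intervalIntegral.integral_sub h1.1 h2.1, h1.2, h2.2, h3, sub_self]

namespace SForm

theorem const_zero_wedge_integral (a b : ℝ) (K : SForm d) :
    ((const 0).wedge K).integral a b = 0 := by
  simp [integral, wedge, const, inv_zero]

theorem sum_update_wedge_integral {ι : Type*} [Fintype ι] [DecidableEq ι] (a b : ι → ℝ) (i : ι)
    (δ : SForm d) (K : ι → SForm d) :
    ∑ j, ((Function.update (fun _ => const 0) i δ j).wedge (K j)).integral (a j) (b j) =
      (δ.wedge (K i)).integral (a i) (b i) := by
  rw [Finset.sum_eq_single i, Function.update_self]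
  · intro j _ hj
    rw [Function.update_of_ne hj, const_zero_wedge_integral]
  · simp

theorem zero_eq_of_integral {a b : ℝ} (hab : a < b) {K K' : SForm d} (hK : K.IsSmooth a b)
    (hK' : K'.IsSmooth a b) (ξ : Coef d)
    (h : ∀ φ : ℝ → ℂ, ContDiffOn ℝ ∞ φ (Icc a b) → φ a = 0 → φ b = 0 →
      ((⟨fun _ => 0, fun t => φ t • ξ⟩ : SForm d).wedge K).integral a b =
        ((⟨fun _ => 0, fun t => φ t • ξ⟩ : SForm d).wedge K').integral a b) :
    ∀ t ∈ Icc a b, ξ * K.zero t = ξ * K'.zero t := by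
  refine SmoothCoef.eq_of_forall_wint_smul hab ((SmoothCoef.const ξ).mul hK.1)
    ((SmoothCoef.const ξ).mul hK'.1) fun φ hφ ha hb => ?_
  simpa [integral, wedge, inv_zero] using h φ hφ ha hb

theorem one_eq_of_integral {a b : ℝ} (hab : a < b) {K K' : SForm d} (hK : K.IsSmooth a b)
    (hK' : K'.IsSmooth a b) (ξ : Coef d)
    (h : ∀ φ : ℝ → ℂ, ContDiffOn ℝ ∞ φ (Icc a b) → φ a = 0 → φ b = 0 →
      ((⟨fun t => φ t • ξ, fun _ => 0⟩ : SForm d).wedge K).integral a b =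
        ((⟨fun t => φ t • ξ, fun _ => 0⟩ : SForm d).wedge K').integral a b) :
    ∀ t ∈ Icc a b, inv ξ * K.one t = inv ξ * K'.one t := by
  refine SmoothCoef.eq_of_forall_wint_smul hab ((SmoothCoef.const _).mul hK.2)
    ((SmoothCoef.const _).mul hK'.2) fun φ hφ ha hb => ?_
  simpa [integral, wedge, inv_smul] using h φ hφ ha hb

theorem isSmooth_const_zero (a b : ℝ) : (const (0 : Coef d)).IsSmooth a b :=
  ⟨SmoothCoef.const 0, SmoothCoef.const 0⟩

theorem hasTotalParity_const_zero (p : ZMod 2) (a b : ℝ) :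
    (const (0 : Coef d)).HasTotalParity p a b := fun _ _ => ⟨HasParity.zero, HasParity.zero⟩

end SForm

theorem isXField_update {δ : SForm d} (hs : δ.IsSmooth (L.θ 0) (L.θ 1))
    (hp : δ.HasTotalParity 0 (L.θ 0) (L.θ 1)) (i : Fin d) :
    IsXField L (Function.update (fun _ => SForm.const 0) i δ) := fun j => by
  rcases eq_or_ne j i with rfl | h
  · rw [Function.update_self]
    exact ⟨hs, hp⟩
  · rw [Function.update_of_ne h]
    exact ⟨SForm.isSmooth_const_zero _ _, SForm.hasTotalParity_const_zero _ _ _⟩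

theorem isEField_update {k : Fin 2} {δ : SForm d} (hs : δ.IsSmooth (L.lo k) (L.hi k))
    (hp : δ.HasTotalParity 1 (L.lo k) (L.hi k)) (ha : δ.zero (L.lo k) = 0)
    (hb : δ.zero (L.hi k) = 0) (i : Fin d) :
    IsEField L (Function.update (fun _ _ => SForm.const 0) k
      (Function.update (fun _ => SForm.const 0) i δ)) := fun l j => by
  rcases eq_or_ne l k with rfl | h
  · rw [Function.update_self]
    rcases eq_or_ne j i with rfl | h'
    · rw [Function.update_self]
      exact ⟨hs, hp, ha, hb⟩
    · rw [Function.update_of_ne h']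
      exact ⟨SForm.isSmooth_const_zero _ _, SForm.hasTotalParity_const_zero _ _ _, rfl, rfl⟩
  · rw [Function.update_of_ne h]
    exact ⟨SForm.isSmooth_const_zero _ _, SForm.hasTotalParity_const_zero _ _ _, rfl, rfl⟩

/-- Variations have fixed parity. The one-form component of `K` pairs with the even part of `δX` and
can be tested with `1`. The function component pairs with the odd part, is only known after
multiplication by odd elements, and is recovered by `eq_zero_of_odd_mul`. -/
theorem HasXDeriv.unique {F : Fields d → Coef d} {Φ : Fields d} {K K' : Fin d → SForm d}
    (h : HasXDeriv L F Φ K) (h' : HasXDeriv L F Φ K') (i : Fin d) :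
    ∀ u ∈ Icc (L.θ 0) (L.θ 1), (K i).zero u = (K' i).zero u ∧ (K i).one u = (K' i).one u := by
  have key : ∀ δ : SForm d, δ.IsSmooth (L.θ 0) (L.θ 1) → δ.HasTotalParity 0 (L.θ 0) (L.θ 1) →
      (δ.wedge (K i)).integral (L.θ 0) (L.θ 1) = (δ.wedge (K' i)).integral (L.θ 0) (L.θ 1) := by
    intro δ hs hp
    have e := (h.2 _ (isXField_update hs hp i)).unique (h'.2 _ (isXField_update hs hp i))
      uniqueDiffWithinAt_univ
    rwa [SForm.sum_update_wedge_integral (fun _ => L.θ 0) (fun _ => L.θ 1),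
      SForm.sum_update_wedge_integral (fun _ => L.θ 0) (fun _ => L.θ 1)] at e
  intro u hu
  constructor
  · refine sub_eq_zero.1 (eq_zero_of_odd_mul fun ξ hξ => ?_)
    rw [mul_sub, sub_eq_zero]
    exact SForm.zero_eq_of_integral L.θ01 (h.1 i) (h'.1 i) ξ (fun φ hφ _ _ =>
      key _ ⟨.const 0, .smul_const hφ ξ⟩ fun t _ => ⟨.zero, by simpa using hξ.smul (φ t)⟩) u hu
  · have := SForm.one_eq_of_integral L.θ01 (h.1 i) (h'.1 i) 1 (fun φ hφ _ _ =>
      key _ ⟨.smul_const hφ 1, .const 0⟩ fun t _ => ⟨HasParity.one.smul _, .zero⟩) u hu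
    simpa [HasParity.one.inv_even] using this

/-- The parities are opposite to those for `X`: now the one-form component of `K` needs odd test
coefficients, and its test functions have to vanish at the ends. -/
theorem HasEDeriv.unique {F : Fields d → Coef d} {Φ : Fields d} {K K' : Fin 2 → Fin d → SForm d}
    (h : HasEDeriv L F Φ K) (h' : HasEDeriv L F Φ K') (k : Fin 2) (i : Fin d) :
    ∀ v ∈ Icc (L.lo k) (L.hi k),
      (K k i).zero v = (K' k i).zero v ∧ (K k i).one v = (K' k i).one v := by
  have key : ∀ δ : SForm d, δ.IsSmooth (L.lo k) (L.hi k) →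
      δ.HasTotalParity 1 (L.lo k) (L.hi k) → δ.zero (L.lo k) = 0 → δ.zero (L.hi k) = 0 →
      (δ.wedge (K k i)).integral (L.lo k) (L.hi k) =
        (δ.wedge (K' k i)).integral (L.lo k) (L.hi k) := by
    intro δ hs hp ha hb
    have e := (h.2 _ (isEField_update hs hp ha hb i)).unique
      (h'.2 _ (isEField_update hs hp ha hb i)) uniqueDiffWithinAt_univ
    have red : ∀ K : Fin 2 → Fin d → SForm d,
        ∑ l, ∑ j, ((Function.update (fun _ _ => SForm.const 0) k
          (Function.update (fun _ => SForm.const 0) i δ) l j).wedge (K l j)).integral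
            (L.lo l) (L.hi l) = (δ.wedge (K k i)).integral (L.lo k) (L.hi k) := by
      intro K
      rw [Finset.sum_eq_single k, Function.update_self,
        SForm.sum_update_wedge_integral (fun _ => L.lo k) (fun _ => L.hi k)]
      · intro l _ hl
        rw [Function.update_of_ne hl]
        exact Finset.sum_eq_zero fun j _ => SForm.const_zero_wedge_integral _ _ _
      · simp
    rwa [red, red] at e
  intro v hv
  constructor
  · have := SForm.zero_eq_of_integral (L.lo_lt_hi k) (h.1 k i) (h'.1 k i) 1 (fun φ hφ _ _ =>
      key _ ⟨.const 0, .smul_const hφ 1⟩ (fun t _ => ⟨.zero, HasParity.one.smul _⟩) rfl rfl) v hv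
    simpa using this
  · refine sub_eq_zero.1 (eq_zero_of_odd_mul fun ξ hξ => ?_)
    have := SForm.one_eq_of_integral (L.lo_lt_hi k) (h.1 k i) (h'.1 k i) ξ (fun φ hφ ha hb =>
      key _ ⟨.smul_const hφ ξ, .const 0⟩ (fun t _ => ⟨hξ.smul _, .zero⟩)
        (by simp [ha]) (by simp [hb])) v hv
    rw [hξ.inv_odd, neg_mul, neg_mul, neg_inj] at this
    rw [mul_sub, this, sub_self]

theorem HasXDeriv.xGrad_eq {F : Fields d → Coef d} {Φ : Fields d} {K : Fin d → SForm d}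
    (h : HasXDeriv L F Φ K) (i : Fin d) : ∀ u ∈ Icc (L.θ 0) (L.θ 1),
      (xGrad L F Φ i).zero u = (K i).zero u ∧ (xGrad L F Φ i).one u = (K i).one u := by
  have hex : ∃ K, HasXDeriv L F Φ K := ⟨K, h⟩
  rw [xGrad, dif_pos hex]
  exact hex.choose_spec.unique h i

theorem HasEDeriv.eGrad_eq {F : Fields d → Coef d} {Φ : Fields d} {K : Fin 2 → Fin d → SForm d}
    (h : HasEDeriv L F Φ K) (k : Fin 2) (i : Fin d) : ∀ v ∈ Icc (L.lo k) (L.hi k),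
      (eGrad L F Φ k i).zero v = (K k i).zero v ∧ (eGrad L F Φ k i).one v = (K k i).one v := by
  have hex : ∃ K, HasEDeriv L F Φ K := ⟨K, h⟩
  rw [eGrad, dif_pos hex]
  exact hex.choose_spec.unique h k i

theorem SForm.integral_wedge_congr {a b : ℝ} (hab : a ≤ b) (ϖ : SForm d) {K K' : SForm d}
    (h : ∀ t ∈ Icc a b, K.zero t = K'.zero t ∧ K.one t = K'.one t) :
    (ϖ.wedge K).integral a b = (ϖ.wedge K').integral a b :=
  wint_congr hab fun t ht => by simp only [wedge, (h t ht).1, (h t ht).2]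


end

section

variable {d : ℕ} {L : L3} {ζ : ℂ × ℂ → (ℂ × ℂ →L[ℝ] ℝ)} {A : Matrix (Fin d) (Fin d) ℝ}
  {X : Fin d → SForm d} {E : Fin 2 → Fin d → SForm d}

/-! ### Existence of the functional derivatives -/

theorem xGrad_expAction (hζ : IsPropagator L ζ) (hA : A.transpose = -A) (ħ : ℝ) {Φ : Fields d}
    (hΦ : IsField L Φ) (i : Fin d) {u : ℝ} (hu : u ∈ Icc (L.θ 0) (L.θ 1)) :
    (xGrad L (expAction L ζ A ħ) Φ i).zero u =
        (gradX L ζ Φ.E i).zero u * ((Complex.I / ħ) • expAction L ζ A ħ Φ) ∧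
      (xGrad L (expAction L ζ A ħ) Φ i).one u =
        (gradX L ζ Φ.E i).one u * ((Complex.I / ħ) • expAction L ζ A ħ Φ) :=
  (hasXDeriv_expAction hζ hA ħ hΦ).xGrad_eq i u hu

theorem hasXDeriv_xGrad_zero (hζ : IsPropagator L ζ) (hA : A.transpose = -A) (ħ : ℝ)
    {Φ : Fields d} (hΦ : IsField L Φ) (j : Fin d) {u : ℝ} (hu : u ∈ Icc (L.θ 0) (L.θ 1)) :
    HasXDeriv L (fun Ψ => (xGrad L (expAction L ζ A ħ) Ψ j).zero u) Φ fun i =>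
      (gradX L ζ Φ.E i).mulRight
        ((Complex.I / ħ) ^ 2 • ((gradX L ζ Φ.E j).zero u * expAction L ζ A ħ Φ)) :=
  hasXDeriv_mul_expAction hζ hA ħ hΦ (c := fun E => (gradX L ζ E j).zero u) fun X hX =>
    (xGrad_expAction hζ hA ħ (Φ := ⟨X, Φ.E⟩) ⟨hX, hΦ.2⟩ j hu).1

theorem hasXDeriv_xGrad_one (hζ : IsPropagator L ζ) (hA : A.transpose = -A) (ħ : ℝ)
    {Φ : Fields d} (hΦ : IsField L Φ) (j : Fin d) {u : ℝ} (hu : u ∈ Icc (L.θ 0) (L.θ 1)) :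
    HasXDeriv L (fun Ψ => (xGrad L (expAction L ζ A ħ) Ψ j).one u) Φ fun i =>
      (gradX L ζ Φ.E i).mulRight
        ((Complex.I / ħ) ^ 2 • ((gradX L ζ Φ.E j).one u * expAction L ζ A ħ Φ)) :=
  hasXDeriv_mul_expAction hζ hA ħ hΦ (c := fun E => (gradX L ζ E j).one u) fun X hX =>
    (xGrad_expAction hζ hA ħ (Φ := ⟨X, Φ.E⟩) ⟨hX, hΦ.2⟩ j hu).2

/-- The second functional derivative of the state on the diagonal. -/
theorem xxDiag_expAction (hζ : IsPropagator L ζ) (hA : A.transpose = -A) (ħ : ℝ)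
    {Φ : Fields d} (hΦ : IsField L Φ) (i j : Fin d) {u : ℝ} (hu : u ∈ Icc (L.θ 0) (L.θ 1)) :
    xxDiag L (expAction L ζ A ħ) Φ i j u =
      ((gradX L ζ Φ.E j).zero u * (gradX L ζ Φ.E i).one u
        - (gradX L ζ Φ.E i).zero u * (gradX L ζ Φ.E j).one u) *
        ((Complex.I / ħ) ^ 2 • expAction L ζ A ħ Φ) := by
  rw [xxDiag, ((hasXDeriv_xGrad_zero hζ hA ħ hΦ j hu).xGrad_eq i u hu).2,
    ((hasXDeriv_xGrad_one hζ hA ħ hΦ j hu).xGrad_eq i u hu).1]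
  simp only [SForm.mulRight]
  rw [← smul_mul_assoc, ← smul_mul_assoc, ← ((even_gradX_one hΦ.2 i u).commute _).eq]
  simp only [sub_mul, mul_smul_comm, smul_mul_assoc, mul_assoc, smul_sub]

theorem isRegular_expAction (hζ : IsPropagator L ζ) (hA : A.transpose = -A) (ħ : ℝ) :
    IsRegular L (expAction L ζ A ħ) := by
  refine ⟨fun Φ hΦ => ⟨⟨_, hasXDeriv_expAction hζ hA ħ hΦ⟩, ⟨_, hasEDeriv_expAction hζ hA ħ hΦ⟩⟩,
    fun Φ hΦ j u hu => ⟨⟨_, hasXDeriv_xGrad_zero hζ hA ħ hΦ j hu⟩,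
      ⟨_, hasXDeriv_xGrad_one hζ hA ħ hΦ j hu⟩⟩, fun Φ hΦ i j => ?_⟩
  have h := fun i => isSmooth_gradX hζ hΦ.2 i
  exact ((((h j).1.mul (h i).2).sub ((h i).1.mul (h j).2)).mul (.const _)).congr
    fun u hu => xxDiag_expAction hζ hA ħ hΦ i j hu

/-! ### Stokes' theorem on the boundary -/

theorem kint_kerV_boundary (hζ : IsPropagator L ζ) (k : Fin 2) {f : ℝ → Coef d} {u : ℝ}
    (hu : u = L.θ 0 ∨ u = L.θ 1) :
    kint (L.lo k) (L.hi k) (fun u v => kerV ζ (v, u)) f u = 0 := by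
  refine (hasWInt_zero.congr (L.lo_lt_hi k).le fun v hv => ?_).wint_eq
  simp only [hζ.kerV_eq_zero (L.Icc_subset_nbhdE k hv) hu, zero_smul]

/-- Integration by parts leaves no end point terms because `gradX` contains the component of the
propagator along `∂₂`, which vanishes at the ends of `∂₁`. The derivative of that component is
`kerD`. -/
theorem wint_wderiv_X (hζ : IsPropagator L ζ) (hX : IsXField L X) (hE : IsEField L E) (i : Fin d) :
    wint (L.θ 0) (L.θ 1)
        (fun u => wderiv (X i).zero (Icc (L.θ 0) (L.θ 1)) u * (gradX L ζ E i).zero u) =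
      ∑ k, kpair (L.lo k) (L.hi k) (L.θ 0) (L.θ 1) (fun v u => kerD ζ (v, u)) (E k i).zero
        (X i).zero := by
  have hu := uniqueDiffOn_Icc L.θ01
  have hD := fun k => (hζ.isKernelD k).swap.smoothCoef_kint (hE.smooth_zero k i)
  rw [wint_mul_wderiv (g := (gradX L ζ E i).zero)
    (g' := fun u => -∑ k, kint (L.lo k) (L.hi k) (fun u v => kerD ζ (v, u)) (E k i).zero u)
    L.θ01 (hX.smooth_zero i) (isSmooth_gradX hζ hE i).1
    (fun t ht => (hX.smooth_zero i).hasWDeriv_wderiv hu ht)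
    (fun t ht => (HasWDeriv.finsetSum Finset.univ fun k _ =>
      hζ.hasWDeriv_kintV k (hE.smooth_zero k i) ht).neg)]
  have h0 : (gradX L ζ E i).zero (L.θ 0) = 0 := by
    simp [gradX, kint_kerV_boundary hζ]
  have h1 : (gradX L ζ E i).zero (L.θ 1) = 0 := by
    simp [gradX, kint_kerV_boundary hζ]
  rw [h0, h1, mul_zero, mul_zero, sub_zero, zero_sub]
  have h : HasWInt (fun u => ∑ k,
      kint (L.lo k) (L.hi k) (fun u v => kerD ζ (v, u)) (E k i).zero u * (X i).zero u)
      (L.θ 0) (L.θ 1) (∑ k, kpair (L.lo k) (L.hi k) (L.θ 0) (L.θ 1) (fun v u => kerD ζ (v, u))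
        (E k i).zero (X i).zero) := by
    refine HasWInt.finsetSum _ fun k _ => ?_
    rw [kpair, (hζ.isKernelD k).wint_mul_kint (hE.smooth_zero k i) (hX.smooth_zero i)]
    exact ((hD k).mul (hX.smooth_zero i)).hasWInt L.θ01.le
  rw [(h.neg.congr L.θ01.le fun u hu => ?_).wint_eq, neg_neg]
  rw [mul_neg, Finset.mul_sum]
  congr 1
  exact Finset.sum_congr rfl fun k _ => (hX.even i u hu).commute _

/-- The end point terms vanish by the boundary condition on `E`, whatever `g` is. -/
theorem wint_wderiv_E (hE : IsEField L E) (k : Fin 2) (i : Fin d)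
    {g g' : ℝ → Coef d} (hg : SmoothCoef g (Icc (L.lo k) (L.hi k)))
    (hg' : ∀ v ∈ Icc (L.lo k) (L.hi k), HasWDeriv g (g' v) (Icc (L.lo k) (L.hi k)) v) :
    wint (L.lo k) (L.hi k) (fun v => wderiv (E k i).zero (Icc (L.lo k) (L.hi k)) v * g v) =
      -wint (L.lo k) (L.hi k) (fun v => (E k i).zero v * g' v) := by
  have hu := uniqueDiffOn_Icc (L.lo_lt_hi k)
  rw [wint_mul_wderiv (L.lo_lt_hi k) (hE.smooth_zero k i) hg
    (fun t ht => (hE.smooth_zero k i).hasWDeriv_wderiv hu ht) hg', (hE k i).2.2.1, (hE k i).2.2.2]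
  simp

/-- The product of the derivatives of the action along `X`, integrated over `∂₁`. -/
def pairXX (L : L3) (ζ : ℂ × ℂ → (ℂ × ℂ →L[ℝ] ℝ)) (E : Fin 2 → Fin d → SForm d) (i j : Fin d) :
    Coef d :=
  wint (L.θ 0) (L.θ 1) fun u => (gradX L ζ E i).zero u * (gradX L ζ E j).one u

/-- The product of the components of `E`, integrated over `∂₂`. -/
def pairEE (L : L3) (E : Fin 2 → Fin d → SForm d) (i j : Fin d) : Coef d :=
  ∑ k, wint (L.lo k) (L.hi k) fun v => (E k i).zero v * (E k j).one v

/-- Composition of the two operators through `∂₁` multiplies their kernels and integrates over `∂₁`,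
which is the definition of `kerC`. Fubini's theorem is applied with the scalar kernel as a Grassmann
valued function. -/
theorem kint_kerV_kint (hζ : IsPropagator L ζ) (k l : Fin 2) {f : ℝ → Coef d}
    (hf : SmoothCoef f (Icc (L.lo l) (L.hi l))) {v : ℝ} (hv : v ∈ Icc (L.lo k) (L.hi k)) :
    kint (L.θ 0) (L.θ 1) (fun v u => kerV ζ (v, u))
        (kint (L.lo l) (L.hi l) (fun u w => kerU ζ (w, u)) f) v =
      kint (L.lo l) (L.hi l) (kerC L ζ) f v := by
  have hV : ContDiffOn ℝ ∞ (fun u => kerV ζ (v, u)) (Icc (L.θ 0) (L.θ 1)) :=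
    hζ.contDiffOn_kerV.comp (f := fun u => (v, u)) (by fun_prop) fun u hu => ⟨L.Icc_subset_nbhdE k hv, L.Icc_subset_nbhdX hu⟩
  have hg : SmoothCoef (fun u => kerV ζ (v, u) • (1 : Coef d)) (Icc (L.θ 0) (L.θ 1)) :=
    .smul_const hV 1
  have h := (hζ.isKernelU l).swap.wint_mul_kint hg hf
  simp only [smul_one_mul] at h
  rw [kint, h]
  refine wint_congr (L.lo_lt_hi l).le fun w hw => ?_
  have hi : IntervalIntegrable (fun u => kerV ζ (v, u) * kerU ζ (w, u)) volume (L.θ 0) (L.θ 1) := by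
    simpa only [mul_comm] using (hζ.isKernelU l).int_snd _ hV w hw
  have h1 : kint (L.θ 0) (L.θ 1) (fun w u => kerU ζ (w, u))
      (fun u => kerV ζ (v, u) • (1 : Coef d)) w = kerC L ζ v w • 1 :=
    ((hasWInt_smul hi (1 : Coef d)).congr L.θ01.le fun u _ => by
      rw [smul_smul, mul_comm]).wint_eq
  exact (congrArg (· * f w) h1).trans (smul_one_mul _ _)

theorem pairXX_eq (hζ : IsPropagator L ζ) (hE : IsEField L E) (i j : Fin d) :
    pairXX L ζ E i j = -∑ k, ∑ l, kpair (L.lo k) (L.hi k) (L.lo l) (L.hi l) (kerC L ζ)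
      (E k i).zero (E l j).one := by
  have h : HasWInt (fun u => ∑ k, ∑ l,
      kint (L.lo k) (L.hi k) (fun u v => kerV ζ (v, u)) (E k i).zero u *
        kint (L.lo l) (L.hi l) (fun u v => kerU ζ (v, u)) (E l j).one u) (L.θ 0) (L.θ 1)
      (∑ k, ∑ l, kpair (L.lo k) (L.hi k) (L.lo l) (L.hi l) (kerC L ζ)
        (E k i).zero (E l j).one) := by
    refine HasWInt.finsetSum _ fun k _ => HasWInt.finsetSum _ fun l _ => ?_
    have hU := (hζ.isKernelU l).swap.smoothCoef_kint (hE.smooth_one l j)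
    have hV := (hζ.isKernelV k).swap.smoothCoef_kint (hE.smooth_zero k i)
    have e : kpair (L.lo k) (L.hi k) (L.lo l) (L.hi l) (kerC L ζ) (E k i).zero (E l j).one =
        wint (L.lo k) (L.hi k) fun v => (E k i).zero v * kint (L.θ 0) (L.θ 1)
          (fun v u => kerV ζ (v, u)) (kint (L.lo l) (L.hi l) (fun u w => kerU ζ (w, u))
            (E l j).one) v :=
      wint_congr (L.lo_lt_hi k).le fun v hv => by
        rw [kint_kerV_kint hζ k l (hE.smooth_one l j) hv]
    rw [e, (hζ.isKernelV k).wint_mul_kint (hE.smooth_zero k i) hU]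
    exact (hV.mul hU).hasWInt L.θ01.le
  refine (h.neg.congr L.θ01.le fun u _ => ?_).wint_eq
  simp only [gradX]
  rw [neg_mul, Finset.sum_mul_sum]

/-- Fubini's theorem against the constant `1` reduces this to the period of the propagator over
`∂₁`. -/
theorem wint_gradX_one (hζ : IsPropagator L ζ) (hE : IsEField L E) (i : Fin d) :
    wint (L.θ 0) (L.θ 1) (gradX L ζ E i).one = ∑ k, wint (L.lo k) (L.hi k) (E k i).one := by
  refine (HasWInt.finsetSum (Finset.univ : Finset (Fin 2)) fun k _ => ?_).wint_eq
  have hU := hζ.isKernelU k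
  have hs := (hU.swap.smoothCoef_kint (hE.smooth_one k i))
  have h := hU.wint_mul_kint (hE.smooth_one k i) (SmoothCoef.const (1 : Coef d))
  simp only [mul_one] at h
  have e : wint (L.lo k) (L.hi k) (E k i).one = wint (L.lo k) (L.hi k) fun v => (E k i).one v *
      kint (L.θ 0) (L.θ 1) (fun v u => kerU ζ (v, u)) (fun _ => (1 : Coef d)) v := by
    refine wint_congr (L.lo_lt_hi k).le fun v hv => ?_
    have hi : IntervalIntegrable (fun u => kerU ζ (v, u)) volume (L.θ 0) (L.θ 1) := by
      simpa using hU.int_snd (fun _ => 1) contDiffOn_const v hv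
    have h1 : kint (L.θ 0) (L.θ 1) (fun v u => kerU ζ (v, u)) (fun _ => (1 : Coef d)) v = 1 := by
      rw [kint, (hasWInt_smul hi (1 : Coef d)).wint_eq,
        hζ.integral_kerU (L.Icc_subset_nbhdE k hv), one_smul]
    rw [h1, mul_one]
  rw [e, h]
  exact hs.hasWInt L.θ01.le


end

section

variable {d : ℕ} {L : L3} {ζ : ℂ × ℂ → (ℂ × ℂ →L[ℝ] ℝ)} {A : Matrix (Fin d) (Fin d) ℝ}
  {X : Fin d → SForm d} {E : Fin 2 → Fin d → SForm d}

/-! ### The master equation -/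

/-- After integration by parts the derivative of `gradE` has three sources: the free kernel gives
`kerD`, the smooth part of `ζ̂` gives `kerC`, and its jump, present only for `l = k`, gives the
products of components of `E`. -/
theorem wint_wderiv_gradE (hζ : IsPropagator L ζ) (hX : IsXField L X) (hE : IsEField L E)
    (k : Fin 2) (i : Fin d) :
    wint (L.lo k) (L.hi k) (fun v => wderiv (E k i).zero (Icc (L.lo k) (L.hi k)) v *
        (gradE L ζ A X E i).zero v) =
      -kpair (L.lo k) (L.hi k) (L.θ 0) (L.θ 1) (fun v u => kerD ζ (v, u)) (E k i).zero (X i).zero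
      + ∑ l, ∑ j, (A i j : ℂ) • kpair (L.lo k) (L.hi k) (L.lo l) (L.hi l) (kerC L ζ)
          (E k i).zero (E l j).one
      - ∑ j, (A i j : ℂ) • wint (L.lo k) (L.hi k) (fun v => (E k i).zero v * (E k j).one v) := by
  have hab := (L.lo_lt_hi k).le
  have hs := hE.smooth_zero k i
  rw [wint_wderiv_E hE k i (isSmooth_gradE hζ hX hE k i).1 (fun v hv =>
    ((hζ.hasWDeriv_kintU k (hX.smooth_zero i) hv).add (HasWDeriv.finsetSum Finset.univ fun l _ =>
      HasWDeriv.finsetSum Finset.univ fun j _ =>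
        (hζ.hasWDeriv_kintZ k l (hE.smooth_one l j) hv).const_smul (A i j : ℂ)).neg).congr
        (fun _ _ => sub_eq_add_neg _ _) hv)]
  have h1 := (hs.mul ((hζ.isKernelD k).smoothCoef_kint (hX.smooth_zero i))).hasWInt hab
  have h2 : HasWInt (fun v => ∑ l, ∑ j, (A i j : ℂ) •
      ((E k i).zero v * kint (L.lo l) (L.hi l) (kerC L ζ) (E l j).one v)) (L.lo k) (L.hi k)
      (∑ l, ∑ j, (A i j : ℂ) • kpair (L.lo k) (L.hi k) (L.lo l) (L.hi l) (kerC L ζ)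
          (E k i).zero (E l j).one) :=
    HasWInt.finsetSum _ fun l _ => HasWInt.finsetSum _ fun j _ =>
      ((hs.mul ((hζ.isKernelC k l).smoothCoef_kint (hE.smooth_one l j))).hasWInt hab).const_smul _
  have h3 : HasWInt (fun v => ∑ j, (A i j : ℂ) • ((E k i).zero v * (E k j).one v))
      (L.lo k) (L.hi k) (∑ j, (A i j : ℂ) •
        wint (L.lo k) (L.hi k) (fun v => (E k i).zero v * (E k j).one v)) :=
    HasWInt.finsetSum _ fun j _ => ((hs.mul (hE.smooth_one k j)).hasWInt hab).const_smul _
  rw [(((h1.sub h2).add h3).congr hab fun v hv => ?_).wint_eq]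
  · rw [kpair]
    abel
  · have e : ∑ l, ∑ j, (A i j : ℂ) • (if k = l then -1 else 0 : ℂ) • (E l j).one v =
        -∑ j, (A i j : ℂ) • (E k j).one v := by
      rw [Finset.sum_eq_single k]
      · simp
      · intro l _ hl
        simp [hl.symm]
      · simp
    simp only [smul_add, Finset.sum_add_distrib]
    rw [e]
    simp only [mul_add, mul_neg, Finset.mul_sum, mul_smul_comm]
    abel

/-- The first-order operators without the background terms, applied to the effective action. -/
theorem wint_diff_sum (hζ : IsPropagator L ζ) (hX : IsXField L X) (hE : IsEField L E) :
    (∑ i, wint (L.θ 0) (L.θ 1)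
        (fun u => wderiv (X i).zero (Icc (L.θ 0) (L.θ 1)) u * (gradX L ζ E i).zero u))
      + (∑ k, ∑ i, wint (L.lo k) (L.hi k) (fun v => wderiv (E k i).zero
          (Icc (L.lo k) (L.hi k)) v * (gradE L ζ A X E i).zero v)) =
      -∑ i, ∑ j, (A i j : ℂ) • (pairXX L ζ E i j + pairEE L E i j) := by
  simp only [wint_wderiv_X hζ hX hE, wint_wderiv_gradE hζ hX hE, pairXX_eq hζ hE, pairEE,
    Finset.sum_add_distrib, Finset.sum_sub_distrib, smul_add, smul_neg, Finset.smul_sum,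
    Finset.sum_neg_distrib]
  have e1 : ∑ i : Fin d, ∑ k : Fin 2, kpair (L.lo k) (L.hi k) (L.θ 0) (L.θ 1)
        (fun v u => kerD ζ (v, u)) (E k i).zero (X i).zero =
      ∑ k, ∑ i, kpair (L.lo k) (L.hi k) (L.θ 0) (L.θ 1)
        (fun v u => kerD ζ (v, u)) (E k i).zero (X i).zero := Finset.sum_comm
  have e2 : ∑ k : Fin 2, ∑ i : Fin d, ∑ l : Fin 2, ∑ j : Fin d, (A i j : ℂ) •
        kpair (L.lo k) (L.hi k) (L.lo l) (L.hi l) (kerC L ζ) (E k i).zero (E l j).one =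
      ∑ i, ∑ j, ∑ k, ∑ l, (A i j : ℂ) •
        kpair (L.lo k) (L.hi k) (L.lo l) (L.hi l) (kerC L ζ) (E k i).zero (E l j).one := by
    rw [Finset.sum_comm]
    refine Finset.sum_congr rfl fun i _ => ?_
    rw [Finset.sum_comm (s := (Finset.univ : Finset (Fin d)))]
    exact Finset.sum_congr rfl fun k _ => Finset.sum_comm
  have e3 : ∑ k : Fin 2, ∑ i : Fin d, ∑ j : Fin d, (A i j : ℂ) •
        wint (L.lo k) (L.hi k) (fun v => (E k i).zero v * (E k j).one v) =
      ∑ i, ∑ j, ∑ k, (A i j : ℂ) •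
        wint (L.lo k) (L.hi k) (fun v => (E k i).zero v * (E k j).one v) := by
    rw [Finset.sum_comm]
    exact Finset.sum_congr rfl fun i _ => Finset.sum_comm
  -- With the sums in the same order, the `kerD` terms from `X` and from `E` are opposite and
  -- cancel.
  rw [e1, e2, e3]
  abel

theorem diff_wedge_mulRight_integral {a b : ℝ} (hab : a < b) {ϖ K : SForm d}
    (h : SmoothCoef ϖ.zero (Icc a b)) (hK : K.IsSmooth a b) (c : Coef d) :
    ((ϖ.diff a b).wedge (K.mulRight c)).integral a b =
      wint a b (fun t => wderiv ϖ.zero (Icc a b) t * K.zero t) * c := by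
  have hd : (ϖ.diff a b).IsSmooth a b := ⟨.const 0, h.wderiv (uniqueDiffOn_Icc hab)⟩
  rw [SForm.integral_wedge_mulRight hab.le hd hK]
  simp [SForm.integral, SForm.wedge, SForm.diff, inv_zero]

/-- By `wint_gradX_one` both sides contain the integral of the one-form component of `E` over `∂₂`.
The sign arises because the odd `dxⁱ` passes the form symbol on one side only. -/
theorem background_sum (hζ : IsPropagator L ζ) (hE : IsEField L E) (c : Coef d) :
    ∑ i, ((SForm.const (dx i)).wedge ((gradX L ζ E i).mulRight c)).integral (L.θ 0) (L.θ 1) =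
      -((∑ k, ∑ i, ((E k i).wedge (SForm.const (dx i))).integral (L.lo k) (L.hi k)) * c) := by
  have e1 : ∀ i, ((SForm.const (dx i)).wedge ((gradX L ζ E i).mulRight c)).integral
      (L.θ 0) (L.θ 1) = -(∑ k, dx i * wint (L.lo k) (L.hi k) (E k i).one) * c := fun i => by
    have hK := isSmooth_gradX hζ hE i
    have hc : (SForm.const (dx i)).IsSmooth (L.θ 0) (L.θ 1) := ⟨.const _, .const 0⟩
    rw [SForm.integral_wedge_mulRight L.θ01.le hc hK, ← Finset.mul_sum, ← wint_gradX_one hζ hE i]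
    congr 1
    refine (((hK.2.hasWInt L.θ01.le).mul_left (dx i)).neg.congr L.θ01.le fun u _ => ?_).wint_eq
    simp [SForm.wedge, SForm.const, (HasParity.dx i).inv_odd]
  have e2 : ∀ k i, ((E k i).wedge (SForm.const (dx i))).integral (L.lo k) (L.hi k) =
      dx i * wint (L.lo k) (L.hi k) (E k i).one := fun k i => by
    refine ((((hE.smooth_one k i).hasWInt (L.lo_lt_hi k).le).mul_left (dx i)).congr
      (L.lo_lt_hi k).le fun v hv => ?_).wint_eq
    simp [SForm.wedge, SForm.const, ((hE.even k i v hv).commute (dx i)).eq]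
  simp only [e1, e2]
  rw [← Finset.sum_mul, Finset.sum_neg_distrib, neg_mul, Finset.sum_comm]

/-- The background terms cancel by `background_sum`. The rest is `wint_diff_sum`, whose sign is
reversed by `iħ * (i/ħ) = -1`. -/
theorem omegaFree_expAction (hζ : IsPropagator L ζ) (hA : A.transpose = -A) {ħ : ℝ} (hħ : ħ ≠ 0)
    {Φ : Fields d} (hΦ : IsField L Φ) :
    omegaFree L ħ (expAction L ζ A ħ) Φ =
      (∑ i, ∑ j, (A i j : ℂ) • (pairXX L ζ Φ.E i j + pairEE L Φ.E i j)) *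
        expAction L ζ A ħ Φ := by
  have hX := hΦ.1
  have hE := hΦ.2
  set ψ := expAction L ζ A ħ Φ with hψ
  set c := (Complex.I / ħ) • ψ with hc
  have hx : ∀ (ϖ : SForm d) i,
      (ϖ.wedge (xGrad L (expAction L ζ A ħ) Φ i)).integral (L.θ 0) (L.θ 1) =
        (ϖ.wedge ((gradX L ζ Φ.E i).mulRight c)).integral (L.θ 0) (L.θ 1) := fun ϖ i =>
    SForm.integral_wedge_congr L.θ01.le ϖ ((hasXDeriv_expAction hζ hA ħ hΦ).xGrad_eq i)
  have he : ∀ (ϖ : SForm d) k i,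
      (ϖ.wedge (eGrad L (expAction L ζ A ħ) Φ k i)).integral (L.lo k) (L.hi k) =
        (ϖ.wedge ((gradE L ζ A Φ.X Φ.E i).mulRight c)).integral (L.lo k) (L.hi k) := fun ϖ k i =>
    SForm.integral_wedge_congr (L.lo_lt_hi k).le ϖ
      ((hasEDeriv_expAction hζ hA ħ hΦ).eGrad_eq k i)
  have hxd : ∀ i, (((Φ.X i).diff (L.θ 0) (L.θ 1)).wedge ((gradX L ζ Φ.E i).mulRight c)).integral
      (L.θ 0) (L.θ 1) = wint (L.θ 0) (L.θ 1) (fun u =>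
        wderiv (Φ.X i).zero (Icc (L.θ 0) (L.θ 1)) u * (gradX L ζ Φ.E i).zero u) * c := fun i =>
    diff_wedge_mulRight_integral L.θ01 (hX.smooth_zero i) (isSmooth_gradX hζ hE i) c
  have hed : ∀ k i, (((Φ.E k i).diff (L.lo k) (L.hi k)).wedge
      ((gradE L ζ A Φ.X Φ.E i).mulRight c)).integral (L.lo k) (L.hi k) =
        wint (L.lo k) (L.hi k) (fun v => wderiv (Φ.E k i).zero (Icc (L.lo k) (L.hi k)) v *
          (gradE L ζ A Φ.X Φ.E i).zero v) * c := fun k i =>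
    diff_wedge_mulRight_integral (L.lo_lt_hi k) (hE.smooth_zero k i) (isSmooth_gradE hζ hX hE k i) c
  rw [omegaFree]
  simp only [hx, he, hxd, hed]
  rw [background_sum hζ hE, ← hψ, ← mul_smul_comm, ← hc, neg_add_cancel_right]
  simp only [← Finset.sum_mul]
  rw [← add_mul, wint_diff_sum hζ hX hE, hc, mul_smul_comm, smul_smul]
  have hz : Complex.I * (ħ : ℂ) * (Complex.I / ħ) = -1 := by
    have : (ħ : ℂ) ≠ 0 := Complex.ofReal_ne_zero.2 hħ
    field_simp
    exact Complex.I_sq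
  rw [hz, neg_one_smul, neg_mul, neg_neg]

theorem sum_skew (hA : A.transpose = -A) (M : Fin d → Fin d → Coef d) :
    ∑ i, ∑ j, (A i j : ℂ) • (M j i - M i j) = -(2 : ℂ) • ∑ i, ∑ j, (A i j : ℂ) • M i j := by
  have hA' : ∀ i j, A i j = -A j i := fun i j => by
    have := congrFun (congrFun hA j) i
    simpa using this
  have e : ∑ i, ∑ j, (A i j : ℂ) • M j i = -∑ i, ∑ j, (A i j : ℂ) • M i j := by
    rw [Finset.sum_comm, ← Finset.sum_neg_distrib]
    refine Finset.sum_congr rfl fun j _ => ?_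
    rw [← Finset.sum_neg_distrib]
    refine Finset.sum_congr rfl fun i _ => ?_
    rw [hA' i j, Complex.ofReal_neg, neg_smul]
  simp only [smul_sub, Finset.sum_sub_distrib]
  rw [e]
  module

/-- Both the second derivative and `E ∧ E` are antisymmetrised in `i` and `j`. Contraction with the
skew matrix doubles them (`sum_skew`), which absorbs the factor `1 / 2`, and `ħ² (i/ħ)² = -1` gives
both the same sign. -/
theorem omegaPert_expAction (hζ : IsPropagator L ζ) (hA : A.transpose = -A) {ħ : ℝ} (hħ : ħ ≠ 0)
    {Φ : Fields d} (hΦ : IsField L Φ) :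
    omegaPert L A ħ (expAction L ζ A ħ) Φ =
      -((∑ i, ∑ j, (A i j : ℂ) • (pairXX L ζ Φ.E i j + pairEE L Φ.E i j)) *
        expAction L ζ A ħ Φ) := by
  have hE := hΦ.2
  set ψ := expAction L ζ A ħ Φ with hψ
  have hK := fun i => isSmooth_gradX hζ hE i
  have hz : (ħ : ℂ) ^ 2 * (Complex.I / ħ) ^ 2 = -1 := by
    have : (ħ : ℂ) ≠ 0 := Complex.ofReal_ne_zero.2 hħ
    field_simp
    exact Complex.I_sq
  have h1 : ∀ i j, (ħ : ℂ) ^ 2 • wint (L.θ 0) (L.θ 1) (xxDiag L (expAction L ζ A ħ) Φ i j) =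
      -((pairXX L ζ Φ.E j i - pairXX L ζ Φ.E i j) * ψ) := fun i j => by
    have h := (((((hK j).1.mul (hK i).2).hasWInt L.θ01.le).sub
      (((hK i).1.mul (hK j).2).hasWInt L.θ01.le)).mul_right
      ((Complex.I / ħ) ^ 2 • ψ)).congr L.θ01.le fun u hu => xxDiag_expAction hζ hA ħ hΦ i j hu
    rw [h.wint_eq, mul_smul_comm, smul_smul, hz, neg_one_smul]
    rfl
  have h2 : ∀ i j, ∑ k, ((Φ.E k i).wedge (Φ.E k j)).integral (L.lo k) (L.hi k) =
      pairEE L Φ.E j i - pairEE L Φ.E i j := fun i j => by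
    rw [pairEE, pairEE, ← Finset.sum_sub_distrib]
    refine Finset.sum_congr rfl fun k _ => ?_
    have hab := (L.lo_lt_hi k).le
    refine (((((hE.smooth_zero k j).mul (hE.smooth_one k i)).hasWInt hab).sub
      (((hE.smooth_zero k i).mul (hE.smooth_one k j)).hasWInt hab)).congr hab
      fun v hv => ?_).wint_eq
    simp only [SForm.wedge]
    rw [((hE.even k i v hv).commute _).eq, (hE.odd k i v hv).inv_odd, neg_mul, sub_eq_add_neg]
  rw [omegaPert]
  simp only [h1, h2, ← hψ]
  have h3 : ∀ i j, -((pairXX L ζ Φ.E j i - pairXX L ζ Φ.E i j) * ψ)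
      - (pairEE L Φ.E j i - pairEE L Φ.E i j) * ψ =
      -(((pairXX L ζ Φ.E j i + pairEE L Φ.E j i)
        - (pairXX L ζ Φ.E i j + pairEE L Φ.E i j)) * ψ) := fun i j => by
    simp only [sub_mul, add_mul]
    abel
  simp only [h3, smul_neg, Finset.sum_neg_distrib, ← smul_mul_assoc, ← Finset.sum_mul]
  rw [sum_skew hA fun i j => pairXX L ζ Φ.E i j + pairEE L Φ.E i j]
  generalize ∑ i, ∑ j, (A i j : ℂ) • (pairXX L ζ Φ.E i j + pairEE L Φ.E i j) = T
  have e : -(1 / 2 : ℂ) • -(2 : ℂ) • T = T := by module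
  rw [e]

theorem omega_expAction (hζ : IsPropagator L ζ) (hA : A.transpose = -A) {ħ : ℝ} (hħ : ħ ≠ 0)
    {Φ : Fields d} (hΦ : IsField L Φ) : omega L A ħ (expAction L ζ A ħ) Φ = 0 := by
  rw [omega, omegaFree_expAction hζ hA hħ hΦ, omegaPert_expAction hζ hA hħ hΦ, add_neg_cancel]

/-! ### Residual fields and backgrounds -/

theorem isEmpty_resIdx (L : L3) : IsEmpty (ResIdx L d) := by
  obtain ⟨h0, h1, h2, -⟩ := L.subsingleton_cohomology
  refine ⟨fun a => ?_⟩
  obtain ⟨⟨k, m⟩, -⟩ := a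
  have : betti L.arcX k = 0 := by
    fin_cases k
    · exact Module.finrank_zero_of_subsingleton
    · exact Module.finrank_zero_of_subsingleton
    · exact Module.finrank_zero_of_subsingleton
  rw [this] at m
  exact m.elim0

theorem bvLaplacian_eq_zero (F : Residual L d → Coef d) (r : Residual L d) :
    bvLaplacian F r = 0 := by
  have := isEmpty_resIdx (d := d) L
  rw [bvLaplacian, Finset.univ_eq_empty, Finset.sum_empty]

theorem extD_const (c : Coef d) (x : Fin d → ℝ) : extD (fun _ => c) x = 0 := by
  simp [extD, (hasWDeriv_const c).wderiv_eq (s := univ) (t := 0) uniqueDiffWithinAt_univ]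


end

end PSM

end

/-! ### The master equation for the disk -/

theorem mainTheorem1 {d : ℕ} (L : PSM.L3) (ζ : ℂ × ℂ → (ℂ × ℂ →L[ℝ] ℝ))
    (hζ : PSM.IsPropagator L ζ) (α : (Fin d → ℝ) → Matrix (Fin d) (Fin d) ℝ)
    (hskew : ∀ x, (α x).transpose = -(α x)) (hconst : ∀ x y, α x = α y)
    (ħ : ℝ) (hħ : ħ ≠ 0) :
    -- there are no residual fields
    (Subsingleton (PSM.H0 L.arcX) ∧ Subsingleton (PSM.H1 L.arcX) ∧ Subsingleton (PSM.H2 L.arcX) ∧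
      Subsingleton (PSM.H0 L.arcB) ∧ Subsingleton (PSM.H1 L.arcB) ∧ Subsingleton (PSM.H2 L.arcB)) ∧
    -- the functional derivatives in the operators exist
    (∀ x r, PSM.IsRegular L (PSM.state L ζ α ħ x r)) ∧
    (∀ x r Φ, PSM.IsField L Φ → ∀ i, ∃ c, PSM.HasWDeriv
      (fun t => PSM.state L ζ α ħ (x + t • Pi.single i 1) r Φ) c univ 0) ∧
    -- the modified differential quantum master equation, and its reduced form
    (∀ x r Φ, PSM.IsField L Φ →
      PSM.quantumGrothendieck L α ħ (PSM.state L ζ α ħ) x r Φ = 0) ∧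
    (∀ x r Φ, PSM.IsField L Φ →
      PSM.omega L (α x) ħ (PSM.state L ζ α ħ x r) Φ = 0) := by
  have hΩ : ∀ x r Φ, PSM.IsField L Φ →
      PSM.omega L (α x) ħ (PSM.state L ζ α ħ x r) Φ = 0 := fun x r Φ hΦ =>
    PSM.omega_expAction hζ (hskew x) hħ hΦ
  -- The background enters only through the constant `α`, so the state is the same at all points and
  -- `d` annihilates it.
  have hx : ∀ x r Φ y, PSM.state L ζ α ħ y r Φ = PSM.state L ζ α ħ x r Φ := fun x r Φ y => by
    simp only [PSM.state, hconst y x]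
  refine ⟨L.subsingleton_cohomology, fun x r => PSM.isRegular_expAction hζ (hskew x) ħ,
    fun x r Φ _ i => ⟨0, ?_⟩, fun x r Φ hΦ => ?_, hΩ⟩
  · simp only [hx x r Φ]
    exact PSM.hasWDeriv_const _
  · rw [PSM.quantumGrothendieck, hΩ x r Φ hΦ, PSM.bvLaplacian_eq_zero]
    simp only [hx x r Φ, PSM.extD_const, smul_zero, add_zero]
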